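/- Consider integer programs of the form $$\min\{c^\intercal x \mid \mathscr{A}x \diamond b,\ x\in\mathbb{Z}_{\ge 0}^{nt}\},\qquad \mathscr{A}=\begin{pmatrix} T^{(1)} & T^{(2)} & \cdots & T^{(n)}\\ \mathbf 1^\intercal & 0 & \cdots & 0\\ 0 & \mathbf 1^\intercal & \cdots & 0\\ \vdots & & \ddots & \vdots\\ 0 & 0 & \cdots & \mathbf 1^\intercal\end{pmatrix},$$ with $T^{(1)},\dots,T^{(n)}\in\mathbb{Z}^{r\times t}$, $\mathbf 1^\intercal=(1,\dots,1)\in\mathbb{Z}^{1\times t}$, $b\in\mathbb{Z}^{r+n}$, $c\in\mathbb{Z}^{nt}$, where $\diamond$ prescribes for each row its own relation: one of $\le,=,\ge$ for each of the first $r$ rows (the globally uniform constraints), and one of $\le,=$ for each of the last $n$ rows (the locally uniform constraints). Let $\Delta$ be the largest absolute value of an entry of $\mathscr{A}$ and let $q$ be the sum of the last $n$ entries of $b$. Then there is a single algorithm which, on every such program (given by $n,r,t,T^{(1)},\dots,T^{(n)},\diamond,b,c$), halts and either outputs an optimal solution or correctly reports that there is no feasible solution, and whose running time is $$O\bigl(q\,r\,t\cdot((n+1)\,\Delta\,(n+2+4r))^{r+1}\bigr)$$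 on all inputs with $q,r,t\ge 1$, the constant in $O(\cdot)$ being absolute. The running time is the number of steps of a random access machine on integers in which additions, subtractions, comparisons, assignments and indirect memory accesses each cost one step (multiplication and division are not available). -/

import Mathlib

/-! ### A unit-cost random access machine

Programs are written with structured control flow.  The machine has registers, each holding an
integer and named by the program text, and a memory of integer cells indexed by `ℕ` that is
accessed indirectly, through an address held in a register.  The arithmetic is addition and
subtraction only (no multiplication or division), and every executed instruction and every
evaluated test costs one step. -/

namespace RAM

structure State where
  reg : ℕ → ℤ
  mem : ℕ → ℤ

/-- Comparison of the contents of two registers. -/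
inductive Test where
  | lt (a b : ℕ)
  | le (a b : ℕ)
  | eq (a b : ℕ)
  | ne (a b : ℕ)

def Test.Holds : Test → State → Prop
  | .lt a b, s => s.reg a < s.reg b
  | .le a b, s => s.reg a ≤ s.reg b
  | .eq a b, s => s.reg a = s.reg b
  | .ne a b, s => s.reg a ≠ s.reg b

/-- Elementary instructions. -/
inductive Instr where
  /-- `R_d := z`, with `z` a constant of the program text -/
  | const (d : ℕ) (z : ℤ)
  /-- `R_d := R_a` -/
  | move (d a : ℕ)
  /-- `R_d := R_a + R_b` -/
  | add (d a b : ℕ)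
  /-- `R_d := R_a - R_b` -/
  | sub (d a b : ℕ)
  /-- `R_d := M[R_a]` -/
  | load (d a : ℕ)
  /-- `M[R_a] := R_b` -/
  | store (a b : ℕ)

/-- The effect of an elementary instruction.  A negative address is read as `0`. -/
def Instr.run : Instr → State → State
  | .const d z, s => { s with reg := Function.update s.reg d z }
  | .move d a, s => { s with reg := Function.update s.reg d (s.reg a) }
  | .add d a b, s => { s with reg := Function.update s.reg d (s.reg a + s.reg b) }
  | .sub d a b, s => { s with reg := Function.update s.reg d (s.reg a - s.reg b) }
  | .load d a, s => { s with reg := Function.update s.reg d (s.mem (s.reg a).toNat) }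
  | .store a b, s => { s with mem := Function.update s.mem (s.reg a).toNat (s.reg b) }

inductive Program where
  | skip
  | instr (i : Instr)
  | seq (p₁ p₂ : Program)
  | ite (c : Test) (p₁ p₂ : Program)
  | loop (c : Test) (p : Program)

/-- `Exec p s k s'`: started in `s`, the program `p` halts after exactly `k` steps, in `s'`. -/
inductive Exec : Program → State → ℕ → State → Prop where
  | skip (s : State) : Exec .skip s 1 s
  | instr (i : Instr) (s : State) : Exec (.instr i) s 1 (i.run s)
  | seq {p₁ p₂ : Program} {s₀ s₁ s₂ : State} {k₁ k₂ : ℕ} :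
      Exec p₁ s₀ k₁ s₁ → Exec p₂ s₁ k₂ s₂ → Exec (.seq p₁ p₂) s₀ (k₁ + k₂) s₂
  | ite_true {c : Test} {p₁ p₂ : Program} {s s' : State} {k : ℕ} :
      c.Holds s → Exec p₁ s k s' → Exec (.ite c p₁ p₂) s (1 + k) s'
  | ite_false {c : Test} {p₁ p₂ : Program} {s s' : State} {k : ℕ} :
      ¬ c.Holds s → Exec p₂ s k s' → Exec (.ite c p₁ p₂) s (1 + k) s'
  | loop_false {c : Test} {p : Program} {s : State} :
      ¬ c.Holds s → Exec (.loop c p) s 1 s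
  | loop_true {c : Test} {p : Program} {s₀ s₁ s₂ : State} {k₁ k₂ : ℕ} :
      c.Holds s₀ → Exec p s₀ k₁ s₁ → Exec (.loop c p) s₁ k₂ s₂ →
        Exec (.loop c p) s₀ (1 + k₁ + k₂) s₂

/-- The initial state on an input word: the word is at the memory addresses `0, 1, 2, …`,
everything else is `0`. -/
def init (w : List ℤ) : State where
  reg := fun _ => 0
  mem := fun a => w.getD a 0

end RAM

/-! ### The integer programs -/

/-- The relation of a single constraint. -/
inductive ConstraintRel where
  | le
  | eq
  | ge

def ConstraintRel.Holds : ConstraintRel → ℤ → ℤ → Prop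
  | .le, x, y => x ≤ y
  | .eq, x, y => x = y
  | .ge, x, y => x ≥ y

def ConstraintRel.code : ConstraintRel → ℤ
  | .le => -1
  | .eq => 0
  | .ge => 1

/-- An instance `min { cᵀ x ∣ 𝒜 x ⋄ b, x ∈ ℤ_{≥ 0}^{nt} }`.  Rows are indexed by
`Fin r ⊕ Fin n` (the `r` globally uniform, then the `n` locally uniform constraints) and
variables by `Fin n × Fin t` (brick, index within the brick). -/
structure NFold where
  n : ℕ
  r : ℕ
  t : ℕ
  /-- the top blocks -/
  T : Fin n → Matrix (Fin r) (Fin t) ℤ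
  b : Fin r ⊕ Fin n → ℤ
  c : Fin n × Fin t → ℤ
  /-- the sequence `⋄` -/
  rel : Fin r ⊕ Fin n → ConstraintRel
  /-- locally uniform constraints use only `≤` and `=` -/
  rel_local : ∀ i, rel (Sum.inr i) ≠ ConstraintRel.ge

namespace NFold

/-- The constraint matrix `𝒜`, with the top blocks side by side above the diagonal blocks
`(1, …, 1)`. -/
def A (I : NFold) : Matrix (Fin I.r ⊕ Fin I.n) (Fin I.n × Fin I.t) ℤ :=
  Matrix.fromRows (Matrix.of fun k p => I.T p.1 k p.2)
    (Matrix.of fun i p => if p.1 = i then 1 else 0)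

/-- The largest absolute value of an entry of `𝒜`. -/
def Δ (I : NFold) : ℕ :=
  Finset.univ.sup fun p : (Fin I.r ⊕ Fin I.n) × (Fin I.n × Fin I.t) => (I.A p.1 p.2).natAbs

/-- The sum of the right-hand sides of the locally uniform constraints. -/
def q (I : NFold) : ℤ := ∑ i, I.b (Sum.inr i)

def Feasible (I : NFold) (x : Fin I.n × Fin I.t → ℤ) : Prop :=
  (∀ p, 0 ≤ x p) ∧ ∀ i, (I.rel i).Holds (I.A.mulVec x i) (I.b i)

def IsOptimal (I : NFold) (x : Fin I.n × Fin I.t → ℤ) : Prop :=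
  I.Feasible x ∧ ∀ y, I.Feasible y → I.c ⬝ᵥ x ≤ I.c ⬝ᵥ y

/-- The input word: `n, r, t`, the entries of `(T⁽¹⁾ ⋯ T⁽ⁿ⁾)` column by column, the codes of the
relations, the vector `b`, the vector `c`. -/
def encode (I : NFold) : List ℤ :=
  [(I.n : ℤ), (I.r : ℤ), (I.t : ℤ)]
    ++ (List.ofFn fun i => (List.ofFn fun j => List.ofFn fun k => I.T i k j).flatten).flatten
    ++ (List.ofFn fun k => (I.rel (Sum.inl k)).code)
    ++ (List.ofFn fun i => (I.rel (Sum.inr i)).code)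
    ++ (List.ofFn fun k => I.b (Sum.inl k))
    ++ (List.ofFn fun i => I.b (Sum.inr i))
    ++ (List.ofFn fun i => List.ofFn fun j => I.c (i, j)).flatten

/-- The vector found in the memory at the addresses `0, …, nt - 1`, brick after brick. -/
def output (I : NFold) (s : RAM.State) : Fin I.n × Fin I.t → ℤ :=
  fun p => s.mem ((p.1 : ℕ) * I.t + (p.2 : ℕ))

/-- The final state `s` answers the instance: either register `0` holds `1` and the output is
an optimal solution, or register `0` holds `0` and there is no feasible solution. -/
def Answers (I : NFold) (s : RAM.State) : Prop :=
  (s.reg 0 = 1 ∧ I.IsOptimal (I.output s)) ∨ (s.reg 0 = 0 ∧ ¬ ∃ x, I.Feasible x)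

end NFold

/-! A feasible solution is a multiset of columns. After zero columns have been added in the bricks
whose local row is `≤`, brick `i` contributes exactly as many items as its local right-hand side
says, `q` in all. Any order of the items is a walk of `q` steps in `ℤ^r` from zero to the left-hand
side of the global rows. The aim is an order in which the walk stays near the segment joining its
ends and in which the brick used at each time does not depend on the solution. The local constraints
then hold automatically, and a dynamic program has to remember only `r` coordinates.

The Steinitz lemma with the Grinberg–Sevastyanov constant (`steinitz`) orders vectors of `ℝ^d` with
sum zero so that all partial sums are at most `d` times the largest entry. In the form
`steinitz_int` it orders the items inside each brick, with deviation at most `2 * r * D` from the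
brick's own segment, where `D` bounds the entries. The bricks are interleaved by an apportionment
rule `sel`, which serves a brick that is behind its proportional share. No brick gets ahead of its
share by a full item, and the deficits sum to zero, so the interleaving costs at most `2 * n * D` in
total. Hence the walk stays in a corridor of half-width `H = 2 * n * (r + 1) * D`
(`Feasible.exists_sequence`).

In an inequality row the slack could be spread evenly over the steps. The program need not know it:
it lifts a coordinate only when it would leave the corridor at the lower edge, and in the last step
up to the centre. The lifted walk never exceeds the one with evenly spread slack, so it also stays
in the corridor (`Feasible.exists_path`). Conversely, a walk in the corridor that ends in the centre
counts up to a feasible solution (`Valid.feasible_count`).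

Optimal solutions are therefore cheapest paths in a layered graph with `W ^ r` nodes per layer, `W =
2 * H + 1`, and at most `t + 1` arcs per node. The invariants `Linked` (every entry comes from a
path) and `Complete` (every arc was tried) prove the table correct. One arc costs `O(r * W)`,
because the number of the new node is computed by Horner's rule with multiplication by repeated
addition. Over `q` layers this gives `O(q * r * t * W ^ (r + 1))`, and `W` is at most the base in
the claimed bound. -/

/-! ### The Steinitz lemma -/

section Steinitz

variable {ι : Type*} {d : ℕ}

/-- A linear relation, with coefficient sum zero, among more than `d + 1` vectors of dimension `d`. -/
theorem exists_affine_relation [Fintype ι] [DecidableEq ι] (v : ι → Fin d → ℝ) (F : Finset ι) (hF : d + 1 < F.card) :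
    ∃ w : ι → ℝ, w ≠ 0 ∧ (∀ i ∉ F, w i = 0) ∧ ∑ i, w i = 0 ∧ ∀ c, ∑ i, w i * v i c = 0 := by
  let f : (ι → ℝ) →ₗ[ℝ] (Fin d → ℝ) × ℝ × ({i // i ∉ F} → ℝ) :=
    { toFun := fun w => (fun c => ∑ i, w i * v i c, ∑ i, w i, fun i => w i)
      map_add' := fun a b => by
        ext <;> simp [add_mul, Finset.sum_add_distrib]
      map_smul' := fun a b => by
        ext <;> simp [mul_assoc, Finset.mul_sum] }
  have hker : LinearMap.ker f ≠ ⊥ := by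
    apply LinearMap.ker_ne_bot_of_finrank_lt
    have h1 : Fintype.card {i // i ∉ F} = Fintype.card ι - F.card := by
      rw [Fintype.card_subtype_compl]; simp
    have h2 := F.card_le_univ
    simp only [Module.finrank_prod, Module.finrank_fintype_fun_eq_card, Module.finrank_self,
      Fintype.card_fin, h1]
    omega
  obtain ⟨w, hw, hw0⟩ := Submodule.exists_mem_ne_zero_of_ne_bot hker
  have hw' : f w = 0 := hw
  refine ⟨w, hw0, fun i hi => ?_, ?_, fun c => ?_⟩
  · exact congrFun (congrArg (fun z => z.2.2) hw') ⟨i, hi⟩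
  · exact congrArg (fun z => z.2.1) hw'
  · exact congrFun (congrArg (fun z => z.1) hw') c

/-- The weights used in the Grinberg–Sevastyanov argument. -/
structure SteinitzWeight [Fintype ι] (v : ι → Fin d → ℝ) (A : Finset ι) (σ : ℝ) (μ : ι → ℝ) : Prop where
  nonneg : ∀ i, 0 ≤ μ i
  le_one : ∀ i, μ i ≤ 1
  off : ∀ i ∉ A, μ i = 0
  sum : ∑ i, μ i = σ
  comb : ∀ c, ∑ i, μ i * v i c = 0

theorem isCompact_steinitzWeight [Fintype ι] (v : ι → Fin d → ℝ) (A : Finset ι) (σ : ℝ) :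
    IsCompact {μ | SteinitzWeight v A σ μ} := by
  have hc : IsCompact (Set.pi Set.univ fun _ : ι => Set.Icc (0 : ℝ) 1) :=
    isCompact_univ_pi fun _ => isCompact_Icc
  refine hc.of_isClosed_subset ?_ fun μ h i _ => ⟨h.nonneg i, h.le_one i⟩
  have : {μ | SteinitzWeight v A σ μ} =
      {μ : ι → ℝ | ∀ i, 0 ≤ μ i} ∩ {μ | ∀ i, μ i ≤ 1} ∩ {μ | ∀ i ∉ A, μ i = 0} ∩
        {μ | ∑ i, μ i = σ} ∩ {μ | ∀ c, ∑ i, μ i * v i c = 0} := by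
    ext μ
    exact ⟨fun h => ⟨⟨⟨⟨h.1, h.2⟩, h.3⟩, h.4⟩, h.5⟩, fun h => ⟨h.1.1.1.1, h.1.1.1.2, h.1.1.2, h.1.2, h.2⟩⟩
  rw [this]
  simp only [Set.ofPred_forall]
  refine IsClosed.inter (IsClosed.inter (IsClosed.inter (IsClosed.inter ?_ ?_) ?_) ?_) ?_
  · exact isClosed_iInter fun i => isClosed_le continuous_const (by fun_prop)
  · exact isClosed_iInter fun i => isClosed_le (by fun_prop) continuous_const
  · exact isClosed_iInter fun i => isClosed_iInter fun _ => isClosed_eq (by fun_prop) continuous_const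
  · exact isClosed_eq (by fun_prop) continuous_const
  · exact isClosed_iInter fun i => isClosed_eq (by fun_prop) continuous_const

/-- An extreme weight has at most `d + 1` fractional entries. -/
theorem card_fractional_le [Fintype ι] [DecidableEq ι] (v : ι → Fin d → ℝ) (A : Finset ι) (σ : ℝ) (μ : ι → ℝ)
    (hμ : μ ∈ Set.extremePoints ℝ {μ | SteinitzWeight v A σ μ}) :
    (A.filter fun i => 0 < μ i ∧ μ i < 1).card ≤ d + 1 := by
  by_contra! hcard
  obtain ⟨w, hw0, hwF, hws, hwv⟩ := exists_affine_relation v _ hcard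
  have hm : SteinitzWeight v A σ μ := hμ.1
  -- Fractional entries tolerate a small perturbation, and `w` vanishes on all the others.
  have hev : ∀ᶠ ε in nhds (0 : ℝ), ∀ i, 0 ≤ μ i + ε * w i ∧ μ i + ε * w i ≤ 1 := by
    rw [Filter.eventually_all]
    intro i
    by_cases hi : i ∈ A.filter fun i => 0 < μ i ∧ μ i < 1
    · have hi' := (Finset.mem_filter.1 hi).2
      have hcont : Filter.Tendsto (fun ε : ℝ => μ i + ε * w i) (nhds 0) (nhds (μ i)) := by
        have : Continuous fun ε : ℝ => μ i + ε * w i := by fun_prop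
        simpa using this.tendsto 0
      filter_upwards [hcont.eventually (lt_mem_nhds hi'.1), hcont.eventually (gt_mem_nhds hi'.2)]
        with ε h1 h2
      exact ⟨h1.le, h2.le⟩
    · rw [hwF i hi]
      simp [hm.nonneg i, hm.le_one i]
  obtain ⟨δ, hδ, hball⟩ := Metric.eventually_nhds_iff.1 hev
  have key : ∀ ε : ℝ, |ε| < δ → SteinitzWeight v A σ (fun i => μ i + ε * w i) := by
    intro ε hε
    have := hball (y := ε) (by simpa using hε)
    refine ⟨fun i => (this i).1, fun i => (this i).2, fun i hi => ?_, ?_, fun c => ?_⟩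
    · rw [hm.off i hi, hwF i (by simp [hi])]; simp
    · rw [Finset.sum_add_distrib, ← Finset.mul_sum, hws, hm.sum]; simp
    · simp only [add_mul, mul_assoc]
      rw [Finset.sum_add_distrib, ← Finset.mul_sum, hwv, hm.comb]; simp
  have hp := key (δ / 2) (by rw [abs_of_pos (by positivity)]; linarith)
  have hn := key (-(δ / 2)) (by rw [abs_neg, abs_of_pos (by positivity)]; linarith)
  -- `μ` is the midpoint of the two perturbed weights, so extremality forces the perturbation to be
  -- zero.
  have := hμ.2 hp hn ⟨1 / 2, 1 / 2, by norm_num, by norm_num, by norm_num, by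
    ext i; simp only [Pi.add_apply, Pi.smul_apply, smul_eq_mul]; ring⟩
  apply hw0
  ext i
  have h1 := congrFun this i
  have : δ / 2 * w i = 0 := by simpa using h1
  rcases mul_eq_zero.1 this with h | h
  · linarith
  · simpa using h

/-- Scaling the weights down lowers their total to `k - d`. An extreme point among the weights with
this total has at most `d + 1` fractional entries, and the total is then too small for all `k + 1`
entries to be positive. An index of weight zero can be dropped. -/
theorem SteinitzWeight.exists_erase [Fintype ι] [DecidableEq ι] {v : ι → Fin d → ℝ} {A : Finset ι} {k : ℕ}
    (hA : A.card = k + 1) (hk : d ≤ k) {μ : ι → ℝ} (hμ : SteinitzWeight v A ((k : ℝ) + 1 - d) μ) :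
    ∃ x ∈ A, ∃ ν, SteinitzWeight v (A.erase x) ((k : ℝ) - d) ν := by
  have hk' : (d : ℝ) ≤ k := by exact_mod_cast hk
  have hne : {μ | SteinitzWeight v A ((k : ℝ) - d) μ}.Nonempty := by
    have hc0 : 0 ≤ ((k : ℝ) - d) / (k + 1 - d) := div_nonneg (by linarith) (by linarith)
    have hc1 : ((k : ℝ) - d) / (k + 1 - d) ≤ 1 := by rw [div_le_one (by linarith)]; linarith
    refine ⟨fun i => ((k : ℝ) - d) / (k + 1 - d) * μ i, fun i => mul_nonneg hc0 (hμ.nonneg i),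
      fun i => mul_le_one₀ hc1 (hμ.nonneg i) (hμ.le_one i), fun i hi => by simp [hμ.off i hi], ?_,
      fun c => ?_⟩
    · rw [← Finset.mul_sum, hμ.sum, div_mul_cancel₀]; linarith
    · simp only [mul_assoc]
      rw [← Finset.mul_sum, hμ.comb, mul_zero]
  obtain ⟨ν, hν⟩ := (isCompact_steinitzWeight v A ((k : ℝ) - d)).extremePoints_nonempty hne
  have hm : SteinitzWeight v A ((k : ℝ) - d) ν := hν.1
  have hcard := card_fractional_le v A _ ν hν
  -- If no entry vanished, all entries outside the fractional set `F` would be one. There are at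
  -- least `k - d` of these, and a nonempty `F` adds a positive amount; if `F` is empty, the total
  -- is `k + 1`. Either way it exceeds `k - d`.
  obtain ⟨x, hx, hx0⟩ : ∃ x ∈ A, ν x = 0 := by
    by_contra! hpos
    have hpos : ∀ x ∈ A, 0 < ν x := fun x hx => lt_of_le_of_ne (hm.nonneg x) (hpos x hx).symm
    set F := A.filter fun i => 0 < ν i ∧ ν i < 1 with hF
    have hsub : F ⊆ A := Finset.filter_subset _ _
    have hsum : ∑ i ∈ A, ν i = k - d := by
      rw [← hm.sum]
      exact Finset.sum_subset A.subset_univ fun i _ hi => hm.off i hi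
    have hone : ∑ i ∈ A \ F, ν i = (A \ F).card := by
      rw [Finset.card_eq_sum_ones, Nat.cast_sum]
      refine Finset.sum_congr rfl fun i hi => ?_
      rw [Finset.mem_sdiff, hF, Finset.mem_filter] at hi
      have := hm.le_one i
      have h2 := hpos i hi.1
      by_contra hne
      exact hi.2 ⟨hi.1, h2, lt_of_le_of_ne this (by simpa using hne)⟩
    rw [← Finset.sum_sdiff hsub, hone] at hsum
    have hcs := Finset.card_sdiff_add_card_eq_card hsub
    rcases F.eq_empty_or_nonempty with he | hne
    · rw [he] at hsum hcs
      simp only [Finset.sdiff_empty, Finset.sum_empty, hA] at hsum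
      push_cast at hsum
      have : (0 : ℝ) ≤ d := Nat.cast_nonneg d
      linarith
    · have h3 : 0 < ∑ i ∈ F, ν i := Finset.sum_pos (fun i hi => hpos i (hsub hi)) hne
      have h4 : k - d ≤ (A \ F).card := by omega
      have h5 : ((k - d : ℕ) : ℝ) ≤ (A \ F).card := by exact_mod_cast h4
      rw [Nat.cast_sub hk] at h5
      linarith
  refine ⟨x, hx, ν, hm.nonneg, hm.le_one, fun i hi => ?_, hm.sum, hm.comb⟩
  by_cases hix : i = x
  · rw [hix, hx0]
  · exact hm.off i fun h => hi (Finset.mem_erase.2 ⟨hix, h⟩)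

/-- The weighted sum of the vectors is zero, so weighting with `1 - μ` does not change their plain
sum; these weights are nonnegative with total `d`. -/
theorem SteinitzWeight.abs_sum_le [Fintype ι] {v : ι → Fin d → ℝ} {M : ℝ} (hv : ∀ i c, |v i c| ≤ M)
    {A : Finset ι} {μ : ι → ℝ} (hμ : SteinitzWeight v A ((A.card : ℝ) - d) μ) (c : Fin d) :
    |∑ i ∈ A, v i c| ≤ d * M := by
  have h1 : ∑ i ∈ A, μ i = A.card - d := by
    rw [← hμ.sum]
    exact Finset.sum_subset A.subset_univ fun i _ hi => hμ.off i hi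
  have h2 : ∑ i ∈ A, μ i * v i c = 0 := by
    rw [← hμ.comb c]
    exact Finset.sum_subset A.subset_univ fun i _ hi => by rw [hμ.off i hi, zero_mul]
  have h3 : ∑ i ∈ A, v i c = ∑ i ∈ A, (1 - μ i) * v i c := by
    simp only [sub_mul, one_mul, Finset.sum_sub_distrib, h2, sub_zero]
  rw [h3]
  calc |∑ i ∈ A, (1 - μ i) * v i c| ≤ ∑ i ∈ A, |(1 - μ i) * v i c| := Finset.abs_sum_le_sum_abs _ _
    _ ≤ ∑ i ∈ A, (1 - μ i) * M := by
        refine Finset.sum_le_sum fun i _ => ?_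
        have := hμ.le_one i
        rw [abs_mul, abs_of_nonneg (by linarith)]
        exact mul_le_mul_of_nonneg_left (hv i c) (by linarith)
    _ = d * M := by
        rw [← Finset.sum_mul, Finset.sum_sub_distrib, h1]; simp

/-- By the triangle inequality any order of at most `d` vectors will do; the induction stops here.
-/
theorem exists_list_of_card_le [DecidableEq ι] {v : ι → Fin d → ℝ} {M : ℝ} (hM : 0 ≤ M)
    (hv : ∀ i c, |v i c| ≤ M) (A : Finset ι) (hA : A.card ≤ d) :
    ∃ l : List ι, l.Nodup ∧ l.toFinset = A ∧
      ∀ m c, |((l.take m).map fun i => v i c).sum| ≤ d * M := by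
  refine ⟨A.toList, A.nodup_toList, A.toList_toFinset, fun m c => ?_⟩
  have h1 : ∀ l : List ι, |(l.map fun i => v i c).sum| ≤ l.length * M := by
    intro l
    induction l with
    | nil => simp
    | cons x l ih =>
      simp only [List.map_cons, List.sum_cons, List.length_cons, Nat.cast_add, Nat.cast_one]
      have := abs_add_le (v x c) (l.map fun i => v i c).sum
      have := hv x c
      linarith
  refine (h1 _).trans (mul_le_mul_of_nonneg_right ?_ hM)
  have : (A.toList.take m).length ≤ d := by
    rw [List.length_take, Finset.length_toList]; omega
  exact_mod_cast this

/-- The order is built from its end: the erased index comes last, and the remaining set carries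
weights again. So every prefix either carries weights, and `SteinitzWeight.abs_sum_le` applies, or
has at most `d` elements. -/
theorem SteinitzWeight.exists_list [Fintype ι] [DecidableEq ι] {v : ι → Fin d → ℝ} {M : ℝ} (hM : 0 ≤ M)
    (hv : ∀ i c, |v i c| ≤ M) (k : ℕ) (A : Finset ι) (hA : A.card = k) (hk : d ≤ k) {μ : ι → ℝ}
    (hμ : SteinitzWeight v A ((k : ℝ) - d) μ) :
    ∃ l : List ι, l.Nodup ∧ l.toFinset = A ∧
      ∀ m c, |((l.take m).map fun i => v i c).sum| ≤ d * M := by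
  induction k generalizing A μ with
  | zero => exact exists_list_of_card_le hM hv A (by omega)
  | succ k ih =>
    rcases hk.eq_or_lt with h | h
    · exact exists_list_of_card_le hM hv A (by omega)
    · have hμ' : SteinitzWeight v A ((A.card : ℝ) - d) μ := by rw [hA]; exact hμ
      obtain ⟨x, hx, ν, hν⟩ := SteinitzWeight.exists_erase hA (Nat.lt_succ_iff.1 h)
        (by push_cast at hμ; exact hμ)
      obtain ⟨l, hl, hlA, hlm⟩ := ih (A.erase x)
        (by rw [Finset.card_erase_of_mem hx, hA]; rfl) (Nat.lt_succ_iff.1 h) hν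
      have hxl : x ∉ l := fun hxl => by
        have : x ∈ A.erase x := hlA ▸ List.mem_toFinset.2 hxl
        simp at this
      have hnd : (l ++ [x]).Nodup := by
        rw [List.nodup_append]
        exact ⟨hl, List.nodup_singleton x, fun a ha b hb h =>
          hxl (by rw [← List.mem_singleton.1 hb, ← h]; exact ha)⟩
      have htf : (l ++ [x]).toFinset = A := by
        ext y
        have : y ∈ l ↔ y ∈ A.erase x := by rw [← hlA, List.mem_toFinset]
        simp only [List.mem_toFinset, List.mem_append, this, Finset.mem_erase, List.mem_singleton]
        by_cases h : y = x <;> simp [h, hx]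
      refine ⟨l ++ [x], hnd, htf, fun m c => ?_⟩
      rcases Nat.lt_or_ge l.length m with hm | hm
      · rw [List.take_of_length_le (by simp; omega)]
        have := SteinitzWeight.abs_sum_le hv hμ' c
        rwa [← htf, List.sum_toFinset _ hnd] at this
      · rw [List.take_append_of_le_length hm]
        exact hlm m c

end Steinitz

/-- **Steinitz lemma**, in the maximum norm and with the Grinberg–Sevastyanov constant. -/
theorem steinitz {d : ℕ} {α : Type*} (l : List α) (v : α → Fin d → ℝ) (M : ℝ) (hM : 0 ≤ M)
    (hv : ∀ a ∈ l, ∀ c, |v a c| ≤ M) (h0 : ∀ c, (l.map fun a => v a c).sum = 0) :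
    ∃ l' : List α, l'.Perm l ∧ ∀ m c, |((l'.take m).map fun a => v a c).sum| ≤ d * M := by
  -- Positions are permuted instead of elements, since the list may have repetitions.
  let u : Fin l.length → Fin d → ℝ := fun i => v l[i]
  have hu : ∀ i c, |u i c| ≤ M := fun i c => hv _ (List.getElem_mem _) c
  have huniv : ∀ c, ∑ i, u i c = 0 := fun c => by
    rw [← h0 c, ← Fin.sum_univ_getElem]
    simp only [u, List.getElem_map, Fin.getElem_fin]
    exact Fintype.sum_equiv (finCongr (by simp)) _ _ fun i => rfl
  obtain ⟨p, hp, hpu, hpm⟩ : ∃ p : List (Fin l.length), p.Nodup ∧ p.toFinset = Finset.univ ∧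
      ∀ m c, |((p.take m).map fun i => u i c).sum| ≤ d * M := by
    rcases Nat.lt_or_ge l.length d with hlt | hge
    · exact exists_list_of_card_le hM hu Finset.univ (by simp; omega)
    · rcases Nat.eq_zero_or_pos l.length with hl0 | hpos
      · exact exists_list_of_card_le hM hu Finset.univ (by simp [hl0])
      have hpos' : (0 : ℝ) < l.length := by exact_mod_cast hpos
      have hge' : (d : ℝ) ≤ l.length := by exact_mod_cast hge
      -- Constant weights are admissible at the start because the vectors sum to zero.
      refine SteinitzWeight.exists_list (μ := fun _ => ((l.length : ℝ) - d) / l.length) hM hu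
        l.length Finset.univ (by simp) hge ⟨fun _ => ?_, fun _ => ?_, by simp, ?_, fun c => ?_⟩
      · exact div_nonneg (by linarith) hpos'.le
      · rw [div_le_one hpos']
        have : (0 : ℝ) ≤ d := Nat.cast_nonneg d
        linarith
      · simp only [Finset.sum_const, Finset.card_univ, Fintype.card_fin, nsmul_eq_mul]
        field_simp
      · rw [← Finset.mul_sum, huniv, mul_zero]
  refine ⟨p.map l.get, ?_, fun m c => ?_⟩
  · have h1 : p.Perm (List.finRange l.length) :=
      (List.perm_ext_iff_of_nodup hp (List.nodup_finRange _)).2 fun i => by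
        rw [← List.mem_toFinset, hpu]; simp
    have := h1.map l.get
    rwa [List.map_get_finRange] at this
  · rw [← List.map_take, List.map_map]
    exact hpm m c

/-! ### Total correctness of machine programs -/

namespace RAM

/-- The state with one register changed. -/
def State.set (s : State) (i : ℕ) (v : ℤ) : State := { s with reg := Function.update s.reg i v }

/-- The state with one memory cell changed. -/
def State.put (s : State) (a : ℕ) (v : ℤ) : State := { s with mem := Function.update s.mem a v }

@[simp] theorem State.set_mem (s : State) (i : ℕ) (v : ℤ) : (s.set i v).mem = s.mem := rfl

@[simp] theorem State.put_reg (s : State) (a : ℕ) (v : ℤ) : (s.put a v).reg = s.reg := rfl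

theorem State.set_reg (s : State) (i : ℕ) (v : ℤ) (x : ℕ) :
    (s.set i v).reg x = if x = i then v else s.reg x := by
  simp [State.set, Function.update_apply]

theorem State.put_mem (s : State) (a : ℕ) (v : ℤ) (x : ℕ) :
    (s.put a v).mem x = if x = a then v else s.mem x := by
  simp [State.put, Function.update_apply]

theorem State.ext' {s s' : State} (hr : ∀ x, s.reg x = s'.reg x) (hm : s.mem = s'.mem) : s = s' := by
  cases s; cases s'
  simp only [State.mk.injEq]
  exact ⟨funext hr, hm⟩

/-- Whether an instruction writes a register. -/
def Instr.writes : Instr → ℕ → Bool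
  | .const d _, x => x == d
  | .move d _, x => x == d
  | .add d _ _, x => x == d
  | .sub d _ _, x => x == d
  | .load d _, x => x == d
  | .store _ _, _ => false

/-- Whether a program contains an instruction that writes a register. -/
def Program.writes : Program → ℕ → Bool
  | .skip, _ => false
  | .instr i, x => i.writes x
  | .seq p₁ p₂, x => p₁.writes x || p₂.writes x
  | .ite _ p₁ p₂, x => p₁.writes x || p₂.writes x
  | .loop _ p, x => p.writes x

/-- Whether an instruction writes to the memory. -/
def Instr.stores : Instr → Bool
  | .store _ _ => true
  | _ => false

/-- Whether a program contains an instruction that writes to the memory. -/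
def Program.stores : Program → Bool
  | .skip => false
  | .instr i => i.stores
  | .seq p₁ p₂ => p₁.stores || p₂.stores
  | .ite _ p₁ p₂ => p₁.stores || p₂.stores
  | .loop _ p => p.stores

/-- The frame condition is syntactic: for a concrete program it is settled by evaluation, so
specifications need only mention what changes. -/
theorem Exec.reg_eq {p : Program} {s s' : State} {k : ℕ} (h : Exec p s k s') {x : ℕ}
    (hx : p.writes x = false) : s'.reg x = s.reg x := by
  induction h with
  | skip => rfl
  | instr i s =>
    cases i <;> simp_all [Program.writes, Instr.writes, Instr.run]
  | seq _ _ ih₁ ih₂ =>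
    simp only [Program.writes, Bool.or_eq_false_iff] at hx
    rw [ih₂ hx.2, ih₁ hx.1]
  | ite_true _ _ ih =>
    simp only [Program.writes, Bool.or_eq_false_iff] at hx
    exact ih hx.1
  | ite_false _ _ ih =>
    simp only [Program.writes, Bool.or_eq_false_iff] at hx
    exact ih hx.2
  | loop_false => rfl
  | loop_true _ _ _ ih₁ ih₂ => rw [ih₂ hx, ih₁ hx]

theorem Exec.mem_eq {p : Program} {s s' : State} {k : ℕ} (h : Exec p s k s')
    (hx : p.stores = false) : s'.mem = s.mem := by
  induction h with
  | skip => rfl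
  | instr i s => cases i <;> simp_all [Program.stores, Instr.stores, Instr.run]
  | seq _ _ ih₁ ih₂ =>
    simp only [Program.stores, Bool.or_eq_false_iff] at hx
    rw [ih₂ hx.2, ih₁ hx.1]
  | ite_true _ _ ih =>
    simp only [Program.stores, Bool.or_eq_false_iff] at hx
    exact ih hx.1
  | ite_false _ _ ih =>
    simp only [Program.stores, Bool.or_eq_false_iff] at hx
    exact ih hx.2
  | loop_false => rfl
  | loop_true _ _ _ ih₁ ih₂ => rw [ih₂ hx, ih₁ hx]

/-- `p` halts when started in `s`, and the number of steps and the final state satisfy `Q`. -/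
def Runs (p : Program) (s : State) (Q : ℕ → State → Prop) : Prop :=
  ∃ k s', Exec p s k s' ∧ Q k s'

section Rules

variable {p p₁ p₂ : Program} {s : State} {Q Q' : ℕ → State → Prop}

theorem Runs.mono (h : Runs p s Q) (hQ : ∀ k s', Q k s' → Q' k s') : Runs p s Q' := by
  obtain ⟨k, s', he, hq⟩ := h
  exact ⟨k, s', he, hQ _ _ hq⟩

/-- What a program does not write is unchanged. -/
theorem Runs.frame (h : Runs p s Q) :
    Runs p s fun k s' => Q k s' ∧ (∀ x, p.writes x = false → s'.reg x = s.reg x) ∧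
      (p.stores = false → s'.mem = s.mem) := by
  obtain ⟨k, s', he, hq⟩ := h
  exact ⟨k, s', he, hq, fun _ hx => he.reg_eq hx, he.mem_eq⟩

theorem Runs.seq (h : Runs p₁ s fun k₁ s₁ => Runs p₂ s₁ fun k₂ s₂ => Q (k₁ + k₂) s₂) :
    Runs (.seq p₁ p₂) s Q := by
  obtain ⟨k₁, s₁, h₁, k₂, s₂, h₂, hQ⟩ := h
  exact ⟨_, _, .seq h₁ h₂, hQ⟩

/-- Run the first program by its specification, keep its frame, and go on. -/
theorem Runs.then (h₁ : Runs p₁ s Q')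
    (h₂ : ∀ k₁ s₁, Q' k₁ s₁ → (∀ x, p₁.writes x = false → s₁.reg x = s.reg x) →
      (p₁.stores = false → s₁.mem = s.mem) → Runs p₂ s₁ fun k₂ s₂ => Q (k₁ + k₂) s₂) :
    Runs (.seq p₁ p₂) s Q :=
  Runs.seq (h₁.frame.mono fun k s' h => h₂ k s' h.1 h.2.1 h.2.2)

theorem Runs.ite {c : Test} (ht : c.Holds s → Runs p₁ s fun k s' => Q (1 + k) s')
    (hf : ¬ c.Holds s → Runs p₂ s fun k s' => Q (1 + k) s') : Runs (.ite c p₁ p₂) s Q := by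
  by_cases h : c.Holds s
  · obtain ⟨k, s', he, hq⟩ := ht h
    exact ⟨_, _, .ite_true h he, hq⟩
  · obtain ⟨k, s', he, hq⟩ := hf h
    exact ⟨_, _, .ite_false h he, hq⟩

theorem Runs.skip (h : Q 1 s) : Runs .skip s Q := ⟨_, _, .skip s, h⟩

theorem Runs.instr {i : Instr} (h : Q 1 (i.run s)) : Runs (.instr i) s Q := ⟨_, _, .instr i s, h⟩

/-- A loop that makes exactly `n` rounds of at most `K` steps each. -/
theorem Runs.loop {c : Test} {n K : ℕ} (Inv : ℕ → State → Prop) (h0 : Inv 0 s)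
    (hstep : ∀ j < n, ∀ s', Inv j s' → c.Holds s' ∧ Runs p s' fun k s'' => k ≤ K ∧ Inv (j + 1) s'')
    (hend : ∀ s', Inv n s' → ¬ c.Holds s') :
    Runs (.loop c p) s fun k s' => k ≤ n * (K + 1) + 1 ∧ Inv n s' := by
  suffices H : ∀ m j s, j + m = n → Inv j s →
      Runs (.loop c p) s fun k s' => k ≤ m * (K + 1) + 1 ∧ Inv n s' from H n 0 s (by simp) h0
  intro m
  induction m with
  | zero =>
    intro j s hj hs
    obtain rfl : j = n := by omega
    exact ⟨_, _, .loop_false (hend s hs), by simp, hs⟩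
  | succ m ih =>
    intro j s hj hs
    obtain ⟨hc, k₁, s₁, he₁, hk₁, hi₁⟩ := hstep j (by omega) s hs
    obtain ⟨k₂, s₂, he₂, hk₂, hi₂⟩ := ih (j + 1) s₁ (by omega) hi₁
    exact ⟨_, _, .loop_true hc he₁ he₂, by rw [add_mul]; omega, hi₂⟩

end Rules

/-- Sequential composition. -/
infixr:60 " ⨾ " => Program.seq

/-- A straight line program. -/
def block : List Instr → Program
  | [] => .skip
  | i :: l => .instr i ⨾ block l

theorem Runs.block {l : List Instr} {s : State} {Q : ℕ → State → Prop}
    (h : Q (l.length + 1) (l.foldl (fun s i => i.run s) s)) : Runs (block l) s Q := by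
  induction l generalizing s Q with
  | nil => exact ⟨_, _, .skip s, h⟩
  | cons i l ih =>
    refine Runs.seq (Runs.instr (ih ?_))
    rw [List.length_cons] at h
    rw [show 1 + (l.length + 1) = l.length + 1 + 1 by omega]
    exact h

/-- Counting loop: register `i` runs from `0` to the content of register `b`; register `1` is
assumed to hold `1`. -/
def Program.for (i b : ℕ) (p : Program) : Program :=
  .instr (.const i 0) ⨾ .loop (.lt i b) (p ⨾ .instr (.add i i 1))

/-- The invariant describes the state at the start of round `j`, when the counter already equals
`j`. A round costs at most `K` steps for the body, one for the increment and one for the test; the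
two extra steps are the initialization and the final test. -/
theorem Runs.for {i b : ℕ} {p : Program} {s₀ : State} {n K : ℕ} (Inv : ℕ → State → Prop)
    (h1 : s₀.reg 1 = 1) (hb : s₀.reg b = n)
    (hw : p.writes i = false ∧ p.writes b = false ∧ p.writes 1 = false ∧ b ≠ i ∧ 1 ≠ i)
    (h0 : Inv 0 (s₀.set i 0))
    (hstep : ∀ j : ℕ, j < n → ∀ s : State, (∀ x, p.writes x = false → x ≠ i → s.reg x = s₀.reg x) →
      (p.stores = false → s.mem = s₀.mem) → s.reg i = j → Inv j s →
      Runs p s fun k s' => k ≤ K ∧ Inv (j + 1) (s'.set i (j + 1))) :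
    Runs (.for i b p) s₀ fun k s' => k ≤ n * (K + 2) + 2 ∧ Inv n s' ∧ s'.reg i = n := by
  refine Runs.seq (Runs.instr ?_)
  have hw' : ∀ x, (p ⨾ .instr (.add i i 1)).writes x = false ↔ (p.writes x = false ∧ x ≠ i) := by
    intro x
    simp [Program.writes, Instr.writes]
  refine (Runs.loop (n := n) (K := K + 1) (fun j s => Inv j s ∧ s.reg i = j ∧
    (∀ x, p.writes x = false → x ≠ i → s.reg x = s₀.reg x) ∧
      (p.stores = false → s.mem = s₀.mem)) ?_ ?_ ?_).mono fun k s' h =>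
      ⟨by have := h.1; rw [show K + 1 + 1 = K + 2 from rfl] at this; omega, h.2.1, h.2.2.1⟩
  · refine ⟨h0, by simp [Instr.run], fun x _ hx => by simp [Instr.run, hx], fun _ => rfl⟩
  · rintro j hj s ⟨hs, hi, hr, hm⟩
    refine ⟨?_, ?_⟩
    · simp only [Test.Holds, hi, hr b hw.2.1 hw.2.2.2.1, hb]
      exact_mod_cast hj
    · refine Runs.then (hstep j hj s hr hm hi hs) fun k s' h hr' hm' => Runs.instr ?_
      have e1 : s'.reg 1 = 1 := by rw [hr' 1 hw.2.2.1, hr 1 hw.2.2.1 hw.2.2.2.2, h1]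
      have ei : s'.reg i = j := by rw [hr' i hw.1, hi]
      have : (Instr.add i i 1).run s' = s'.set i (j + 1) := by
        simp only [Instr.run, State.set, e1, ei]
      rw [this]
      refine ⟨by omega, h.2, by simp [State.set_reg], fun x hx hxi => ?_, fun hst => ?_⟩
      · rw [State.set_reg, if_neg hxi, hr' x hx, hr x hx hxi]
      · rw [State.set_mem, hm' hst, hm hst]
  · rintro s ⟨_, hi, hr, _⟩
    simp only [Test.Holds, hi, hr b hw.2.1 hw.2.2.2.1, hb]
    exact lt_irrefl _

/-- `R_d := R_a * R_b` by repeated addition, with counter `R_i`. -/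
def mul (d a b i : ℕ) : Program := .instr (.const d 0) ⨾ .for i b (.instr (.add d d a))

theorem Runs.mul {d a b i : ℕ} {s : State} {y : ℕ} {Q : ℕ → State → Prop} (h1 : s.reg 1 = 1)
    (hb : s.reg b = y) (hw : d ≠ a ∧ d ≠ b ∧ d ≠ i ∧ d ≠ 1 ∧ i ≠ a ∧ i ≠ b ∧ i ≠ 1)
    (hQ : ∀ k ≤ 3 * y + 3, Q k ((s.set d (s.reg a * y)).set i y)) : Runs (mul d a b i) s Q := by
  obtain ⟨hda, hdb, hdi, hd1, hia, hib, hi1⟩ := hw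
  refine Runs.seq (Runs.instr ?_)
  change Runs _ (s.set d 0) _
  refine (Runs.for (n := y) (K := 1)
    (fun j s' => s' = (s.set d (s.reg a * j)).set i j) ?_ ?_ ?_ ?_ ?_).mono ?_
  · rw [State.set_reg, if_neg hd1.symm, h1]
  · rw [State.set_reg, if_neg hdb.symm, hb]
  · simp [Program.writes, Instr.writes, hdb.symm, hdi.symm, hd1.symm, hib.symm, hi1.symm]
  · simp
  · rintro j - s' - - - rfl
    refine Runs.instr ⟨le_rfl, State.ext' (fun x => ?_) rfl⟩
    simp only [Instr.run, State.set, Function.update_apply, Nat.cast_add, Nat.cast_one]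
    by_cases hx : x = d
    · subst hx
      simp [hdi, hda.symm, hia.symm]
      ring
    · simp [hx]
      split_ifs <;> rfl
  · rintro k s' ⟨hk, rfl, -⟩
    exact hQ _ (by omega)

end RAM

/-! ### The layered dynamic program -/

/-- An instance with the variables numbered consecutively (variable `i * t + j` is the `j`-th one of
brick `i`) and the relations given by their codes; `q` and `D` bound the local right-hand sides
and the entries. -/
structure FoldData where
  n : ℕ
  r : ℕ
  t : ℕ
  q : ℕ
  D : ℕ
  T : ℕ → ℕ → ℤ
  relG : ℕ → ℤ
  relL : ℕ → ℤ
  bG : ℕ → ℤ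
  bL : ℕ → ℤ
  c : ℕ → ℤ

/-- The last index below `n` at which `f` is positive. -/
def lastPos : ℕ → (ℕ → ℤ) → ℕ
  | 0, _ => 0
  | n + 1, f => if 0 < f n then n else lastPos n f

theorem lastPos_spec {n : ℕ} {f : ℕ → ℤ} (h : 0 < ∑ i ∈ Finset.range n, f i) :
    lastPos n f < n ∧ 0 < f (lastPos n f) := by
  induction n with
  | zero => simp at h
  | succ n ih =>
    unfold lastPos
    split_ifs with hn
    · exact ⟨Nat.lt_succ_self n, hn⟩
    · rw [Finset.sum_range_succ] at h
      have := ih (by omega)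
      exact ⟨this.1.trans (Nat.lt_succ_self n), this.2⟩

namespace FoldData

variable (d : FoldData)

/-- The columns, with the `≥` rows negated; the index `n * t` stands for the zero column. -/
def vec (a k : ℕ) : ℤ := if a < d.n * d.t then (if d.relG k = 1 then -d.T a k else d.T a k) else 0

def cst (a : ℕ) : ℤ := if a < d.n * d.t then d.c a else 0

/-- The global right-hand side, with the `≥` rows negated. -/
def rhs (k : ℕ) : ℤ := if d.relG k = 1 then -d.bG k else d.bG k

/-- The global right-hand side, cut off at a trivial bound. -/
def tgt (k : ℕ) : ℤ := if d.relG k = 0 then d.rhs k else min (d.rhs k) (d.D * d.q)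

/-- Half the width of the corridor: each of the `n` bricks may deviate by `2 * r * D` in its own
order, and the interleaving of the bricks adds `2 * n * D` in total. -/
def H : ℕ := 2 * d.n * (d.r + 1) * d.D

def W : ℕ := 2 * d.H + 1

/-- Since `≥` rows are negated, equality rows are just `≤` rows with an additional condition. -/
structure Feasible (x : ℕ → ℕ) : Prop where
  eq : ∀ k < d.r, d.relG k = 0 → ∑ a ∈ Finset.range (d.n * d.t), d.vec a k * x a = d.rhs k
  le : ∀ k < d.r, ∑ a ∈ Finset.range (d.n * d.t), d.vec a k * x a ≤ d.rhs k
  local_eq : ∀ i < d.n, d.relL i = 0 → ∑ j ∈ Finset.range d.t, (x (i * d.t + j) : ℤ) = d.bL i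
  local_le : ∀ i < d.n, ∑ j ∈ Finset.range d.t, (x (i * d.t + j) : ℤ) ≤ d.bL i

def value (x : ℕ → ℕ) : ℤ := ∑ a ∈ Finset.range (d.n * d.t), d.c a * x a

/-- What has to hold of the data for the dynamic program to be run. -/
structure Valid : Prop where
  bL_nonneg : ∀ i < d.n, 0 ≤ d.bL i
  sum_bL : ∑ i ∈ Finset.range d.n, d.bL i = d.q
  abs_T : ∀ a < d.n * d.t, ∀ k < d.r, |d.T a k| ≤ d.D
  le_rhs : ∀ k < d.r, -(d.D * d.q : ℤ) ≤ d.rhs k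
  rhs_le : ∀ k < d.r, d.relG k = 0 → d.rhs k ≤ d.D * d.q
  relL : ∀ i < d.n, d.relL i = 0 ∨ d.relL i = -1

/-! ### Apportioning the `q` steps among the bricks. -/

/-- How far each brick is behind its share, in units of `1 / q`. -/
def deficit : ℕ → ℕ → ℤ
  | 0, _ => 0
  | m + 1, i => deficit m i + d.bL i -
      if i = lastPos d.n (fun i => deficit m i + d.bL i) then (d.q : ℤ) else 0

/-- The brick that is served in step `m`. -/
def sel (m : ℕ) : ℕ := lastPos d.n fun i => d.deficit m i + d.bL i

theorem deficit_succ (m i : ℕ) :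
    d.deficit (m + 1) i = d.deficit m i + d.bL i - if i = d.sel m then (d.q : ℤ) else 0 := rfl

/-- How often brick `i` is served before step `m`. -/
def cnt : ℕ → ℕ → ℕ
  | 0, _ => 0
  | m + 1, i => cnt m i + if i = d.sel m then 1 else 0

theorem cnt_succ (m i : ℕ) : d.cnt (m + 1) i = d.cnt m i + if i = d.sel m then 1 else 0 := rfl

/-- The fair share of brick `i` after `m` steps is `m * bL i / q`; multiplying the shortfall by `q`
keeps everything integral. -/
theorem deficit_eq (m i : ℕ) : d.deficit m i = m * d.bL i - d.q * d.cnt m i := by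
  induction m with
  | zero => simp [deficit, cnt]
  | succ m ih =>
    rw [deficit_succ, cnt_succ, ih]
    split_ifs <;> push_cast <;> ring

theorem cnt_eq_card (m i : ℕ) : d.cnt m i = ((Finset.range m).filter fun l => i = d.sel l).card := by
  induction m with
  | zero => simp [cnt]
  | succ m ih =>
    rw [cnt_succ, ih, Finset.range_add_one, Finset.filter_insert]
    split_ifs
    · rw [Finset.card_insert_of_notMem (by simp)]
    · simp

theorem cnt_mono (i : ℕ) : Monotone fun m => d.cnt m i :=
  monotone_nat_of_le_succ fun m => by simp only [cnt_succ]; omega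

/-! ### The corridor and the paths inside it. -/

/-- The centre of the corridor. -/
def cen (m k : ℕ) : ℤ := (m * d.tgt k) / d.q

def inc (m k : ℕ) : ℤ := d.cen (m + 1) k - d.cen m k

/-- The least digit admitted after step `m` in a row that is an inequality. -/
def cl (m : ℕ) : ℤ := if m + 1 = d.q then d.H else 0

/-- The effect of item `a` on the digits in step `m`. -/
def nxt (m : ℕ) (z : ℕ → ℤ) (a k : ℕ) : ℤ :=
  if d.relG k = 0 then z k + d.vec a k - d.inc m k else max (z k + d.vec a k - d.inc m k) (d.cl m)

/-- The digits reached by a sequence of items. -/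
def traj (a : ℕ → ℕ) : ℕ → ℕ → ℤ
  | 0, _ => d.H
  | m + 1, k => d.nxt m (traj a m) (a m) k

def Allowed (m a : ℕ) : Prop :=
  (∃ j < d.t, a = d.sel m * d.t + j) ∨ (d.relL (d.sel m) = -1 ∧ a = d.n * d.t)

/-- The first `m` items are allowed and keep all digits in range. -/
def IsPath (a : ℕ → ℕ) (m : ℕ) : Prop :=
  ∀ l < m, d.Allowed l (a l) ∧ ∀ k < d.r, 0 ≤ d.traj a (l + 1) k ∧ d.traj a (l + 1) k < d.W

def pathCost (a : ℕ → ℕ) (m : ℕ) : ℤ := ∑ l ∈ Finset.range m, d.cst (a l)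

/-- The vector counting the items of a path. -/
def count (a : ℕ → ℕ) (p : ℕ) : ℕ := ((Finset.range d.q).filter fun l => a l = p).card

variable {d}

namespace Valid

variable (h : d.Valid)
include h

theorem abs_vec (a : ℕ) {k : ℕ} (hk : k < d.r) : |d.vec a k| ≤ d.D := by
  unfold vec
  split_ifs with h1 h2
  · rw [abs_neg]; exact h.abs_T a h1 k hk
  · exact h.abs_T a h1 k hk
  · simp

theorem sum_deficit_pos (hq : 0 < d.q) (m : ℕ)
    (h0 : ∑ i ∈ Finset.range d.n, d.deficit m i = 0) : d.sel m < d.n ∧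
      0 < d.deficit m (d.sel m) + d.bL (d.sel m) := by
  apply lastPos_spec (f := fun i => d.deficit m i + d.bL i)
  rw [Finset.sum_add_distrib, h0, h.sum_bL]
  exact_mod_cast (by omega : 0 < 0 + d.q)

theorem sum_deficit (hq : 0 < d.q) (m : ℕ) : ∑ i ∈ Finset.range d.n, d.deficit m i = 0 := by
  induction m with
  | zero => simp [deficit]
  | succ m ih =>
    have := (h.sum_deficit_pos hq m ih).1
    simp only [deficit_succ, Finset.sum_sub_distrib, Finset.sum_add_distrib, ih, h.sum_bL]
    simp [this]

theorem sel_lt (hq : 0 < d.q) (m : ℕ) : d.sel m < d.n :=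
  (h.sum_deficit_pos hq m (h.sum_deficit hq m)).1

/-- A brick is charged `q` only while its balance, including the new share, is positive. -/
theorem neg_lt_deficit (hq : 0 < d.q) (m : ℕ) {i : ℕ} (hi : i < d.n) :
    -(d.q : ℤ) < d.deficit m i := by
  induction m with
  | zero => simp [deficit]; exact_mod_cast hq
  | succ m ih =>
    rw [deficit_succ]
    have := h.bL_nonneg i hi
    split_ifs with hs
    · have := (h.sum_deficit_pos hq m (h.sum_deficit hq m)).2
      rw [← hs] at this
      linarith
    · linarith

/-- A number above `-q` has absolute value at most itself plus `2 * q`, and the deficits themselves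
cancel in the sum. -/
theorem sum_abs_deficit_le (hq : 0 < d.q) (m : ℕ) :
    ∑ i ∈ Finset.range d.n, |d.deficit m i| ≤ 2 * d.n * d.q := by
  calc ∑ i ∈ Finset.range d.n, |d.deficit m i|
      ≤ ∑ i ∈ Finset.range d.n, (d.deficit m i + 2 * d.q) := by
        refine Finset.sum_le_sum fun i hi => ?_
        have := h.neg_lt_deficit hq m (Finset.mem_range.1 hi)
        rw [abs_le]
        constructor <;> linarith
    _ = 2 * d.n * d.q := by
        rw [Finset.sum_add_distrib, h.sum_deficit hq]
        simp
        ring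

/-- At time `q` every deficit is a multiple of `q` exceeding `-q`, hence nonnegative; as the
deficits sum to zero, all of them vanish. If `q = 0`, all right-hand sides are zero already. -/
theorem cnt_q {i : ℕ} (hi : i < d.n) : (d.cnt d.q i : ℤ) = d.bL i := by
  rcases Nat.eq_zero_or_pos d.q with hq | hq
  · have h0 : ∑ i ∈ Finset.range d.n, d.bL i = 0 := by rw [h.sum_bL, hq]; rfl
    rw [Finset.sum_eq_zero_iff_of_nonneg fun i hi => h.bL_nonneg i (Finset.mem_range.1 hi)] at h0
    rw [h0 i (Finset.mem_range.2 hi), hq]; rfl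
  · have hq' : (0 : ℤ) < d.q := by exact_mod_cast hq
    have key : ∀ i ∈ Finset.range d.n, 0 ≤ d.deficit d.q i := by
      intro i hi
      have h1 := h.neg_lt_deficit hq d.q (Finset.mem_range.1 hi)
      have h2 : d.deficit d.q i = d.q * (d.bL i - d.cnt d.q i) := by rw [deficit_eq]; ring
      rw [h2] at h1 ⊢
      have : -1 < d.bL i - d.cnt d.q i := by
        by_contra! hle
        nlinarith
      exact mul_nonneg hq'.le (by omega)
    have h0 := (Finset.sum_eq_zero_iff_of_nonneg key).1 (h.sum_deficit hq d.q) i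
      (Finset.mem_range.2 hi)
    rw [deficit_eq, ← mul_sub] at h0
    rcases mul_eq_zero.1 h0 with h1 | h1
    · omega
    · omega

theorem cnt_le {m i : ℕ} (hm : m ≤ d.q) (hi : i < d.n) : (d.cnt m i : ℤ) ≤ d.bL i := by
  rw [← h.cnt_q hi]
  exact_mod_cast d.cnt_mono i hm

/-- This bounds by `2 * D` the quotient that `runs_carry` finds by repeated subtraction. -/
theorem abs_tgt {k : ℕ} (hk : k < d.r) : |d.tgt k| ≤ d.D * d.q := by
  have h0 : (0 : ℤ) ≤ d.D * d.q := by positivity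
  have h1 := h.le_rhs k hk
  unfold tgt
  split_ifs with h2
  · exact abs_le.2 ⟨h1, h.rhs_le k hk h2⟩
  · exact abs_le.2 ⟨le_min h1 (by linarith), min_le_right _ _⟩

theorem cen_q {k : ℕ} (hk : k < d.r) : d.cen d.q k = d.tgt k := by
  unfold cen
  rcases Nat.eq_zero_or_pos d.q with hq | hq
  · have := h.abs_tgt hk
    rw [hq] at this
    simp only [Nat.cast_zero, mul_zero, abs_nonpos_iff] at this
    simp [this]
  · exact Int.mul_ediv_cancel_left _ (by omega)

end Valid

theorem cen_zero (k : ℕ) : d.cen 0 k = 0 := by simp [cen]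

theorem tgt_le (k : ℕ) : d.tgt k ≤ d.rhs k := by
  unfold tgt
  split_ifs
  · rfl
  · exact min_le_left _ _

end FoldData

/-! ### From paths to feasible solutions. -/

namespace FoldData

variable {d : FoldData}

theorem traj_eq (a : ℕ → ℕ) (m : ℕ) {k : ℕ} (hk : d.relG k = 0) :
    d.traj a m k = ∑ l ∈ Finset.range m, d.vec (a l) k - d.cen m k + d.H := by
  induction m with
  | zero => simp [traj, cen_zero]
  | succ m ih =>
    rw [traj, nxt, if_pos hk, ih, Finset.sum_range_succ, inc]
    ring

/-- Lifting only raises a digit. The amount lifted plays the part of a slack variable, so the digit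
bounds the true sum from above. -/
theorem le_traj (a : ℕ → ℕ) (m k : ℕ) :
    ∑ l ∈ Finset.range m, d.vec (a l) k - d.cen m k + d.H ≤ d.traj a m k := by
  by_cases hk : d.relG k = 0
  · rw [traj_eq a m hk]
  · induction m with
    | zero => simp [traj, cen_zero]
    | succ m ih =>
      rw [traj, nxt, if_neg hk, Finset.sum_range_succ]
      refine le_max_of_le_left ?_
      rw [inc]
      linarith

theorem sum_mul_count (a : ℕ → ℕ) (F : ℕ → ℤ) :
    ∑ p ∈ Finset.range (d.n * d.t), F p * d.count a p =
      ∑ l ∈ Finset.range d.q, if a l < d.n * d.t then F (a l) else 0 := by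
  simp only [count, Finset.card_filter, Nat.cast_sum, Finset.mul_sum]
  rw [Finset.sum_comm]
  refine Finset.sum_congr rfl fun l _ => ?_
  simp

theorem sum_vec_mul_count (a : ℕ → ℕ) (k : ℕ) :
    ∑ p ∈ Finset.range (d.n * d.t), d.vec p k * d.count a p =
      ∑ l ∈ Finset.range d.q, d.vec (a l) k := by
  rw [sum_mul_count]
  refine Finset.sum_congr rfl fun l _ => ?_
  split_ifs with h
  · rfl
  · simp [vec, h]

theorem value_count (a : ℕ → ℕ) : d.value (d.count a) = d.pathCost a d.q := by
  rw [value, sum_mul_count]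
  rfl

theorem index_lt {n t i j : ℕ} (hi : i < n) (hj : j < t) : i * t + j < n * t :=
  calc i * t + j < (i + 1) * t := by rw [add_mul]; omega
    _ ≤ n * t := Nat.mul_le_mul_right t hi

theorem index_inj {t i i' j j' : ℕ} (hj : j < t) (hj' : j' < t) (h : i * t + j = i' * t + j') :
    i = i' ∧ j = j' := by
  have ht : 0 < t := by omega
  have h1 : (i * t + j) / t = (i' * t + j') / t := by rw [h]
  rw [mul_comm i, mul_comm i', Nat.mul_add_div ht, Nat.mul_add_div ht, Nat.div_eq_of_lt hj,
    Nat.div_eq_of_lt hj'] at h1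
  obtain rfl : i = i' := by omega
  exact ⟨rfl, by omega⟩

theorem Allowed.sum_eq {m a : ℕ} (ha : d.Allowed m a) {i : ℕ} (hi : i < d.n) :
    (∑ j ∈ Finset.range d.t, if a = i * d.t + j then (1 : ℤ) else 0) =
      if i = d.sel m ∧ a ≠ d.n * d.t then 1 else 0 := by
  rcases ha with ⟨j₀, hj₀, rfl⟩ | ⟨_, rfl⟩
  · by_cases h : i = d.sel m
    · subst h
      rw [Finset.sum_eq_single_of_mem j₀ (Finset.mem_range.2 hj₀)]
      · have := index_lt hi hj₀
        simp; omega
      · intro j hj hne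
        rw [if_neg]
        omega
    · rw [if_neg (by tauto)]
      refine Finset.sum_eq_zero fun j hj => if_neg fun he => h ?_
      exact (index_inj hj₀ (Finset.mem_range.1 hj) he).1.symm
  · rw [if_neg (by tauto)]
    refine Finset.sum_eq_zero fun j hj => if_neg fun he => ?_
    have := index_lt hi (Finset.mem_range.1 hj)
    omega

theorem sum_count_brick {a : ℕ → ℕ} (ha : d.IsPath a d.q) {i : ℕ} (hi : i < d.n) :
    ∑ j ∈ Finset.range d.t, (d.count a (i * d.t + j) : ℤ) =
      ∑ l ∈ Finset.range d.q, if i = d.sel l ∧ a l ≠ d.n * d.t then 1 else 0 := by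
  simp only [count, Finset.card_filter, Nat.cast_sum]
  rw [Finset.sum_comm]
  refine Finset.sum_congr rfl fun l hl => ?_
  rw [← (ha l (Finset.mem_range.1 hl)).1.sum_eq hi]
  simp

/-- A path that ends in the centre yields a feasible solution. -/
theorem Valid.feasible_count (h : d.Valid) {a : ℕ → ℕ} (ha : d.IsPath a d.q)
    (hend : ∀ k < d.r, d.traj a d.q k = d.H) : d.Feasible (d.count a) where
  eq k hk h0 := by
    rw [sum_vec_mul_count]
    have h1 := traj_eq (d := d) a d.q h0
    rw [hend k hk, h.cen_q hk, tgt, if_pos h0] at h1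
    linarith
  le k hk := by
    rw [sum_vec_mul_count]
    have h1 := le_traj (d := d) a d.q k
    rw [hend k hk, h.cen_q hk] at h1
    have := tgt_le (d := d) k
    linarith
  local_eq i hi h0 := by
    rw [sum_count_brick ha hi, ← h.cnt_q hi, cnt_eq_card, Finset.card_filter, Nat.cast_sum]
    refine Finset.sum_congr rfl fun l hl => ?_
    -- In a brick with an equality constraint the zero column is not allowed, so every visit takes a
    -- genuine item.
    have hne : i = d.sel l → a l ≠ d.n * d.t := by
      intro hs hal
      rcases (ha l (Finset.mem_range.1 hl)).1 with ⟨j, hj, he⟩ | ⟨h1, _⟩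
      · rw [← hs] at he
        have := index_lt hi hj
        omega
      · rw [← hs, h0] at h1
        norm_num at h1
    by_cases hs : i = d.sel l
    · simp [hs, hne hs]
    · simp [hs]
  local_le i hi := by
    rw [sum_count_brick ha hi, ← h.cnt_q hi, cnt_eq_card, Finset.card_filter, Nat.cast_sum]
    refine Finset.sum_le_sum fun l hl => ?_
    by_cases hs : i = d.sel l
    · simp only [hs, true_and, if_true]
      split_ifs <;> simp
    · simp [hs]

end FoldData

/-- **Steinitz lemma** for integer vectors that need not sum to zero, without denominators. -/
theorem steinitz_int (l : List ℕ) (F : ℕ → ℕ → ℤ) (r D : ℕ) (hF : ∀ a, ∀ k < r, |F a k| ≤ D) :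
    ∃ l' : List ℕ, l'.Perm l ∧ ∀ m ≤ l.length, ∀ k < r,
      |l.length * ((l'.take m).map fun a => F a k).sum - m * (l.map fun a => F a k).sum| ≤
        2 * r * D * l.length := by
  rcases Nat.eq_zero_or_pos l.length with h0 | hpos
  · refine ⟨l, .refl _, fun m hm k _ => ?_⟩
    rw [List.eq_nil_of_length_eq_zero h0]
    simp
  have hpos' : (0 : ℝ) < l.length := by exact_mod_cast hpos
  have habs : ∀ k < r, |((l.map fun a => F a k).sum : ℝ)| ≤ D * l.length := by
    intro k hk
    have : ∀ l : List ℕ, |(l.map fun a => F a k).sum| ≤ D * l.length := by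
      intro l
      induction l with
      | nil => simp
      | cons a l ih =>
        simp only [List.map_cons, List.sum_cons, List.length_cons]
        have h1 := abs_add_le (F a k) (l.map fun a => F a k).sum
        have h2 := hF a k hk
        push_cast
        linarith
    exact_mod_cast this l
  have hmap : ∀ (l₁ : List ℕ) (k : ℕ) (s : ℝ), (l₁.map fun a => (F a k : ℝ) - s).sum =
      (((l₁.map fun a => F a k).sum : ℤ) : ℝ) - l₁.length * s := by
    intro l₁ k s
    induction l₁ with
    | nil => simp
    | cons a l₁ ih =>
      simp only [List.map_cons, List.sum_cons, List.length_cons, ih]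
      push_cast
      ring
  -- Subtracting the mean makes the vectors sum to zero and at most doubles the bound on their
  -- entries.
  obtain ⟨l', hl', hm⟩ := steinitz l
    (fun a (k : Fin r) => (F a k : ℝ) - ((l.map fun a => F a k).sum : ℤ) / l.length) (2 * D)
    (by positivity) (by
      intro a _ k
      have h1 : |(F a k : ℝ)| ≤ D := by exact_mod_cast hF a k k.2
      have h2 : |(((l.map fun a => F a k).sum : ℤ) : ℝ) / l.length| ≤ D := by
        rw [abs_div, Nat.abs_cast, div_le_iff₀ hpos']
        exact habs k k.2
      have := abs_sub (F a k : ℝ) (((l.map fun a => F a k).sum : ℤ) / l.length)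
      linarith) (by
      intro k
      rw [hmap]
      field_simp
      ring)
  refine ⟨l', hl', fun m hml k hk => ?_⟩
  have h1 := hm m ⟨k, hk⟩
  rw [hmap, List.length_take, min_eq_left (by rw [hl'.length_eq]; exact hml)] at h1
  have h2 : |(l.length : ℝ) * (((l'.take m).map fun a => F a k).sum : ℤ) -
      m * ((l.map fun a => F a k).sum : ℤ)| ≤ 2 * r * D * l.length := by
    have h3 : (l.length : ℝ) * (((l'.take m).map fun a => F a k).sum : ℤ) -
      m * ((l.map fun a => F a k).sum : ℤ) = l.length * ((((l'.take m).map fun a => F a k).sum : ℤ) -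
        m * (((l.map fun a => F a k).sum : ℤ) / l.length)) := by
      field_simp
    rw [h3, abs_mul, Nat.abs_cast]
    calc _ ≤ (l.length : ℝ) * (r * (2 * D)) := mul_le_mul_of_nonneg_left h1 hpos'.le
      _ = _ := by ring
  exact_mod_cast h2

theorem sum_map_take_succ (l : List ℕ) (F : ℕ → ℤ) {m : ℕ} (hm : m < l.length) :
    ((l.take (m + 1)).map F).sum = ((l.take m).map F).sum + F (l.getD m 0) := by
  rw [List.take_add_one, List.map_append, List.sum_append]
  simp [hm]

/-! ### From feasible solutions to paths. -/

namespace FoldData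

variable (d : FoldData)

/-- How much is missing to the right-hand side of the local constraint of brick `i`. -/
def slack (x : ℕ → ℕ) (i : ℕ) : ℕ := (d.bL i - ∑ j ∈ Finset.range d.t, (x (i * d.t + j) : ℤ)).toNat

/-- The items of brick `i`, with multiplicities. -/
def brickList (x : ℕ → ℕ) (i : ℕ) : List ℕ :=
  ((List.range d.t).flatMap fun j => List.replicate (x (i * d.t + j)) (i * d.t + j)) ++
    List.replicate (d.slack x i) (d.n * d.t)

variable {d}

theorem sum_map_brickList (x : ℕ → ℕ) (i : ℕ) (F : ℕ → ℤ) :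
    ((d.brickList x i).map F).sum =
      ∑ j ∈ Finset.range d.t, F (i * d.t + j) * x (i * d.t + j) + F (d.n * d.t) * d.slack x i := by
  have : ∀ m, (((List.range m).flatMap fun j =>
      List.replicate (x (i * d.t + j)) (i * d.t + j)).map F).sum =
        ∑ j ∈ Finset.range m, F (i * d.t + j) * x (i * d.t + j) := by
    intro m
    induction m with
    | zero => simp
    | succ m ih =>
      rw [List.range_succ, List.flatMap_append, List.map_append, List.sum_append, ih,
        Finset.sum_range_succ]
      simp [mul_comm]
  rw [brickList, List.map_append, List.sum_append, this]
  simp [mul_comm]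

/-- The zero columns fill the list up to the right-hand side, which does not depend on `x`; so one
schedule serves all solutions. -/
theorem Feasible.length_brickList {x : ℕ → ℕ} (hx : d.Feasible x) {i : ℕ} (hi : i < d.n) :
    ((d.brickList x i).length : ℤ) = d.bL i := by
  have h1 := sum_map_brickList (d := d) x i fun _ => 1
  have h2 := hx.local_le i hi
  have h3 : (d.slack x i : ℤ) = d.bL i - ∑ j ∈ Finset.range d.t, (x (i * d.t + j) : ℤ) :=
    Int.toNat_of_nonneg (by linarith)
  simp only [List.map_const', List.sum_replicate, one_mul, h3] at h1
  simpa using h1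

theorem Feasible.mem_brickList {x : ℕ → ℕ} (hx : d.Feasible x) (h : d.Valid) {i a : ℕ}
    (hi : i < d.n) (ha : a ∈ d.brickList x i) :
    (∃ j < d.t, a = i * d.t + j) ∨ (d.relL i = -1 ∧ a = d.n * d.t) := by
  rw [brickList, List.mem_append, List.mem_flatMap] at ha
  rcases ha with ⟨j, hj, ha⟩ | ha
  · exact .inl ⟨j, List.mem_range.1 hj, List.eq_of_mem_replicate ha⟩
  · refine .inr ⟨(h.relL i hi).resolve_left fun h0 => ?_, List.eq_of_mem_replicate ha⟩
    have h1 : d.slack x i = 0 := by rw [slack, hx.local_eq i hi h0]; simp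
    rw [h1] at ha
    simp at ha

/-- Interleaving sequences, one for each brick, in the order given by `sel`. -/
theorem Valid.sum_interleave (h : d.Valid) (hq : 0 < d.q) (g : ℕ → ℕ → ℕ) (F : ℕ → ℤ) (m : ℕ) :
    ∑ l ∈ Finset.range m, F (g (d.sel l) (d.cnt l (d.sel l))) =
      ∑ i ∈ Finset.range d.n, ∑ l ∈ Finset.range (d.cnt m i), F (g i l) := by
  induction m with
  | zero => simp [cnt]
  | succ m ih =>
    have : ∀ i, ∑ l ∈ Finset.range (d.cnt (m + 1) i), F (g i l) =
        ∑ l ∈ Finset.range (d.cnt m i), F (g i l) +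
          if i = d.sel m then F (g (d.sel m) (d.cnt m (d.sel m))) else 0 := by
      intro i
      rw [cnt_succ]
      split_ifs with hs
      · rw [Finset.sum_range_succ, hs]
      · simp
    simp only [this]
    rw [Finset.sum_range_succ, ih, Finset.sum_add_distrib]
    congr 1
    simp [h.sel_lt hq m]

theorem sum_range_mul (n t : ℕ) (F : ℕ → ℤ) :
    ∑ a ∈ Finset.range (n * t), F a =
      ∑ i ∈ Finset.range n, ∑ j ∈ Finset.range t, F (i * t + j) := by
  induction n with
  | zero => simp
  | succ n ih => rw [add_mul, one_mul, Finset.sum_range_add, ih, Finset.sum_range_succ]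

/-- A sequence of items that realizes a feasible solution and whose partial sums stay close to
the segment from zero to the total. -/
theorem Feasible.exists_sequence {x : ℕ → ℕ} (hx : d.Feasible x) (h : d.Valid) (hq : 0 < d.q) :
    ∃ a : ℕ → ℕ, (∀ l < d.q, d.Allowed l (a l)) ∧
      (∀ F : ℕ → ℤ, F (d.n * d.t) = 0 → ∑ l ∈ Finset.range d.q, F (a l) =
        ∑ p ∈ Finset.range (d.n * d.t), F p * x p) ∧
      ∀ m ≤ d.q, ∀ k < d.r, |d.q * ∑ l ∈ Finset.range m, d.vec (a l) k -
        m * ∑ l ∈ Finset.range d.q, d.vec (a l) k| ≤ d.q * d.H := by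
  -- Each brick has its own Steinitz order `L i`; the schedule only decides when its next item is
  -- used.
  choose L hperm hdev using fun i => steinitz_int (d.brickList x i) d.vec d.r d.D
    fun a k hk => h.abs_vec a hk
  have hlen : ∀ i < d.n, ((L i).length : ℤ) = d.bL i := fun i hi => by
    rw [(hperm i).length_eq, hx.length_brickList hi]
  have hsum : ∀ i, ∀ F : ℕ → ℤ, ∀ c ≤ (L i).length,
      ∑ l ∈ Finset.range c, F ((L i).getD l 0) = (((L i).take c).map F).sum := by
    intro i F c
    induction c with
    | zero => simp
    | succ c ih =>
      intro hc
      rw [Finset.sum_range_succ, ih (by omega), sum_map_take_succ _ _ (by omega)]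
  have hfull : ∀ i < d.n, ∀ F : ℕ → ℤ,
      ∑ l ∈ Finset.range (d.cnt d.q i), F ((L i).getD l 0) = ((d.brickList x i).map F).sum := by
    intro i hi F
    have : d.cnt d.q i = (L i).length := by
      have := h.cnt_q hi
      have := hlen i hi
      omega
    rw [hsum i F _ this.le, this, List.take_length, ((hperm i).map F).sum_eq]
  refine ⟨fun l => (L (d.sel l)).getD (d.cnt l (d.sel l)) 0, fun l hl => ?_, fun F hF => ?_,
    fun m hm k hk => ?_⟩
  · have hs := h.sel_lt hq l
    have h1 := h.cnt_le (m := l + 1) (by omega) hs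
    rw [cnt_succ, if_pos rfl, ← hlen _ hs] at h1
    refine hx.mem_brickList h hs ((hperm _).mem_iff.1 ?_)
    dsimp only
    rw [List.getD_eq_getElem _ _ (by omega)]
    exact List.getElem_mem _
  · rw [h.sum_interleave hq (fun i l => (L i).getD l 0) F, sum_range_mul]
    refine Finset.sum_congr rfl fun i hi => ?_
    rw [hfull i (Finset.mem_range.1 hi), sum_map_brickList, hF]
    simp
  · rw [h.sum_interleave hq (fun i l => (L i).getD l 0) fun a => d.vec a k,
      h.sum_interleave hq (fun i l => (L i).getD l 0) fun a => d.vec a k, Finset.mul_sum,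
      Finset.mul_sum, ← Finset.sum_sub_distrib]
    have key : ∀ i ∈ Finset.range d.n,
        |(d.q : ℤ) * ∑ l ∈ Finset.range (d.cnt m i), d.vec ((L i).getD l 0) k -
          m * ∑ l ∈ Finset.range (d.cnt d.q i), d.vec ((L i).getD l 0) k| ≤
        d.q * (2 * d.r * d.D) + |d.deficit m i| * d.D := by
      intro i hi
      have hi := Finset.mem_range.1 hi
      have hb := hlen i hi
      have hcm := h.cnt_le hm hi
      have hcq := h.cnt_q hi
      rw [hfull i hi fun a => d.vec a k, hsum i (fun a => d.vec a k) (d.cnt m i) (by omega)]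
      have hd := hdev i (d.cnt m i) (by rw [← (hperm i).length_eq]; omega) k hk
      have hS : |((d.brickList x i).map fun a => d.vec a k).sum| ≤ d.bL i * d.D := by
        rw [← hfull i hi fun a => d.vec a k]
        refine (Finset.abs_sum_le_sum_abs _ _).trans ?_
        refine (Finset.sum_le_card_nsmul _ _ (d.D : ℤ) fun l _ => h.abs_vec _ hk).trans ?_
        rw [Finset.card_range, nsmul_eq_mul, hcq]
      rw [← (hperm i).length_eq, hb] at hd
      set S := ((d.brickList x i).map fun a => d.vec a k).sum
      set P := (((L i).take (d.cnt m i)).map fun a => d.vec a k).sum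
      have hdef := d.deficit_eq m i
      -- The main estimate is obtained after multiplication by `bL i`. A brick with `bL i = 0` has
      -- no items and is settled directly.
      rcases (h.bL_nonneg i hi).eq_or_lt with h0 | hpos
      · rw [← h0] at hS hcm hcq
        have hS0 : S = 0 := by
          rw [zero_mul] at hS
          exact abs_nonpos_iff.1 hS
        have hP0 : P = 0 := by
          have : d.cnt m i = 0 := by omega
          simp [P, this]
        rw [hS0, hP0]
        simp only [mul_zero, sub_self, abs_zero]
        positivity
      · refine le_of_mul_le_mul_left ?_ hpos
        -- The first term measures the prefix against its proportional part of the brick total,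
        -- which Steinitz controls; the second measures this proportion against `m / q`, which the
        -- deficit controls.
        have e : d.bL i * (d.q * P - m * S) =
            d.q * (d.bL i * P - d.cnt m i * S) - d.deficit m i * S := by
          rw [hdef]; ring
        calc d.bL i * |d.q * P - m * S| = |d.bL i * (d.q * P - m * S)| := by
              rw [abs_mul, abs_of_pos hpos]
          _ ≤ |d.q * (d.bL i * P - d.cnt m i * S)| + |d.deficit m i * S| := by
              rw [e]; exact abs_sub _ _
          _ = d.q * |d.bL i * P - d.cnt m i * S| + |d.deficit m i| * |S| := by
              rw [abs_mul, abs_mul, Nat.abs_cast]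
          _ ≤ d.q * (2 * d.r * d.D * d.bL i) + |d.deficit m i| * (d.bL i * d.D) := by
              gcongr
          _ = _ := by ring
    calc _ ≤ ∑ i ∈ Finset.range d.n, ((d.q : ℤ) * (2 * d.r * d.D) + |d.deficit m i| * d.D) :=
          (Finset.abs_sum_le_sum_abs _ _).trans (Finset.sum_le_sum key)
      _ = d.n * (d.q * (2 * d.r * d.D)) + (∑ i ∈ Finset.range d.n, |d.deficit m i|) * d.D := by
          rw [Finset.sum_add_distrib, Finset.sum_mul]; simp
      _ ≤ d.n * (d.q * (2 * d.r * d.D)) + 2 * d.n * d.q * d.D := by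
          have := h.sum_abs_deficit_le hq m
          gcongr
      _ = d.q * d.H := by
          rw [H]; push_cast; ring

/-- A feasible solution is realized by a path that ends in the centre. -/
theorem Feasible.exists_path {x : ℕ → ℕ} (hx : d.Feasible x) (h : d.Valid) :
    ∃ a : ℕ → ℕ, d.IsPath a d.q ∧ (∀ k < d.r, d.traj a d.q k = d.H) ∧
      d.pathCost a d.q = d.value x := by
  rcases Nat.eq_zero_or_pos d.q with hq0 | hq
  · refine ⟨fun _ => 0, by simp [IsPath, hq0], by simp [hq0, traj], ?_⟩
    have hz : ∀ a ∈ Finset.range (d.n * d.t), (x a : ℤ) = 0 := by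
      have h1 : ∑ a ∈ Finset.range (d.n * d.t), (x a : ℤ) ≤ d.q := by
        rw [sum_range_mul _ _ fun a => (x a : ℤ), ← h.sum_bL]
        exact Finset.sum_le_sum fun i hi => hx.local_le i (Finset.mem_range.1 hi)
      have h2 : ∀ a ∈ Finset.range (d.n * d.t), 0 ≤ (x a : ℤ) := fun a _ => by positivity
      exact (Finset.sum_eq_zero_iff_of_nonneg h2).1
        (le_antisymm (by simpa [hq0] using h1) (Finset.sum_nonneg h2))
    rw [value, Finset.sum_eq_zero fun a ha => by rw [hz a ha, mul_zero]]
    simp [pathCost, hq0]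
  obtain ⟨a, hall, hsum, hdev⟩ := hx.exists_sequence h hq
  have hq' : (0 : ℤ) < d.q := by exact_mod_cast hq
  set P : ℕ → ℕ → ℤ := fun m k => ∑ l ∈ Finset.range m, d.vec (a l) k with hP
  have hPq : ∀ k, P d.q k = ∑ p ∈ Finset.range (d.n * d.t), d.vec p k * x p := fun k =>
    hsum (fun p => d.vec p k) (by simp [vec])
  have hPabs : ∀ k < d.r, |P d.q k| ≤ d.D * d.q := fun k hk => by
    refine (Finset.abs_sum_le_sum_abs _ _).trans ?_
    refine (Finset.sum_le_card_nsmul _ _ (d.D : ℤ) fun l _ => h.abs_vec _ hk).trans ?_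
    rw [Finset.card_range, nsmul_eq_mul, mul_comm]
  -- The cut-off in `tgt` does no harm, since `q` columns never add up to more than `D * q`.
  have hs0 : ∀ k < d.r, 0 ≤ d.tgt k - P d.q k := fun k hk => by
    have h1 := hx.le k hk
    rw [← hPq] at h1
    have h2 := abs_le.1 (hPabs k hk)
    unfold tgt
    split_ifs
    · linarith
    · have := le_min h1 h2.2
      linarith
  -- The comparison walk, relative to the centre: the slack of each row is spent evenly over the
  -- steps, rounded down.
  set U : ℕ → ℕ → ℤ := fun m k => P m k + (m * (d.tgt k - P d.q k)) / d.q - d.cen m k with hU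
  have hUabs : ∀ m ≤ d.q, ∀ k < d.r, |U m k| ≤ d.H := by
    intro m hm k hk
    have h1 := abs_le.1 (hdev m hm k hk)
    have h2 := Int.mul_ediv_add_emod (m * (d.tgt k - P d.q k)) d.q
    have h3 := Int.mul_ediv_add_emod (m * d.tgt k) d.q
    have h4 := Int.emod_nonneg (m * (d.tgt k - P d.q k)) hq'.ne'
    have h5 := Int.emod_nonneg (m * d.tgt k) hq'.ne'
    have h6 := Int.emod_lt_of_pos (m * (d.tgt k - P d.q k)) hq'
    have h7 := Int.emod_lt_of_pos (m * d.tgt k) hq'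
    -- The two remainders differ by less than `q`, so the absolute value of `U m k` is below `H +
    -- 1`; being an integer, it is at most `H`. Rounding thus does not widen the corridor.
    have e : (d.q : ℤ) * U m k = (d.q * P m k - m * P d.q k) +
        (m * d.tgt k % d.q - m * (d.tgt k - P d.q k) % d.q) := by
      simp only [hU, cen]
      linear_combination h2 - h3
    rw [abs_le]
    constructor
    · have : (d.q : ℤ) * (-(d.H : ℤ) - 1) < d.q * U m k := by
        rw [e]; linarith [h1.1]
      have := lt_of_mul_lt_mul_left this hq'.le
      omega
    · have : (d.q : ℤ) * U m k < d.q * (d.H + 1) := by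
        rw [e]; linarith [h1.2]
      have := lt_of_mul_lt_mul_left this hq'.le
      omega
  have hUq : ∀ k < d.r, U d.q k = 0 := fun k hk => by
    simp only [hU]
    rw [h.cen_q hk, Int.mul_ediv_cancel_left _ hq'.ne']
    ring
  have hstep : ∀ m, ∀ k < d.r, U m k + d.vec (a m) k - d.inc m k ≤ U (m + 1) k := by
    intro m k hk
    have h1 : P (m + 1) k = P m k + d.vec (a m) k := Finset.sum_range_succ _ _
    have h2 : (m * (d.tgt k - P d.q k)) / (d.q : ℤ) ≤
        ((m + 1 : ℕ) * (d.tgt k - P d.q k)) / d.q :=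
      Int.ediv_le_ediv hq' (mul_le_mul_of_nonneg_right (by push_cast; omega) (hs0 k hk))
    simp only [hU, inc, h1]
    linarith
  have hclU : ∀ m < d.q, ∀ k < d.r, d.cl m ≤ U (m + 1) k + d.H := by
    intro m hm k hk
    unfold cl
    split_ifs with hl
    · rw [hl, hUq k hk, zero_add]
    · have := abs_le.1 (hUabs (m + 1) hm k hk)
      linarith [this.1]
  have hcl0 : ∀ m, 0 ≤ d.cl m := fun m => by
    unfold cl
    split_ifs <;> simp
  -- The comparison walk rises at least as fast as the unlifted digits and never falls below the
  -- admitted minimum, so the lifted digits cannot overtake it.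
  have hup : ∀ m ≤ d.q, ∀ k < d.r, d.traj a m k ≤ U m k + d.H := by
    intro m
    induction m with
    | zero => intro _ k _; simp [traj, hU, hP, cen_zero]
    | succ m ih =>
      intro hm k hk
      have h1 := ih (by omega) k hk
      have h2 := hstep m k hk
      have h3 := hclU m hm k hk
      rw [traj, nxt]
      split_ifs
      · linarith
      · exact max_le (by linarith) h3
  -- An equality row has no slack and follows the comparison walk exactly; in the other rows the
  -- lift itself gives the bound.
  have hlo : ∀ m < d.q, ∀ k < d.r, d.cl m ≤ d.traj a (m + 1) k := by
    intro m hm k hk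
    by_cases h0 : d.relG k = 0
    · have hs : d.tgt k - P d.q k = 0 := by
        rw [hPq, hx.eq k hk h0, tgt, if_pos h0, sub_self]
      have h1 := hclU m hm k hk
      rw [traj_eq a _ h0]
      simp only [hU, hs, mul_zero, Int.zero_ediv, add_zero] at h1
      exact h1
    · rw [traj, nxt, if_neg h0]
      exact le_max_right _ _
  refine ⟨a, fun l hl => ⟨hall l hl, fun k hk => ⟨(hcl0 l).trans (hlo l hl k hk), ?_⟩⟩,
    fun k hk => le_antisymm ?_ ?_, ?_⟩
  · have h1 := hup (l + 1) hl k hk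
    have h2 := abs_le.1 (hUabs (l + 1) hl k hk)
    rw [W]
    push_cast
    linarith [h2.2]
  · have := hup d.q le_rfl k hk
    rwa [hUq k hk, zero_add] at this
  · obtain ⟨m, hm⟩ : ∃ m, d.q = m + 1 := ⟨d.q - 1, by omega⟩
    have := hlo m (by omega) k hk
    rwa [cl, if_pos hm.symm, ← hm] at this
  · rw [pathCost, hsum d.cst (by simp [cst]), value]
    refine Finset.sum_congr rfl fun p hp => ?_
    rw [cst, if_pos (Finset.mem_range.1 hp)]

end FoldData

/-! ### The table of the dynamic program in memory -/

namespace FoldData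

variable (d : FoldData)

/-- `S` is the length of a cell and `N` the number of cells in a layer. The arrays of the input word
follow; `aEnd` is the first address after it, still zero, and serves as the cost of the zero column.
-/
def S : ℕ := d.r + 4
def N : ℕ := d.W ^ d.r
def aRG : ℕ := 3 + d.n * d.t * d.r
def aRL : ℕ := d.aRG + d.r
def aBG : ℕ := d.aRL + d.n
def aBL : ℕ := d.aBG + d.r
def aC : ℕ := d.aBL + d.n
def aEnd : ℕ := d.aC + d.n * d.t
-- Working storage, one array after the other: the deficits, the remainders of `m * tgt` modulo `q`,
-- the moves of the centre, the digits of a candidate, a zero column, and the targets shifted by `D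
-- * q`. The table starts at `base`.
def aDef : ℕ := d.aEnd + 1
def aAcc : ℕ := d.aDef + d.n
def aInc : ℕ := d.aAcc + d.r
def aTmp : ℕ := d.aInc + d.r
def aZero : ℕ := d.aTmp + d.r
def aBS : ℕ := d.aZero + d.r
def base : ℕ := d.aBS + d.r

/-- The address of a cell of the table.  A cell consists of a mark, the cost, the address of the
predecessor, the last item, and the `r` digits. -/
def cell (m idx : ℕ) : ℕ := d.base + (m * d.N + idx) * d.S

/-- The number with the given digits in base `W`, most significant digit first. -/
def enc (z : ℕ → ℤ) : ℕ → ℤ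
  | 0 => 0
  | k + 1 => enc z k * d.W + z k

def InRange (z : ℕ → ℤ) : Prop := ∀ k < d.r, 0 ≤ z k ∧ z k < d.W

def idx (z : ℕ → ℤ) : ℕ := (d.enc z d.r).toNat

/-- The digits stored in a cell. -/
def dig (mem : ℕ → ℤ) (p k : ℕ) : ℤ := mem (p + 4 + k)

/-- Every cell of layer `m + 1` is empty or correctly derived from a cell of layer `m`. -/
def Linked (mem : ℕ → ℤ) (m : ℕ) : Prop :=
  ∀ i' < d.N, mem (d.cell (m + 1) i') = 0 ∨
    (mem (d.cell (m + 1) i') = 1 ∧ ∃ i < d.N, ∃ a, mem (d.cell m i) = 1 ∧ d.Allowed m a ∧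
      mem (d.cell (m + 1) i' + 1) = mem (d.cell m i + 1) + d.cst a ∧
      mem (d.cell (m + 1) i' + 2) = d.cell m i ∧
      mem (d.cell (m + 1) i' + 3) = a ∧
      (∀ k < d.r, dig mem (d.cell (m + 1) i') k = d.nxt m (dig mem (d.cell m i)) a k) ∧
      d.InRange (dig mem (d.cell (m + 1) i')) ∧ d.idx (dig mem (d.cell (m + 1) i')) = i')

/-- The transitions in `Done` from layer `m` have been taken into account. -/
def Complete (mem : ℕ → ℤ) (m : ℕ) (Done : ℕ → ℕ → Prop) : Prop :=
  ∀ i < d.N, mem (d.cell m i) = 1 → ∀ a, Done i a → d.InRange (d.nxt m (dig mem (d.cell m i)) a) →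
    mem (d.cell (m + 1) (d.idx (d.nxt m (dig mem (d.cell m i)) a))) = 1 ∧
    mem (d.cell (m + 1) (d.idx (d.nxt m (dig mem (d.cell m i)) a)) + 1) ≤
      mem (d.cell m i + 1) + d.cst a

/-- The digits of the centre. -/
def mid (_ : ℕ) : ℤ := d.H

/-- The only cell of layer `0` is the centre. -/
structure Start (mem : ℕ → ℤ) : Prop where
  mark : ∀ i < d.N, mem (d.cell 0 i) = if i = d.idx d.mid then 1 else 0
  cost : mem (d.cell 0 (d.idx d.mid) + 1) = 0
  dig : ∀ k < d.r, dig mem (d.cell 0 (d.idx d.mid)) k = d.H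

/-- The first `m` layers of the table are complete. -/
structure Table (mem : ℕ → ℤ) (m : ℕ) : Prop where
  start : d.Start mem
  linked : ∀ l < m, d.Linked mem l
  complete : ∀ l < m, d.Complete mem l fun _ a => d.Allowed l a

variable {d}

theorem W_pos : 0 < d.W := by unfold W; omega

theorem N_pos : 0 < d.N := pow_pos W_pos _

theorem InRange.enc_mem {z : ℕ → ℤ} (hz : d.InRange z) {k : ℕ} (hk : k ≤ d.r) :
    0 ≤ d.enc z k ∧ d.enc z k < (d.W ^ k : ℕ) := by
  induction k with
  | zero => simp [enc]
  | succ k ih =>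
    obtain ⟨h1, h2⟩ := ih (by omega)
    obtain ⟨h3, h4⟩ := hz k (by omega)
    refine ⟨by rw [enc]; positivity, ?_⟩
    have : (d.enc z k + 1) * d.W ≤ ((d.W ^ k : ℕ) : ℤ) * d.W :=
      mul_le_mul_of_nonneg_right (by omega) (by positivity)
    rw [enc, pow_succ, Nat.cast_mul]
    linarith

theorem InRange.idx_lt {z : ℕ → ℤ} (hz : d.InRange z) : d.idx z < d.N := by
  have := hz.enc_mem le_rfl
  unfold idx N
  omega

theorem InRange.cast_idx {z : ℕ → ℤ} (hz : d.InRange z) : (d.idx z : ℤ) = d.enc z d.r :=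
  Int.toNat_of_nonneg (hz.enc_mem le_rfl).1

theorem enc_congr {z z' : ℕ → ℤ} {k : ℕ} (h : ∀ j < k, z j = z' j) : d.enc z k = d.enc z' k := by
  induction k with
  | zero => rfl
  | succ k ih => rw [enc, enc, ih fun j hj => h j (by omega), h k (by omega)]

theorem idx_congr {z z' : ℕ → ℤ} (h : ∀ k < d.r, z k = z' k) : d.idx z = d.idx z' := by
  rw [idx, idx, enc_congr h]

theorem InRange.congr {z z' : ℕ → ℤ} (hz : d.InRange z) (h : ∀ k < d.r, z k = z' k) :
    d.InRange z' := fun k hk => h k hk ▸ hz k hk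

theorem enc_inj {z z' : ℕ → ℤ} (hz : d.InRange z) (hz' : d.InRange z') {k : ℕ} (hk : k ≤ d.r)
    (h : d.enc z k = d.enc z' k) : ∀ j < k, z j = z' j := by
  induction k with
  | zero => intro j hj; omega
  | succ k ih =>
    obtain ⟨h1, h2⟩ := hz k (by omega)
    obtain ⟨h3, h4⟩ := hz' k (by omega)
    rw [enc, enc] at h
    have hW : (0 : ℤ) < d.W := by exact_mod_cast W_pos
    have e1 : d.enc z k = d.enc z' k := by
      have := congrArg (· / (d.W : ℤ)) h
      simpa [Int.add_ediv_of_dvd_left, hW.ne', (W_pos (d := d)).ne', Int.ediv_eq_zero_of_lt h1 h2,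
        Int.ediv_eq_zero_of_lt h3 h4] using this
    intro j hj
    rcases Nat.lt_succ_iff_lt_or_eq.1 hj with hj | rfl
    · exact ih (by omega) e1 j hj
    · rw [e1] at h
      linarith

/-- A cell is found by its number alone. Injectivity identifies the digits stored there with those
of any path that leads to it. -/
theorem idx_inj {z z' : ℕ → ℤ} (hz : d.InRange z) (hz' : d.InRange z') (h : d.idx z = d.idx z') :
    ∀ k < d.r, z k = z' k :=
  enc_inj hz hz' le_rfl (by rw [← hz.cast_idx, ← hz'.cast_idx, h])

theorem inRange_mid : d.InRange d.mid := fun k _ => by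
  simp only [mid, W]
  push_cast
  omega

theorem nxt_congr {m : ℕ} {z z' : ℕ → ℤ} {a k : ℕ} (h : z k = z' k) :
    d.nxt m z a k = d.nxt m z' a k := by
  rw [nxt, nxt, h]

theorem cell_succ (m i : ℕ) : d.cell (m + 1) i = d.cell m (d.N + i) := by
  unfold cell
  ring_nf

theorem cell_add_le {m i j : ℕ} (h : i < j) : d.cell m i + d.S ≤ d.cell m j := by
  unfold cell
  rw [add_assoc, ← Nat.succ_mul]
  exact Nat.add_le_add_left (Nat.mul_le_mul_right _ (by omega)) _

theorem cell_mono {m m' i i' : ℕ} (h : m * d.N + i ≤ m' * d.N + i') : d.cell m i ≤ d.cell m' i' :=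
  Nat.add_le_add_left (Nat.mul_le_mul_right _ h) _

theorem cell_add_le_succ {m i : ℕ} (h : i < d.N) : d.cell m i + d.S ≤ d.cell (m + 1) 0 := by
  rw [cell_succ]
  exact cell_add_le (by omega)

theorem cell_zero_le (m i : ℕ) : d.cell m 0 ≤ d.cell m i := cell_mono (by omega)

theorem base_le (m i : ℕ) : d.base ≤ d.cell m i := Nat.le_add_right _ _

theorem cell_layer_mono {m m' : ℕ} (h : m ≤ m') : d.cell m 0 ≤ d.cell m' 0 :=
  cell_mono (by have := Nat.mul_le_mul_right d.N h; omega)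

theorem traj_congr {a a' : ℕ → ℕ} {m : ℕ} (h : ∀ l < m, a l = a' l) : d.traj a m = d.traj a' m := by
  induction m with
  | zero => rfl
  | succ m ih =>
    ext k
    rw [traj, traj, ih fun l hl => h l (by omega), h m (by omega)]

theorem IsPath.congr {a a' : ℕ → ℕ} {m : ℕ} (ha : d.IsPath a m) (h : ∀ l < m, a l = a' l) :
    d.IsPath a' m := fun l hl => by
  have := ha l hl
  rwa [h l hl, traj_congr fun l' hl' => h l' (by omega)] at this

theorem IsPath.inRange {a : ℕ → ℕ} {m : ℕ} (ha : d.IsPath a m) : d.InRange (d.traj a m) := by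
  cases m with
  | zero => exact inRange_mid
  | succ m => exact (ha m (Nat.lt_succ_self m)).2

theorem pathCost_congr {a a' : ℕ → ℕ} {m : ℕ} (h : ∀ l < m, a l = a' l) :
    d.pathCost a m = d.pathCost a' m :=
  Finset.sum_congr rfl fun l hl => by rw [h l (Finset.mem_range.1 hl)]

/-- A marked cell belongs to a path, which can be read off backwards. -/
theorem Table.exists_path {mem : ℕ → ℤ} {m : ℕ} (ht : d.Table mem m) {l : ℕ} (hl : l ≤ m) {i : ℕ}
    (hi : i < d.N) (hmark : mem (d.cell l i) = 1) :
    ∃ a P : ℕ → ℕ, d.IsPath a l ∧ (∀ k < d.r, d.traj a l k = dig mem (d.cell l i) k) ∧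
      d.idx (dig mem (d.cell l i)) = i ∧
      d.pathCost a l = mem (d.cell l i + 1) ∧ P l = d.cell l i ∧
      ∀ u < l, mem (P (u + 1) + 3) = a u ∧ mem (P (u + 1) + 2) = P u ∧ d.base ≤ P (u + 1) := by
  induction l generalizing i with
  | zero =>
    have h1 := ht.start.mark i hi
    have h2 : i = d.idx d.mid := by
      by_contra hne
      rw [if_neg hne, hmark] at h1
      exact one_ne_zero h1
    subst h2
    refine ⟨fun _ => 0, fun _ => d.cell 0 (d.idx d.mid), by simp [IsPath],
      fun k hk => (ht.start.dig k hk).symm, idx_congr fun k hk => ht.start.dig k hk, ?_, rfl,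
      by simp⟩
    rw [ht.start.cost]; simp [pathCost]
  | succ l ih =>
    rcases ht.linked l hl i hi with h0 | ⟨-, i₀, hi₀, b, hm₀, hb, hcost, hpred, hitem, hdig, hrange, hidx⟩
    · rw [hmark] at h0; exact absurd h0 one_ne_zero
    obtain ⟨a, P, hpath, htraj, -, hc, hP, hchain⟩ := ih (by omega) hi₀ hm₀
    have hag : ∀ u < l, a u = Function.update a l b u := fun u hu => by
      rw [Function.update_of_ne (by omega)]
    have htr : ∀ k < d.r, d.traj (Function.update a l b) (l + 1) k =
        dig mem (d.cell (l + 1) i) k := fun k hk => by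
      rw [traj, ← traj_congr hag, hdig k hk, Function.update_self]
      exact nxt_congr (htraj k hk)
    refine ⟨Function.update a l b, Function.update P (l + 1) (d.cell (l + 1) i), ?_, htr, hidx, ?_,
      by simp, fun u hu => ?_⟩
    · intro u hu
      rcases Nat.lt_succ_iff_lt_or_eq.1 hu with hu | rfl
      · exact hpath.congr hag u hu
      · rw [Function.update_self]
        exact ⟨hb, hrange.congr fun k hk => (htr k hk).symm⟩
    · rw [pathCost, Finset.sum_range_succ, ← pathCost, ← pathCost_congr hag, Function.update_self,
        hc, hcost]
    · rcases Nat.lt_succ_iff_lt_or_eq.1 hu with hu | rfl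
      · obtain ⟨h1, h2, h3⟩ := hchain u hu
        rw [Function.update_of_ne (by omega), Function.update_of_ne (by omega),
          Function.update_of_ne (by omega)]
        exact ⟨h1, h2, h3⟩
      · rw [Function.update_self, Function.update_self, Function.update_of_ne (by omega), hP]
        exact ⟨hitem, hpred, base_le _ _⟩

/-- The end of every path is marked, with at most the cost of the path. -/
theorem Table.of_path {mem : ℕ → ℤ} {m : ℕ} (ht : d.Table mem m) {l : ℕ} (hl : l ≤ m)
    {a : ℕ → ℕ} (ha : d.IsPath a l) :
    mem (d.cell l (d.idx (d.traj a l))) = 1 ∧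
      mem (d.cell l (d.idx (d.traj a l)) + 1) ≤ d.pathCost a l := by
  induction l with
  | zero =>
    have h0 : d.traj a 0 = d.mid := rfl
    rw [h0, ht.start.mark _ inRange_mid.idx_lt, if_pos rfl, ht.start.cost]
    exact ⟨rfl, by simp [pathCost]⟩
  | succ l ih =>
    have ha' : d.IsPath a l := fun u hu => ha u (by omega)
    obtain ⟨h1, h2⟩ := ih (by omega) ha'
    have hr := ha'.inRange
    obtain ⟨a', -, hp', htr', hidx, -⟩ := ht.exists_path (by omega) hr.idx_lt h1
    have hrd : d.InRange (dig mem (d.cell l (d.idx (d.traj a l)))) :=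
      hp'.inRange.congr fun k hk => htr' k hk
    have hd := idx_inj hrd hr hidx
    have hn : ∀ k < d.r, d.nxt l (dig mem (d.cell l (d.idx (d.traj a l)))) (a l) k =
        d.traj a (l + 1) k := fun k hk => nxt_congr (hd k hk)
    have hc := ht.complete l hl _ hr.idx_lt h1 (a l) (ha l (by omega)).1
      (ha.inRange.congr fun k hk => (hn k hk).symm)
    rw [idx_congr hn] at hc
    refine ⟨hc.1, hc.2.trans ?_⟩
    rw [pathCost, Finset.sum_range_succ, ← pathCost]
    linarith

end FoldData

/-! ### Stability of the table invariants, and the effect of one transition. -/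

namespace FoldData

variable {d : FoldData} {mem mem' mem₀ : ℕ → ℤ} {m : ℕ}

theorem dig_congr {p k : ℕ} (h : mem' (p + 4 + k) = mem (p + 4 + k)) :
    dig mem' p k = dig mem p k := h

/-- Layers `m` and `m + 1` lie between `base` and the start of layer `m + 2`, so nothing the
condition reads has changed. -/
theorem Linked.congr (h : d.Linked mem m)
    (he : ∀ x, d.base ≤ x → x < d.cell (m + 2) 0 → mem' x = mem x) : d.Linked mem' m := by
  have hS : d.S = d.r + 4 := rfl
  intro i' hi'
  have h1 := base_le (d := d) (m + 1) i'
  have h2 : _ ≤ d.cell (m + 2) 0 := cell_add_le_succ (m := m + 1) hi'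
  have e : ∀ u < d.S, mem' (d.cell (m + 1) i' + u) = mem (d.cell (m + 1) i' + u) := fun u hu =>
    he _ (by omega) (by omega)
  have e0 : mem' (d.cell (m + 1) i') = mem (d.cell (m + 1) i') := e 0 (by omega)
  rcases h i' hi' with h0 | ⟨hmk, i, hi, a, hm, ha, hc, hp, hit, hd, hr, hx⟩
  · left; rw [e0, h0]
  · right
    have h3 := base_le (d := d) m i
    have h4 := cell_add_le_succ (m := m) hi
    have h5 : d.cell (m + 1) 0 ≤ d.cell (m + 2) 0 := cell_layer_mono (by omega)
    have f : ∀ u < d.S, mem' (d.cell m i + u) = mem (d.cell m i + u) := fun u hu =>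
      he _ (by omega) (by omega)
    have f0 : mem' (d.cell m i) = mem (d.cell m i) := f 0 (by omega)
    have ed : ∀ k < d.r, dig mem (d.cell (m + 1) i') k = dig mem' (d.cell (m + 1) i') k :=
      fun k hk => (dig_congr (by rw [add_assoc]; exact e _ (by omega))).symm
    refine ⟨by rw [e0, hmk], i, hi, a, by rw [f0, hm], ha, ?_, ?_, ?_, fun k hk => ?_, hr.congr ed,
      ?_⟩
    · rw [e 1 (by omega), f 1 (by omega), hc]
    · rw [e 2 (by omega), hp]
    · rw [e 3 (by omega), hit]
    · rw [← ed k hk, hd k hk]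
      exact nxt_congr (dig_congr (by rw [add_assoc]; exact f _ (by omega))).symm
    · exact (idx_congr fun k hk => (ed k hk).symm).trans hx

theorem Complete.congr {Done : ℕ → ℕ → Prop} (h : d.Complete mem m Done)
    (he : ∀ x, d.base ≤ x → x < d.cell (m + 2) 0 → mem' x = mem x) : d.Complete mem' m Done := by
  have hS : d.S = d.r + 4 := rfl
  intro i hi hmk a hD hr
  have h3 := base_le (d := d) m i
  have h4 := cell_add_le_succ (m := m) hi
  have h5 : d.cell (m + 1) 0 ≤ d.cell (m + 2) 0 := cell_layer_mono (by omega)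
  have f : ∀ u < d.S, mem' (d.cell m i + u) = mem (d.cell m i + u) := fun u hu =>
    he _ (by omega) (by omega)
  have hn : ∀ k < d.r, d.nxt m (dig mem' (d.cell m i)) a k = d.nxt m (dig mem (d.cell m i)) a k :=
    fun k hk => nxt_congr (dig_congr (by rw [add_assoc]; exact f _ (by omega)))
  have f0 : mem' (d.cell m i) = mem (d.cell m i) := f 0 (by omega)
  have hr' := hr.congr hn
  have h1 := base_le (d := d) (m + 1) (d.idx (d.nxt m (dig mem (d.cell m i)) a))
  have h2 : _ ≤ d.cell (m + 2) 0 := cell_add_le_succ (m := m + 1) hr'.idx_lt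
  have := h i hi (by rw [← f0, hmk]) a hD hr'
  rwa [idx_congr hn, f 1 (by omega), he _ h1 (by omega), he _ (by omega) (by omega)]

theorem Start.congr (h : d.Start mem)
    (he : ∀ x, d.base ≤ x → x < d.cell 1 0 → mem' x = mem x) : d.Start mem' := by
  have hS : d.S = d.r + 4 := rfl
  have key : ∀ i < d.N, ∀ u < d.S, mem' (d.cell 0 i + u) = mem (d.cell 0 i + u) := by
    intro i hi u hu
    have h1 := base_le (d := d) 0 i
    have h2 : _ ≤ d.cell 1 0 := cell_add_le_succ (m := 0) hi
    exact he _ (by omega) (by omega)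
  have hm := inRange_mid (d := d).idx_lt
  refine ⟨fun i hi => ?_, ?_, fun k hk => ?_⟩
  · rw [← h.mark i hi]; exact key i hi 0 (by omega)
  · rw [← h.cost]; exact key _ hm 1 (by omega)
  · exact (dig_congr (by rw [add_assoc]; exact key _ hm _ (by omega))).trans (h.dig k hk)

theorem Table.congr (h : d.Table mem m)
    (he : ∀ x, d.base ≤ x → x < d.cell (m + 1) 0 → mem' x = mem x) : d.Table mem' m where
  start := h.start.congr fun x h1 h2 =>
    he x h1 (h2.trans_le (cell_layer_mono (by omega)))
  linked l hl := (h.linked l hl).congr fun x h1 h2 =>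
    he x h1 (h2.trans_le (cell_layer_mono (by omega)))
  complete l hl := (h.complete l hl).congr fun x h1 h2 =>
    he x h1 (h2.trans_le (cell_layer_mono (by omega)))

/-- Layer `m + 1` is being filled. -/
structure Progress (d : FoldData) (mem₀ mem : ℕ → ℤ) (m : ℕ) (Done : ℕ → ℕ → Prop) : Prop where
  frame : ∀ x, (x < d.aTmp ∨ d.aZero ≤ x) → (x < d.cell (m + 1) 0 ∨ d.cell (m + 2) 0 ≤ x) →
    mem x = mem₀ x
  linked : d.Linked mem m
  complete : d.Complete mem m Done

theorem Progress.mono {Done Done' : ℕ → ℕ → Prop} (h : d.Progress mem₀ mem m Done)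
    (hD : ∀ i a, Done' i a → i < d.N → mem (d.cell m i) = 1 → Done i a) :
    d.Progress mem₀ mem m Done' :=
  ⟨h.frame, h.linked, fun i hi hm a ha => h.complete i hi hm a (hD i a ha hi hm)⟩

/-- The effect of trying item `a` on cell `i` of layer `m`. -/
def Relaxed (d : FoldData) (mem mem' : ℕ → ℤ) (m i a : ℕ) : Prop :=
  let z := d.nxt m (dig mem (d.cell m i)) a
  let p := d.cell (m + 1) (d.idx z)
  let cost := mem (d.cell m i + 1) + d.cst a
  ((¬ d.InRange z ∨ (mem p ≠ 0 ∧ mem (p + 1) ≤ cost)) ∧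
    ∀ x, (x < d.aTmp ∨ d.aZero ≤ x) → mem' x = mem x) ∨
  (d.InRange z ∧ (mem p = 0 ∨ cost < mem (p + 1)) ∧ mem' p = 1 ∧ mem' (p + 1) = cost ∧
    mem' (p + 2) = d.cell m i ∧ mem' (p + 3) = a ∧ (∀ k < d.r, mem' (p + 4 + k) = z k) ∧
    ∀ x, (x < d.aTmp ∨ d.aZero ≤ x) → (x < p ∨ p + d.S ≤ x) → mem' x = mem x)

/-- Only one cell of layer `m + 1` may change, and none of layer `m`. A new entry is linked to a
marked cell, and costs never increase, so transitions already taken into account stay so. -/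
theorem Progress.relax {Done : ℕ → ℕ → Prop} (h : d.Progress mem₀ mem m Done) {i a : ℕ}
    (hi : i < d.N) (hmark : mem (d.cell m i) = 1) (ha : d.Allowed m a)
    (hR : d.Relaxed mem mem' m i a) :
    d.Progress mem₀ mem' m fun i' a' => Done i' a' ∨ (i' = i ∧ a' = a) := by
  have hS : d.S = d.r + 4 := rfl
  have hbase : d.base = d.aZero + d.r + d.r := rfl
  rcases hR with ⟨hno, hfr⟩ | ⟨hz, hbetter, h0, h1, h2, h3, h4, hfr⟩
  · have he : ∀ x, d.base ≤ x → mem' x = mem x := fun x hx => hfr x (by omega)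
    refine ⟨fun x hx hx' => by rw [hfr x hx, h.frame x hx hx'], h.linked.congr fun x hx _ => he x hx,
      Complete.congr ?_ fun x hx _ => he x hx⟩
    intro i' hi' hm' a' hD hr
    rcases hD with hD | ⟨rfl, rfl⟩
    · exact h.complete i' hi' hm' a' hD hr
    · have hno := hno.resolve_left (not_not.2 hr)
      rcases h.linked _ hr.idx_lt with h0 | h0
      · exact absurd h0 hno.1
      · exact ⟨h0.1, hno.2⟩
  · set z := d.nxt m (dig mem (d.cell m i)) a with hzdef
    have hp := hz.idx_lt
    set p := d.cell (m + 1) (d.idx z) with hpdef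
    have hp0 : d.cell (m + 1) 0 ≤ p := cell_zero_le _ _
    have hp1 : p + d.S ≤ d.cell (m + 2) 0 := cell_add_le_succ hp
    have hb0 := base_le (d := d) (m + 1) 0
    have fr_low : ∀ i' < d.N, ∀ u < d.S, mem' (d.cell m i' + u) = mem (d.cell m i' + u) := by
      intro i' hi' u hu
      have h1 := cell_add_le_succ (m := m) hi'
      have h2 := base_le (d := d) m i'
      exact hfr _ (by omega) (by omega)
    have fr_low0 : ∀ i' < d.N, mem' (d.cell m i') = mem (d.cell m i') := fun i' hi' =>
      fr_low i' hi' 0 (by omega)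
    have fr_oth : ∀ i', i' ≠ d.idx z → ∀ u < d.S,
        mem' (d.cell (m + 1) i' + u) = mem (d.cell (m + 1) i' + u) := by
      intro i' hne u hu
      have h2 := base_le (d := d) (m + 1) i'
      rcases lt_or_gt_of_ne hne with hlt | hgt
      · have := cell_add_le (d := d) (m := m + 1) hlt
        exact hfr _ (by omega) (by omega)
      · have := cell_add_le (d := d) (m := m + 1) hgt
        exact hfr _ (by omega) (by omega)
    have nx : ∀ i' < d.N, ∀ a', ∀ k < d.r, d.nxt m (dig mem' (d.cell m i')) a' k =
        d.nxt m (dig mem (d.cell m i')) a' k := fun i' hi' a' k hk =>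
      nxt_congr (dig_congr (by rw [add_assoc]; exact fr_low i' hi' _ (by omega)))
    have hdz : ∀ k < d.r, dig mem' p k = z k := h4
    refine ⟨fun x hx hx' => by rw [hfr x hx (by omega), h.frame x hx hx'], fun i' hi' => ?_,
      fun i' hi' hm' a' hD hr => ?_⟩
    · by_cases hii : i' = d.idx z
      · right
        rw [hii, ← hpdef]
        refine ⟨h0, i, hi, a, by rw [fr_low0 i hi, hmark], ha, ?_, h2, h3, fun k hk => ?_, ?_, ?_⟩
        · rw [h1, fr_low i hi 1 (by omega)]
        · rw [hdz k hk, nx i hi a k hk]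
        · exact hz.congr fun k hk => (hdz k hk).symm
        · exact idx_congr hdz
      · have e0 : mem' (d.cell (m + 1) i') = mem (d.cell (m + 1) i') := fr_oth i' hii 0 (by omega)
        rcases h.linked i' hi' with hl | ⟨hmk, j, hj, b, hm, hb, hc, hpr, hit, hd, hr, hx⟩
        · left; rw [e0, hl]
        · right
          have ed : ∀ k < d.r, dig mem (d.cell (m + 1) i') k = dig mem' (d.cell (m + 1) i') k :=
            fun k hk => (dig_congr (by rw [add_assoc]; exact fr_oth i' hii _ (by omega))).symm
          refine ⟨by rw [e0, hmk], j, hj, b, by rw [fr_low0 j hj, hm], hb, ?_, ?_, ?_,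
            fun k hk => ?_, hr.congr ed, ?_⟩
          · rw [fr_oth i' hii 1 (by omega), fr_low j hj 1 (by omega), hc]
          · rw [fr_oth i' hii 2 (by omega), hpr]
          · rw [fr_oth i' hii 3 (by omega), hit]
          · rw [← ed k hk, nx j hj b k hk, hd k hk]
          · exact (idx_congr fun k hk => (ed k hk).symm).trans hx
    · have hn := nx i' hi' a'
      have hr' := hr.congr hn
      rw [fr_low0 i' hi'] at hm'
      rw [idx_congr hn, fr_low i' hi' 1 (by omega)]
      rcases hD with hD | ⟨rfl, rfl⟩
      · obtain ⟨c1, c2⟩ := h.complete i' hi' hm' a' hD hr'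
        by_cases hii : d.idx (d.nxt m (dig mem (d.cell m i')) a') = d.idx z
        · rw [hii, ← hpdef] at c1 c2 ⊢
          refine ⟨h0, ?_⟩
          rw [h1]
          rcases hbetter with hb | hb
          · rw [c1] at hb; exact absurd hb one_ne_zero
          · linarith
        · rw [fr_oth _ hii 1 (by omega), ← add_zero (d.cell (m + 1) _), fr_oth _ hii 0 (by omega)]
          exact ⟨c1, c2⟩
      · exact ⟨h0, h1.le⟩

end FoldData

/-! ### The program: one transition

Registers `1 … 27` hold constants, see `FoldData.Env`.  The others are used as follows:
`28`, `29` current and next layer, `30` step, `31` selected brick, `32` its first item, `33` least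
admitted digit, `34` number of items, `44`, `45` current cell, `46`, `47`, `48` current item and the
address of its column, `50` whether the new digits are in range, `51` index of the new cell,
`59` its address, `60` the new cost. -/

namespace RAM

@[simp] theorem run_const (s : State) (d : ℕ) (z : ℤ) : (Instr.const d z).run s = s.set d z := rfl
@[simp] theorem run_move (s : State) (d a : ℕ) : (Instr.move d a).run s = s.set d (s.reg a) := rfl
@[simp] theorem run_add (s : State) (d a b : ℕ) :
    (Instr.add d a b).run s = s.set d (s.reg a + s.reg b) := rfl
@[simp] theorem run_sub (s : State) (d a b : ℕ) :
    (Instr.sub d a b).run s = s.set d (s.reg a - s.reg b) := rfl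
@[simp] theorem run_load (s : State) (d a : ℕ) :
    (Instr.load d a).run s = s.set d (s.mem (s.reg a).toNat) := rfl
@[simp] theorem run_store (s : State) (a b : ℕ) :
    (Instr.store a b).run s = s.put (s.reg a).toNat (s.reg b) := rfl

attribute [simp] State.set_reg State.put_mem Test.Holds

open Classical in
/-- One of two states, depending on a proposition. -/
noncomputable def State.select (c : Prop) (s s' : State) : State := if c then s else s'

open Classical in
@[simp] theorem State.select_reg (c : Prop) (s s' : State) (x : ℕ) :
    (State.select c s s').reg x = if c then s.reg x else s'.reg x := by
  unfold State.select; split_ifs <;> rfl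

open Classical in
@[simp] theorem State.select_mem (c : Prop) (s s' : State) :
    (State.select c s s').mem = if c then s.mem else s'.mem := by
  unfold State.select; split_ifs <;> rfl

/-- A conditional instruction. -/
def cond (c : Test) (i : Instr) : Program := .ite c (.instr i) .skip

/-- Both branches take two steps, so a conditional instruction can be treated like a single
instruction, without a case split. -/
theorem Runs.cond {c : Test} {i : Instr} {s : State} {Q : ℕ → State → Prop}
    (h : Q 2 (State.select (c.Holds s) (i.run s) s)) : Runs (cond c i) s Q := by
  refine Runs.ite (fun hc => Runs.instr ?_) fun hc => Runs.skip ?_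
  · rwa [State.select, if_pos hc] at h
  · rwa [State.select, if_neg hc] at h

end RAM

/-! ### Input, constant registers and the digits of a candidate. -/

namespace FoldData

open RAM

variable {d : FoldData}

/-- The memory holds the instance. -/
structure Input (d : FoldData) (mem : ℕ → ℤ) : Prop where
  T : ∀ a < d.n * d.t, ∀ k < d.r, mem (3 + a * d.r + k) = d.T a k
  relG : ∀ k < d.r, mem (d.aRG + k) = d.relG k
  relL : ∀ i < d.n, mem (d.aRL + i) = d.relL i
  bG : ∀ k < d.r, mem (d.aBG + k) = d.bG k
  bL : ∀ i < d.n, mem (d.aBL + i) = d.bL i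
  c : ∀ a < d.n * d.t, mem (d.aC + a) = d.c a
  zero : mem d.aEnd = 0

theorem Input.congr {mem mem' : ℕ → ℤ} (h : d.Input mem) (he : ∀ x ≤ d.aEnd, mem' x = mem x) :
    d.Input mem' := by
  have e1 : d.aRG = 3 + d.n * d.t * d.r := rfl
  have e2 : d.aRL = d.aRG + d.r := rfl
  have e3 : d.aBG = d.aRL + d.n := rfl
  have e4 : d.aBL = d.aBG + d.r := rfl
  have e5 : d.aC = d.aBL + d.n := rfl
  have e6 : d.aEnd = d.aC + d.n * d.t := rfl
  refine ⟨fun a ha k hk => ?_, fun k hk => ?_, fun k hk => ?_, fun k hk => ?_, fun k hk => ?_,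
    fun k hk => ?_, ?_⟩
  · have := index_lt ha hk
    rw [he _ (by omega), h.T a ha k hk]
  · rw [he _ (by omega), h.relG k hk]
  · rw [he _ (by omega), h.relL k hk]
  · rw [he _ (by omega), h.bG k hk]
  · rw [he _ (by omega), h.bL k hk]
  · rw [he _ (by omega), h.c k hk]
  · rw [he _ le_rfl, h.zero]

theorem Input.cst {mem : ℕ → ℤ} (h : d.Input mem) {a : ℕ} (ha : a ≤ d.n * d.t) :
    mem (d.aC + a) = d.cst a := by
  unfold FoldData.cst
  split_ifs with hlt
  · exact h.c a hlt
  · rw [show a = d.n * d.t by omega]; exact h.zero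

/-- The contents of the registers that do not change while the table is filled. -/
structure Env (d : FoldData) (s : State) : Prop where
  r1 : s.reg 1 = 1
  r2 : s.reg 2 = 0
  r3 : s.reg 3 = d.n
  r4 : s.reg 4 = d.r
  r5 : s.reg 5 = d.t
  r6 : s.reg 6 = (d.n * d.t : ℕ)
  r7 : s.reg 7 = d.aRG
  r8 : s.reg 8 = d.aRL
  r9 : s.reg 9 = d.aBG
  r10 : s.reg 10 = d.aBL
  r11 : s.reg 11 = d.aC
  r12 : s.reg 12 = d.q
  r13 : s.reg 13 = d.D
  r14 : s.reg 14 = (d.D * d.q : ℕ)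
  r15 : s.reg 15 = d.H
  r16 : s.reg 16 = d.W
  r17 : s.reg 17 = d.S
  r18 : s.reg 18 = d.N
  r19 : s.reg 19 = (d.N * d.S : ℕ)
  r20 : s.reg 20 = d.aDef
  r21 : s.reg 21 = d.aAcc
  r22 : s.reg 22 = d.aInc
  r23 : s.reg 23 = d.aTmp
  r24 : s.reg 24 = d.aZero
  r25 : s.reg 25 = d.aBS
  r26 : s.reg 26 = (2 * d.D : ℕ)
  r27 : s.reg 27 = (d.idx d.mid * d.S : ℕ)

theorem Env.congr {s s' : State} (h : d.Env s) (he : ∀ x < 28, s'.reg x = s.reg x) : d.Env s' := by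
  constructor <;> rw [he _ (by norm_num)]
  exacts [h.r1, h.r2, h.r3, h.r4, h.r5, h.r6, h.r7, h.r8, h.r9, h.r10, h.r11, h.r12, h.r13, h.r14,
    h.r15, h.r16, h.r17, h.r18, h.r19, h.r20, h.r21, h.r22, h.r23, h.r24, h.r25, h.r26, h.r27]

theorem Env.frame {p : Program} {s s' : State} (h : d.Env s)
    (hf : ∀ x, p.writes x = false → s'.reg x = s.reg x) (hp : ∀ x < 28, p.writes x = false) :
    d.Env s' := h.congr fun x hx => hf x (hp x hx)

/-- `R_52` becomes the new digit number `R_49`, before it is cut off. -/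
def digitLoad : Program :=
  block [.const 53 4, .add 53 53 45, .add 53 53 49, .load 52 53, .add 53 48 49, .load 54 53,
    .add 53 7 49, .load 55 53] ⨾
  cond (.eq 55 1) (.sub 54 2 54) ⨾
  block [.add 52 52 54, .add 53 22 49, .load 56 53, .sub 52 52 56]

/-- The uncut digit is kept in register `54`, from which an equality row restores it. -/
def digitCut : Program :=
  .instr (.move 54 52) ⨾ cond (.lt 52 33) (.move 52 33) ⨾ cond (.eq 55 2) (.move 52 54)

/-- One step of Horner's rule. The multiplication by repeated addition is the source of the factor
`W` in the cost of a transition. -/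
def digitPush : Program :=
  cond (.lt 52 2) (.const 50 0) ⨾ cond (.le 16 52) (.const 50 0) ⨾
  block [.add 53 23 49, .store 53 52] ⨾ mul 57 51 16 58 ⨾ .instr (.add 51 57 52)

def digits : Program :=
  block [.const 50 1, .const 51 0] ⨾ .for 49 4 (digitLoad ⨾ digitCut ⨾ digitPush)

theorem runs_digitLoad {s : State} (hE : d.Env s) {p c k : ℕ} {z v w : ℤ} (h45 : s.reg 45 = p)
    (h48 : s.reg 48 = c) (h49 : s.reg 49 = k) (hz : s.mem (p + 4 + k) = z)
    (hr : s.mem (d.aRG + k) = d.relG k)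
    (hv : (if d.relG k = 1 then -s.mem (c + k) else s.mem (c + k)) = v)
    (hw : s.mem (d.aInc + k) = w) :
    Runs digitLoad s fun K s' => K ≤ 16 ∧ s'.reg 52 = z + v - w ∧ s'.reg 55 = d.relG k := by
  have a1 : (4 + (p : ℤ) + k).toNat = p + 4 + k := by omega
  have a2 : ((c : ℤ) + k).toNat = c + k := by omega
  have a3 : ((d.aRG : ℤ) + k).toNat = d.aRG + k := by omega
  have a4 : ((d.aInc : ℤ) + k).toNat = d.aInc + k := by omega
  refine Runs.seq (Runs.block (Runs.seq (Runs.cond (Runs.block ?_))))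
  simp [h45, h48, h49, a1, a2, a3, a4, hz, hr, hw, hE.r1, hE.r2, hE.r7, hE.r22, hv]

theorem runs_digitCut {s : State} (hE : d.Env s) {m k a : ℕ} {z : ℕ → ℤ}
    (h33 : s.reg 33 = d.cl m) (h52 : s.reg 52 = z k + d.vec a k - d.inc m k)
    (h55 : s.reg 55 = d.relG k) :
    Runs digitCut s fun K s' => K ≤ 5 ∧ s'.reg 52 = d.nxt m z a k := by
  refine Runs.seq (Runs.instr (Runs.seq (Runs.cond (Runs.cond ?_))))
  simp only [run_move, State.select_reg, Test.Holds, State.set_reg]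
  simp only [Nat.reduceEqDiff, if_true, if_false, ite_self, h33, h52, h55, hE.r2, nxt]
  refine ⟨le_rfl, ?_⟩
  split_ifs with h1 h2
  · rfl
  · rw [max_eq_right h2.le]
  · rw [max_eq_left (not_lt.1 h2)]

theorem runs_digitPush {s : State} (hE : d.Env s) {k : ℕ} {e u : ℤ} (h49 : s.reg 49 = k)
    (h51 : s.reg 51 = u) (h52 : s.reg 52 = e) :
    Runs digitPush s fun K s' => K ≤ 3 * d.W + 11 ∧ s'.reg 51 = u * d.W + e ∧
      s'.reg 50 = (if 0 ≤ e ∧ e < d.W then s.reg 50 else 0) ∧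
      s'.mem = Function.update s.mem (d.aTmp + k) e := by
  have a1 : ((d.aTmp : ℤ) + k).toNat = d.aTmp + k := by omega
  refine Runs.seq (Runs.cond (Runs.seq (Runs.cond (Runs.seq (Runs.block (Runs.seq (Runs.mul
    (y := d.W) ?_ ?_ (by norm_num) fun K hK => Runs.instr ?_)))))))
  · simp [hE.r1]
  · simp [hE.r16]
  · refine ⟨?_, ?_, ?_, ?_⟩
    · simp only [List.length_cons, List.length_nil]
      omega
    · simp [h51, h52]
    · simp only [List.foldl_cons, List.foldl_nil, run_const, run_add, run_store, State.set_reg,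
        State.put_reg, State.select_reg, Test.Holds]
      simp only [Nat.reduceEqDiff, if_true, if_false, ite_self, hE.r2, hE.r16, h52]
      by_cases h1 : e < 0
      · have h3 : ¬ (0 ≤ e ∧ e < d.W) := by omega
        simp only [h1, h3, if_true, if_false, ite_self]
      · by_cases h2 : (d.W : ℤ) ≤ e
        · have h3 : ¬ (0 ≤ e ∧ e < d.W) := by omega
          simp only [h2, h3, if_true, if_false]
        · have h3 : 0 ≤ e ∧ e < d.W := by omega
          simp only [h1, h2, h3, if_true, if_false, and_self]
    · simp [State.put, h52, h49, hE.r23, a1]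

/-- The digits are kept along with the number, since no division is available to recover them from
it. The condition on `c` separates the column being read from the scratch array being written. -/
theorem runs_digits {s : State} (hE : d.Env s) {m c p a : ℕ}
    (hrel : ∀ k < d.r, s.mem (d.aRG + k) = d.relG k)
    (hinc : ∀ k < d.r, s.mem (d.aInc + k) = d.inc m k)
    (hv : ∀ k < d.r, (if d.relG k = 1 then -s.mem (c + k) else s.mem (c + k)) = d.vec a k)
    (hc : c + d.r ≤ d.aTmp ∨ d.aZero ≤ c) (hp : d.base ≤ p) (h33 : s.reg 33 = d.cl m)
    (h45 : s.reg 45 = p) (h48 : s.reg 48 = c) :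
    Runs digits s fun K s' => K ≤ d.r * (3 * d.W + 34) + 5 ∧
      s'.reg 51 = d.enc (d.nxt m (dig s.mem p) a) d.r ∧
      (s'.reg 50 = 1 ↔ d.InRange (d.nxt m (dig s.mem p) a)) ∧
      (∀ k < d.r, s'.mem (d.aTmp + k) = d.nxt m (dig s.mem p) a k) ∧
      ∀ x, (x < d.aTmp ∨ d.aZero ≤ x) → s'.mem x = s.mem x := by
  have e1 : d.aRG + d.r = d.aRL := rfl
  have e2 : d.aRL + d.n = d.aBG := rfl
  have e3 : d.aBG + d.r + d.n + d.n * d.t + 1 + d.n = d.aAcc := rfl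
  have e4 : d.aAcc + d.r = d.aInc := rfl
  have e5 : d.aInc + d.r = d.aTmp := rfl
  have e6 : d.aTmp + d.r = d.aZero := rfl
  have e7 : d.aZero + d.r + d.r = d.base := rfl
  set e := d.nxt m (dig s.mem p) a with he
  refine Runs.then (Q' := fun K s₁ => K = 3 ∧ s₁.reg 50 = 1 ∧ s₁.reg 51 = 0)
    (Runs.block (by simp)) ?_
  rintro K₁ s₁ ⟨rfl, h50, h51⟩ hf₁ hm₁
  have hm₁ := hm₁ rfl
  have hE₁ : d.Env s₁ := hE.frame hf₁ (by decide)
  refine (Runs.for (n := d.r) (K := 3 * d.W + 32) (fun j s' => s'.reg 51 = d.enc e j ∧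
    s'.reg 50 = (if ∀ k < j, 0 ≤ e k ∧ e k < d.W then 1 else 0) ∧
    (∀ k < j, s'.mem (d.aTmp + k) = e k) ∧
    ∀ x, (x < d.aTmp ∨ d.aZero ≤ x) → s'.mem x = s.mem x) hE₁.r1 hE₁.r4 (by decide) ?_ ?_).mono ?_
  · simp [h50, h51, enc, hm₁]
  · rintro j hj s₂ hf₂ - h49 ⟨i51, i50, itmp, ifr⟩
    have hE₂ : d.Env s₂ := hE₁.congr fun x hx =>
      hf₂ x ((by decide : ∀ x < 28, (digitLoad ⨾ digitCut ⨾ digitPush).writes x = false) x hx)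
        (by omega)
    have f33 : s₂.reg 33 = d.cl m := by rw [hf₂ 33 rfl (by norm_num), hf₁ 33 rfl, h33]
    have f45 : s₂.reg 45 = p := by rw [hf₂ 45 rfl (by norm_num), hf₁ 45 rfl, h45]
    have f48 : s₂.reg 48 = c := by rw [hf₂ 48 rfl (by norm_num), hf₁ 48 rfl, h48]
    refine Runs.then (runs_digitLoad hE₂ (z := dig s.mem p j) (v := d.vec a j) (w := d.inc m j)
      f45 f48 h49 ?_ ?_ ?_ ?_) ?_
    · rw [ifr _ (by omega)]; rfl
    · rw [ifr _ (by omega), hrel j hj]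
    · rw [ifr _ (by omega), hv j hj]
    · rw [ifr _ (by omega), hinc j hj]
    rintro K₃ s₃ ⟨hK₃, g52, g55⟩ hf₃ hm₃
    have hE₃ : d.Env s₃ := hE₂.frame hf₃ (by decide)
    refine Runs.then (runs_digitCut hE₃ (by rw [hf₃ 33 rfl, f33]) g52 g55) ?_
    rintro K₄ s₄ ⟨hK₄, g52'⟩ hf₄ hm₄
    have hE₄ : d.Env s₄ := hE₃.frame hf₄ (by decide)
    have hm₄ : s₄.mem = s₂.mem := by rw [hm₄ rfl, hm₃ rfl]
    refine (runs_digitPush hE₄ (k := j) (u := d.enc e j) (e := e j) ?_ ?_ g52').mono ?_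
    · rw [hf₄ 49 rfl, hf₃ 49 rfl, h49]
    · rw [hf₄ 51 rfl, hf₃ 51 rfl, i51]
    rintro K₅ s₅ ⟨hK₅, g51, g50, gm⟩
    rw [hm₄] at gm
    refine ⟨by omega, ?_, ?_, ?_, ?_⟩
    · simp [g51, enc]
    · have : (∀ k < j + 1, 0 ≤ e k ∧ e k < d.W) ↔
          (0 ≤ e j ∧ e j < d.W) ∧ ∀ k < j, 0 ≤ e k ∧ e k < d.W := by
        constructor
        · exact fun h => ⟨h j (by omega), fun k hk => h k (by omega)⟩
        · intro h k hk
          rcases Nat.lt_succ_iff_lt_or_eq.1 hk with hk | rfl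
          · exact h.2 k hk
          · exact h.1
      simp only [State.set_reg, Nat.reduceEqDiff, if_false, g50, hf₄ 50 rfl, hf₃ 50 rfl, i50, this]
      by_cases hr : 0 ≤ e j ∧ e j < d.W <;> simp [hr]
    · intro k hk
      simp only [State.set_mem, gm, Function.update_apply]
      rcases Nat.lt_succ_iff_lt_or_eq.1 hk with hk | rfl
      · rw [if_neg (by omega), itmp k hk]
      · rw [if_pos rfl]
    · intro x hx
      simp only [State.set_mem, gm, Function.update_apply]
      rw [if_neg (by omega), ifr x hx]
  · rintro K s' ⟨hK, ⟨i51, i50, itmp, ifr⟩, -⟩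
    refine ⟨by rw [show 3 * d.W + 32 + 2 = 3 * d.W + 34 from rfl] at hK; omega, i51, ?_, itmp, ifr⟩
    rw [i50, InRange]
    split_ifs with h
    · exact ⟨fun _ => h, fun _ => rfl⟩
    · exact ⟨fun h' => absurd h' (by norm_num), fun h' => absurd h' h⟩

end FoldData

/-! ### Improving a cell of the next layer. -/

namespace FoldData

open RAM

variable {d : FoldData}

def copyDigit : Program :=
  block [.add 53 23 49, .load 54 53, .const 53 4, .add 53 53 59, .add 53 53 49, .store 53 54]

/-- Write the cell at address `R_59`. -/
def storeCell : Program :=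
  block [.store 59 1, .store 63 60, .add 63 63 1, .store 63 45, .add 63 63 1, .store 63 47] ⨾
  .for 49 4 copyDigit

/-- Try to improve the cell with number `R_51` of the next layer. -/
def improve : Program :=
  mul 59 51 17 70 ⨾
  block [.add 59 59 29, .add 60 45 1, .load 60 60, .add 61 11 47, .load 61 61, .add 60 60 61,
    .load 62 59, .add 63 59 1, .load 64 63, .const 65 0] ⨾
  cond (.eq 62 2) (.const 65 1) ⨾ cond (.lt 60 64) (.const 65 1) ⨾
  .ite (.eq 65 1) storeCell .skip

def relax : Program := digits ⨾ .ite (.eq 50 1) improve .skip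

theorem cell_eq (m i : ℕ) : d.cell m i = d.cell m 0 + i * d.S := by
  unfold cell
  ring

theorem runs_storeCell {s : State} (hE : d.Env s) {p p' a : ℕ} {cost : ℤ} {e : ℕ → ℤ}
    (hp' : d.base ≤ p') (h45 : s.reg 45 = p) (h47 : s.reg 47 = a) (h59 : s.reg 59 = p')
    (h60 : s.reg 60 = cost) (h63 : s.reg 63 = p' + 1)
    (htmp : ∀ k < d.r, s.mem (d.aTmp + k) = e k) :
    Runs storeCell s fun K s' => K ≤ d.r * 9 + 9 ∧ s'.mem p' = 1 ∧ s'.mem (p' + 1) = cost ∧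
      s'.mem (p' + 2) = p ∧ s'.mem (p' + 3) = a ∧ (∀ k < d.r, s'.mem (p' + 4 + k) = e k) ∧
      ∀ x, (x < p' ∨ p' + d.S ≤ x) → s'.mem x = s.mem x := by
  have e6 : d.aTmp + d.r = d.aZero := rfl
  have e7 : d.aZero + d.r + d.r = d.base := rfl
  have hS : d.S = d.r + 4 := rfl
  refine Runs.then (Q' := fun K s₁ => K = 7 ∧ s₁.mem p' = 1 ∧ s₁.mem (p' + 1) = cost ∧
    s₁.mem (p' + 2) = p ∧ s₁.mem (p' + 3) = a ∧
      ∀ x, (x < p' ∨ p' + 4 ≤ x) → s₁.mem x = s.mem x) (Runs.block ?_) ?_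
  · have a1 : ((p' : ℤ) + 1).toNat = p' + 1 := by omega
    have a2 : ((p' : ℤ) + 1 + 1).toNat = p' + 2 := by omega
    have a3 : ((p' : ℤ) + 1 + 1 + 1).toNat = p' + 3 := by omega
    simp [h45, h47, h59, h60, h63, hE.r1, a1, a2, a3]
    intro x hx
    rw [if_neg (by omega), if_neg (by omega), if_neg (by omega), if_neg (by omega)]
  rintro K₁ s₁ ⟨rfl, m0, m1, m2, m3, mf⟩ hf₁ -
  have hE₁ : d.Env s₁ := hE.frame hf₁ (by decide)
  refine (Runs.for (n := d.r) (K := 7) (fun j s' => (∀ k < j, s'.mem (p' + 4 + k) = e k) ∧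
    ∀ x, (x < p' + 4 ∨ p' + 4 + j ≤ x) → s'.mem x = s₁.mem x) hE₁.r1 hE₁.r4 (by decide) ?_ ?_).mono ?_
  · simp
  · rintro j hj s₂ hf₂ - h49 ⟨hd, hfr⟩
    have hE₂ : d.Env s₂ := hE₁.congr fun x hx =>
      hf₂ x ((by decide : ∀ x < 28, copyDigit.writes x = false) x hx) (by omega)
    have a1 : ((d.aTmp : ℤ) + j).toNat = d.aTmp + j := by omega
    have a2 : (4 + (p' : ℤ) + j).toNat = p' + 4 + j := by omega
    have f59 : s₂.reg 59 = p' := by rw [hf₂ 59 rfl (by norm_num), hf₁ 59 rfl, h59]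
    have g : s₂.mem (d.aTmp + j) = e j := by
      rw [hfr _ (by omega), mf _ (by omega), htmp j hj]
    refine Runs.block ?_
    simp [h49, hE₂.r23, a1, a2, f59, g]
    refine ⟨fun k hk => ?_, fun x hx => ?_⟩
    · split_ifs with h
      · rw [h]
      · exact hd k (by omega)
    · rw [if_neg (by omega), hfr x (by omega)]
  · rintro K s' ⟨hK, ⟨hd, hfr⟩, -⟩
    refine ⟨by omega, ?_, ?_, ?_, ?_, hd, fun x hx => ?_⟩
    · rw [hfr _ (by omega), m0]
    · rw [hfr _ (by omega), m1]
    · rw [hfr _ (by omega), m2]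
    · rw [hfr _ (by omega), m3]
    · rw [hfr _ (by omega), mf _ (by omega)]

/-- The column of an item. -/
def col (d : FoldData) (a : ℕ) : ℕ := if a < d.n * d.t then 3 + a * d.r else d.aZero

theorem runs_relax {s : State} (hE : d.Env s) {m i a : ℕ} (hin : d.Input s.mem)
    (hinc : ∀ k < d.r, s.mem (d.aInc + k) = d.inc m k)
    (hzero : ∀ k < d.r, s.mem (d.aZero + k) = 0) (ha : a ≤ d.n * d.t)
    (h29 : s.reg 29 = d.cell (m + 1) 0) (h33 : s.reg 33 = d.cl m) (h45 : s.reg 45 = d.cell m i)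
    (h47 : s.reg 47 = a) (h48 : s.reg 48 = d.col a) :
    Runs relax s fun K s' => K ≤ d.r * (3 * d.W + 46) + 50 ∧ d.Relaxed s.mem s'.mem m i a := by
  have e0 : d.aRG = 3 + d.n * d.t * d.r := rfl
  have e1 : d.aRG + d.r = d.aRL := rfl
  have e2 : d.aRL + d.n + d.r + d.n = d.aC := rfl
  have e3 : d.aC + d.n * d.t + 1 + d.n = d.aAcc := rfl
  have e4 : d.aAcc + d.r = d.aInc := rfl
  have e5 : d.aInc + d.r = d.aTmp := rfl
  have e6 : d.aTmp + d.r = d.aZero := rfl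
  have e7 : d.aZero + d.r + d.r = d.base := rfl
  have hS : d.S = d.r + 4 := rfl
  have hb := base_le (d := d) m i
  refine Runs.then (runs_digits hE (m := m) (c := d.col a) (p := d.cell m i) (a := a) hin.relG hinc
    ?_ ?_ hb h33 h45 h48) ?_
  · intro k hk
    unfold vec col
    by_cases h : a < d.n * d.t
    · rw [if_pos h, if_pos h, hin.T a h k hk]
    · rw [if_neg h, if_neg h, hzero k hk]; simp
  · unfold col
    split_ifs with h
    · left
      have : (a + 1) * d.r ≤ d.n * d.t * d.r := Nat.mul_le_mul_right _ h
      rw [add_mul] at this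
      omega
    · right; exact le_rfl
  rintro K₁ s₁ ⟨hK₁, h51, h50, htmp, hfr⟩ hf₁ -
  have hE₁ : d.Env s₁ := hE.frame hf₁ (by decide)
  set z := d.nxt m (dig s.mem (d.cell m i)) a with hz
  refine Runs.ite (fun hc => ?_) fun hc => Runs.skip ?_
  swap
  · refine ⟨by rw [mul_add] at hK₁ ⊢; omega, .inl ⟨.inl fun hr => hc ?_, hfr⟩⟩
    change s₁.reg 50 = s₁.reg 1
    rw [h50.2 hr, hE₁.r1]
  have hr : d.InRange z := h50.1 (by
    have : s₁.reg 50 = s₁.reg 1 := hc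
    rw [this, hE₁.r1])
  set p' := d.cell (m + 1) (d.idx z) with hp'
  have hb' : d.base ≤ p' := base_le _ _
  have g11 : s₁.mem (d.aC + a) = d.cst a := by
    rw [hfr _ (by omega), hin.cst ha]
  have g45 : s₁.mem (d.cell m i + 1) = s.mem (d.cell m i + 1) := hfr _ (by omega)
  have gp : s₁.mem p' = s.mem p' := hfr _ (by omega)
  have gp1 : s₁.mem (p' + 1) = s.mem (p' + 1) := hfr _ (by omega)
  refine Runs.seq (Runs.mul hE₁.r1 hE₁.r17 (by norm_num) fun K₂ hK₂ => ?_)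
  refine Runs.then (Q' := fun K s₂ => K = 11 ∧ s₂.reg 59 = p' ∧ s₂.reg 63 = p' + 1 ∧
    s₂.reg 60 = s.mem (d.cell m i + 1) + d.cst a ∧ s₂.reg 62 = s.mem p' ∧
    s₂.reg 64 = s.mem (p' + 1) ∧ s₂.reg 65 = 0) (Runs.block ?_) ?_
  · have a1 : (d.enc z d.r * d.S + (d.cell (m + 1) 0 : ℤ)) = p' := by
      rw [hp', cell_eq (m + 1) (d.idx z), ← hr.cast_idx]; push_cast; ring
    have a2 : ((d.cell m i : ℤ) + 1).toNat = d.cell m i + 1 := by omega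
    have a3 : ((d.aC : ℤ) + a).toNat = d.aC + a := by omega
    have a4 : ((p' : ℤ) + 1).toNat = p' + 1 := by omega
    simp [hf₁ 29 rfl, hf₁ 45 rfl, hf₁ 47 rfl, h29, h45, h47, h51, hE₁.r1, hE₁.r11, a1, a2, a3,
      a4, g11, g45, gp, gp1]
  rintro K₃ s₃ ⟨rfl, f59, f63, f60, f62, f64, f65⟩ hf₃ hm₃
  have hm₃ := hm₃ rfl
  have hE₃ : d.Env s₃ := by
    refine hE₁.congr fun x hx => ?_
    rw [hf₃ x ((by decide : ∀ x < 28, (block [.add 59 59 29, .add 60 45 1, .load 60 60,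
      .add 61 11 47, .load 61 61, .add 60 60 61, .load 62 59, .add 63 59 1, .load 64 63,
      .const 65 0]).writes x = false) x hx), State.set_reg, State.set_reg, if_neg (by omega),
      if_neg (by omega)]
  refine Runs.seq (Runs.cond (Runs.seq (Runs.cond ?_)))
  have f45 : s₃.reg 45 = d.cell m i := by
    rw [hf₃ 45 rfl]; simp [hf₁ 45 rfl, h45]
  have f47 : s₃.reg 47 = a := by
    rw [hf₃ 47 rfl]; simp [hf₁ 47 rfl, h47]
  set s₄ := State.select (Test.Holds (.lt 60 64) (State.select (Test.Holds (.eq 62 2) s₃)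
    ((Instr.const 65 1).run s₃) s₃)) ((Instr.const 65 1).run (State.select (Test.Holds (.eq 62 2) s₃)
    ((Instr.const 65 1).run s₃) s₃)) (State.select (Test.Holds (.eq 62 2) s₃)
    ((Instr.const 65 1).run s₃) s₃) with hs₄
  have f4 : ∀ x, x ≠ 65 → s₄.reg x = s₃.reg x := by
    intro x hx
    simp only [hs₄, State.select_reg, run_const, State.set_reg, if_neg hx, ite_self]
  have m4 : s₄.mem = s₁.mem := by
    simp only [hs₄, State.select_mem, run_const, State.set_mem, ite_self, hm₃]
  have f4' : s₄.reg 65 = 1 ↔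
      (s.mem p' = 0 ∨ s.mem (d.cell m i + 1) + d.cst a < s.mem (p' + 1)) := by
    simp only [hs₄, State.select_reg, run_const, State.set_reg, Test.Holds]
    simp only [Nat.reduceEqDiff, if_true, if_false, ite_self, f60, f62, f64, f65, hE₃.r2]
    split_ifs <;> simp_all
  have hE₄ : d.Env s₄ := hE₃.congr fun x hx => f4 x (by omega)
  refine Runs.ite (fun hc => ?_) fun hc => Runs.skip ?_
  · have hb1 := f4'.1 (by
      have : s₄.reg 65 = s₄.reg 1 := hc
      rw [this, hE₄.r1])
    refine (runs_storeCell hE₄ hb' (by rw [f4 _ (by norm_num), f45])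
      (by rw [f4 _ (by norm_num), f47]) (by rw [f4 _ (by norm_num), f59])
      (by rw [f4 _ (by norm_num), f60]) (by rw [f4 _ (by norm_num), f63])
      (by rw [m4]; exact htmp)).mono ?_
    rintro K s' ⟨hK, q0, q1, q2, q3, q4, q5⟩
    refine ⟨?_, .inr ⟨hr, hb1, q0, q1, q2, q3, q4, fun x hx hx' => ?_⟩⟩
    · rw [mul_add] at hK₁ ⊢; omega
    · rw [q5 x hx', m4, hfr x hx]
  · have hb1 := mt f4'.2 (fun h => hc (by
      change s₄.reg 65 = s₄.reg 1
      rw [h, hE₄.r1]))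
    push Not at hb1
    refine ⟨?_, .inl ⟨.inr hb1, fun x hx => by rw [m4, hfr x hx]⟩⟩
    rw [mul_add] at hK₁ ⊢; omega

end FoldData

/-! ### All items in all cells of a layer. -/

namespace FoldData

open RAM

variable {d : FoldData} {mem₀ : ℕ → ℤ} {m : ℕ}

/-- `R_47` becomes item number `R_46` of the selected brick, `R_48` its column. -/
def pickItem : Program :=
  .instr (.add 47 32 46) ⨾ mul 48 47 4 71 ⨾ block [.const 53 3, .add 48 48 53] ⨾
  .ite (.eq 46 5) (block [.move 47 6, .move 48 24]) .skip

def items : Program := .for 46 34 (pickItem ⨾ relax)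

def cells : Program :=
  .instr (.move 45 28) ⨾
  .for 44 18 (.instr (.load 53 45) ⨾ .ite (.eq 53 1) items .skip ⨾ .instr (.add 45 45 17))

/-- The number of items to be tried in step `m`. -/
def itemCount (d : FoldData) (m : ℕ) : ℕ := d.t + if d.relL (d.sel m) = -1 then 1 else 0

def itemAt (d : FoldData) (m j : ℕ) : ℕ := if j = d.t then d.n * d.t else d.sel m * d.t + j

theorem allowed_itemAt {j : ℕ} (hj : j < d.itemCount m) : d.Allowed m (d.itemAt m j) := by
  unfold itemCount at hj
  unfold itemAt
  by_cases h : j = d.t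
  · rw [if_pos h]
    refine .inr ⟨?_, rfl⟩
    by_contra hr
    rw [if_neg hr] at hj
    omega
  · rw [if_neg h]
    exact .inl ⟨j, by split_ifs at hj <;> omega, rfl⟩

theorem Allowed.exists_itemAt {a : ℕ} (ha : d.Allowed m a) :
    ∃ j < d.itemCount m, a = d.itemAt m j := by
  unfold itemCount itemAt
  rcases ha with ⟨j, hj, rfl⟩ | ⟨h, rfl⟩
  · exact ⟨j, by omega, by rw [if_neg (by omega)]⟩
  · exact ⟨d.t, by rw [if_pos h]; omega, by rw [if_pos rfl]⟩

theorem itemAt_le (hs : d.sel m < d.n) {j : ℕ} (hj : j < d.itemCount m) :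
    d.itemAt m j ≤ d.n * d.t := by
  unfold itemCount at hj
  unfold itemAt
  split_ifs with h
  · exact le_rfl
  · exact (index_lt hs (by split_ifs at hj <;> omega)).le

/-- What the memory provides for step `m`. -/
structure Ready (d : FoldData) (mem : ℕ → ℤ) (m : ℕ) : Prop where
  input : d.Input mem
  inc : ∀ k < d.r, mem (d.aInc + k) = d.inc m k
  zero : ∀ k < d.r, mem (d.aZero + k) = 0

theorem Ready.progress {Done : ℕ → ℕ → Prop} {mem : ℕ → ℤ} (h : d.Ready mem₀ m)
    (hp : d.Progress mem₀ mem m Done) : d.Ready mem m := by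
  have e1 : d.aDef = d.aEnd + 1 := rfl
  have e3 : d.aDef + d.n = d.aAcc := rfl
  have e4 : d.aAcc + d.r = d.aInc := rfl
  have e5 : d.aInc + d.r = d.aTmp := rfl
  have e6 : d.aTmp + d.r = d.aZero := rfl
  have e7 : d.aZero + d.r + d.r = d.base := rfl
  have hb := base_le (d := d) (m + 1) 0
  refine ⟨h.input.congr fun x hx => hp.frame x (by omega) (by omega), fun k hk => ?_,
    fun k hk => ?_⟩
  · rw [hp.frame _ (by omega) (by omega), h.inc k hk]
  · rw [hp.frame _ (by omega) (by omega), h.zero k hk]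

theorem runs_pickItem {s : State} (hE : d.Env s) {j : ℕ} (hs : d.sel m < d.n)
    (hj : j < d.itemCount m) (h32 : s.reg 32 = (d.sel m * d.t : ℕ)) (h46 : s.reg 46 = j) :
    Runs pickItem s fun K s' => K ≤ 3 * d.r + 11 ∧ s'.reg 47 = d.itemAt m j ∧
      s'.reg 48 = d.col (d.itemAt m j) := by
  refine Runs.seq (Runs.instr (Runs.seq (Runs.mul (y := d.r) ?_ ?_ (by norm_num) fun K hK => ?_)))
  · simp [hE.r1]
  · simp [hE.r4]
  refine Runs.seq (Runs.block (Runs.ite (fun hc => Runs.block ?_) fun hc => Runs.skip ?_))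
  · have hc' : j = d.t := by simpa [h46, hE.r5] using hc
    simp [hE.r6, hE.r24, itemAt, hc', col]
    omega
  · have hc' : j ≠ d.t := by simpa [h46, hE.r5] using hc
    have hlt : d.sel m * d.t + j < d.n * d.t := by
      unfold itemCount at hj
      exact index_lt hs (by split_ifs at hj <;> omega)
    simp [itemAt, hc', col, hlt, h32, h46]
    refine ⟨by omega, by ring⟩

theorem runs_items {s : State} (hE : d.Env s) (hR : d.Ready mem₀ m) {i : ℕ} (hi : i < d.N)
    (hmark : s.mem (d.cell m i) = 1) {Done : ℕ → ℕ → Prop} (hP : d.Progress mem₀ s.mem m Done)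
    (hs : d.sel m < d.n) (h29 : s.reg 29 = d.cell (m + 1) 0)
    (h32 : s.reg 32 = (d.sel m * d.t : ℕ)) (h33 : s.reg 33 = d.cl m)
    (h34 : s.reg 34 = d.itemCount m) (h45 : s.reg 45 = d.cell m i) :
    Runs items s fun K s' => K ≤ d.itemCount m * (d.r * (3 * d.W + 49) + 63) + 2 ∧
      d.Progress mem₀ s'.mem m fun i' a' => Done i' a' ∨ (i' = i ∧ d.Allowed m a') := by
  have e7 : d.aZero + d.r + d.r = d.base := rfl
  have hS : d.S = d.r + 4 := rfl
  have hb := base_le (d := d) m i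
  have hc1 := cell_add_le_succ (m := m) hi
  refine (Runs.for (n := d.itemCount m) (K := d.r * (3 * d.W + 49) + 61)
    (fun j s' => d.Progress mem₀ s'.mem m
      fun i' a' => Done i' a' ∨ (i' = i ∧ ∃ j' < j, a' = d.itemAt m j')) hE.r1 h34 (by decide)
      ?_ ?_).mono ?_
  · refine hP.mono fun i' a' h _ _ => ?_
    simpa using h
  · rintro j hj s₁ hf₁ - h46 hP₁
    have hE₁ : d.Env s₁ := hE.congr fun x hx =>
      hf₁ x ((by decide : ∀ x < 28, (pickItem ⨾ relax).writes x = false) x hx) (by omega)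
    have hmark₁ : s₁.mem (d.cell m i) = 1 := by
      rw [hP₁.frame _ (by omega) (by omega), ← hP.frame _ (by omega) (by omega), hmark]
    refine Runs.then (runs_pickItem hE₁ hs hj (by rw [hf₁ 32 rfl (by norm_num), h32]) h46) ?_
    rintro K₂ s₂ ⟨hK₂, h47, h48⟩ hf₂ hm₂
    have hm₂ := hm₂ rfl
    have hE₂ : d.Env s₂ := hE₁.frame hf₂ (by decide)
    have hR₁ := hR.progress hP₁
    rw [← hm₂] at hR₁ hP₁ hmark₁
    refine (runs_relax hE₂ hR₁.input hR₁.inc hR₁.zero (itemAt_le hs hj)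
      (by rw [hf₂ 29 rfl, hf₁ 29 rfl (by norm_num), h29])
      (by rw [hf₂ 33 rfl, hf₁ 33 rfl (by norm_num), h33])
      (by rw [hf₂ 45 rfl, hf₁ 45 rfl (by norm_num), h45]) h47 h48).mono ?_
    rintro K₃ s₃ ⟨hK₃, hrel⟩
    refine ⟨by rw [mul_add] at hK₃ ⊢; omega, ?_⟩
    refine (hP₁.relax hi hmark₁ (allowed_itemAt hj) hrel).mono fun i' a' h _ _ => ?_
    rcases h with h | ⟨rfl, j', hj', rfl⟩
    · exact .inl (.inl h)
    · rcases Nat.lt_succ_iff_lt_or_eq.1 hj' with h | rfl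
      · exact .inl (.inr ⟨rfl, j', h, rfl⟩)
      · exact .inr ⟨rfl, rfl⟩
  · rintro K s' ⟨hK, hP', -⟩
    refine ⟨hK, hP'.mono fun i' a' h _ _ => ?_⟩
    rcases h with h | ⟨h, ha⟩
    · exact .inl h
    · exact .inr ⟨h, ha.exists_itemAt⟩

/-- Unused memory holds zeros, so the next layer starts out empty and needs no initialization. -/
theorem runs_cells {s : State} (hE : d.Env s) (hR : d.Ready s.mem m)
    (hfresh : ∀ x, d.cell (m + 1) 0 ≤ x → s.mem x = 0) (h01 : ∀ i < d.N,
      s.mem (d.cell m i) = 0 ∨ s.mem (d.cell m i) = 1)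
    (hs : d.sel m < d.n) (h28 : s.reg 28 = d.cell m 0) (h29 : s.reg 29 = d.cell (m + 1) 0)
    (h32 : s.reg 32 = (d.sel m * d.t : ℕ)) (h33 : s.reg 33 = d.cl m)
    (h34 : s.reg 34 = d.itemCount m) :
    Runs cells s fun K s' =>
      K ≤ d.N * (d.itemCount m * (d.r * (3 * d.W + 49) + 63) + 7) + 3 ∧
        d.Progress s.mem s'.mem m fun _ a => d.Allowed m a := by
  have e7 : d.aZero + d.r + d.r = d.base := rfl
  have hS : d.S = d.r + 4 := rfl
  have hP₀ : d.Progress s.mem s.mem m fun i a => i < 0 ∧ d.Allowed m a :=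
    ⟨fun _ _ _ => rfl, fun i' hi' => .inl (hfresh _ (cell_zero_le _ _)),
      fun i hi _ a ha => absurd ha.1 (by omega)⟩
  refine Runs.seq (Runs.instr ?_)
  have hE' : d.Env ((Instr.move 45 28).run s) := hE.congr fun x hx => by
    simp only [run_move, State.set_reg]; rw [if_neg (by omega)]
  refine (Runs.for (n := d.N) (K := d.itemCount m * (d.r * (3 * d.W + 49) + 63) + 5)
    (fun j s' => s'.reg 45 = d.cell m j ∧
      d.Progress s.mem s'.mem m fun i a => i < j ∧ d.Allowed m a) hE'.r1 hE'.r18 (by decide)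
      ?_ ?_).mono ?_
  · refine ⟨by simp [h28], hP₀⟩
  · rintro j hj s₁ hf₁ - h44 ⟨h45, hP₁⟩
    have hE₁ : d.Env s₁ := hE'.congr fun x hx => hf₁ x ((by decide : ∀ x < 28,
      (.instr (.load 53 45) ⨾ .ite (.eq 53 1) items .skip ⨾
        .instr (.add 45 45 17) : Program).writes x = false) x hx) (by omega)
    have hb := base_le (d := d) m j
    have hc1 := cell_add_le_succ (m := m) hj
    have e : s₁.mem (d.cell m j) = s.mem (d.cell m j) := hP₁.frame _ (by omega) (by omega)
    refine Runs.then (Q' := fun K s₂ => K = 1 ∧ s₂.reg 53 = s₁.mem (d.cell m j))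
      (Runs.instr (by simp [h45])) ?_
    rintro K₂ s₂ ⟨rfl, h53⟩ hf₂ hm₂
    have hm₂ := hm₂ rfl
    have hE₂ : d.Env s₂ := hE₁.frame hf₂ (by decide)
    refine Runs.then (Q' := fun K s₃ => K ≤ d.itemCount m * (d.r * (3 * d.W + 49) + 63) + 3 ∧
      d.Progress s.mem s₃.mem m fun i a => i < j + 1 ∧ d.Allowed m a)
      (Runs.ite (fun hc => ?_) fun hc => Runs.skip ?_) ?_
    · have hmark : s₂.mem (d.cell m j) = 1 := by
        have : s₂.reg 53 = s₂.reg 1 := hc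
        rw [hm₂, ← h53, this, hE₂.r1]
      have g : ∀ x, items.writes x = false → (Program.instr (.add 45 45 17)).writes x = false →
          x ≠ 44 → x ≠ 53 → s₂.reg x = s.reg x := by
        intro x h1 h2 h3 h4
        have h45 : x ≠ 45 := by simpa [Program.writes, Instr.writes] using h2
        rw [hf₂ x (by simpa [Program.writes, Instr.writes] using h4), hf₁ x (by
          simp [Program.writes, Instr.writes, h1, h45, h4]) h3]
        simp [h45]
      refine (runs_items hE₂ hR hj hmark (Done := fun i a => i < j ∧ d.Allowed m a)
        (by rw [hm₂]; exact hP₁) hs (by rw [g 29 rfl rfl (by norm_num) (by norm_num), h29])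
        (by rw [g 32 rfl rfl (by norm_num) (by norm_num), h32])
        (by rw [g 33 rfl rfl (by norm_num) (by norm_num), h33])
        (by rw [g 34 rfl rfl (by norm_num) (by norm_num), h34])
        (by rw [hf₂ 45 rfl, h45])).mono ?_
      rintro K₃ s₃ ⟨hK₃, hP₃⟩
      refine ⟨by omega, hP₃.mono fun i a h _ _ => ?_⟩
      rcases Nat.lt_succ_iff_lt_or_eq.1 h.1 with h' | h'
      · exact .inl ⟨h', h.2⟩
      · exact .inr ⟨h', h.2⟩
    · have hmark : s₂.mem (d.cell m j) = 0 := by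
        have hne : ¬ s₂.reg 53 = s₂.reg 1 := hc
        rw [h53, hE₂.r1, e] at hne
        rw [hm₂, e]
        exact (h01 j hj).resolve_right hne
      rw [← hm₂] at hP₁
      refine ⟨by omega, hP₁.mono fun i a h _ hm => ?_⟩
      rcases Nat.lt_succ_iff_lt_or_eq.1 h.1 with h' | rfl
      · exact ⟨h', h.2⟩
      · rw [hmark] at hm; exact absurd hm (by norm_num)
    rintro K₃ s₃ ⟨hK₃, hP₃⟩ hf₃ -
    refine Runs.instr ⟨by omega, ?_, hP₃⟩
    have h45' : s₃.reg 45 = d.cell m j := by rw [hf₃ 45 rfl, hf₂ 45 rfl, h45]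
    have h17 : s₃.reg 17 = d.S := by rw [hf₃ 17 rfl, hE₂.r17]
    simp [h45', h17, cell_eq m (j + 1), cell_eq m j]
    ring
  · rintro K s' ⟨hK, ⟨-, hP⟩, -⟩
    refine ⟨by rw [show d.itemCount m * (d.r * (3 * d.W + 49) + 63) + 5 + 2 =
      d.itemCount m * (d.r * (3 * d.W + 49) + 63) + 7 from rfl] at hK; omega,
      hP.mono fun i a h hi _ => ⟨hi, h⟩⟩

end FoldData

/-! ### The program: filling the table -/

namespace FoldData

open RAM

variable {d : FoldData} {m : ℕ}

/-- Later bricks with a positive balance overwrite earlier ones in register `31`, in accordance with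
`lastPos`. -/
def addShare : Program :=
  block [.add 36 20 35, .load 37 36, .add 38 10 35, .load 38 38, .add 37 37 38, .store 36 37] ⨾
  cond (.lt 2 37) (.move 31 35)

/-- `R_31` becomes the brick to be served. -/
def selectBrick : Program :=
  .instr (.const 31 0) ⨾ .for 35 3 addShare ⨾
  block [.add 36 20 31, .load 37 36, .sub 37 37 12, .store 36 37]

theorem runs_selectBrick {s : State} (hE : d.Env s) (hin : d.Input s.mem)
    (hdef : ∀ i < d.n, s.mem (d.aDef + i) = d.deficit m i) (hs : d.sel m < d.n) :
    Runs selectBrick s fun K s' => K ≤ d.n * 11 + 8 ∧ s'.reg 31 = d.sel m ∧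
      (∀ i < d.n, s'.mem (d.aDef + i) = d.deficit (m + 1) i) ∧
      ∀ x, (x < d.aDef ∨ d.aAcc ≤ x) → s'.mem x = s.mem x := by
  have e1 : d.aDef = d.aEnd + 1 := rfl
  have e2 : d.aBL + d.n = d.aC := rfl
  have e3 : d.aDef + d.n = d.aAcc := rfl
  have e4 : d.aEnd = d.aC + d.n * d.t := rfl
  refine Runs.seq (Runs.instr ?_)
  have hE' : d.Env ((Instr.const 31 0).run s) := hE.congr fun x hx => by
    simp only [run_const, State.set_reg]; rw [if_neg (by omega)]
  refine Runs.then (Runs.for (n := d.n) (K := 9) (fun j s' =>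
    s'.reg 31 = lastPos j (fun i => d.deficit m i + d.bL i) ∧
    (∀ i < j, s'.mem (d.aDef + i) = d.deficit m i + d.bL i) ∧
    ∀ x, (x < d.aDef ∨ d.aDef + j ≤ x) → s'.mem x = s.mem x) hE'.r1 hE'.r3 (by decide) ?_ ?_) ?_
  · simp [lastPos]
  · rintro j hj s₁ hf₁ - h35 ⟨h31, hlt, hfr⟩
    have hE₁ : d.Env s₁ := hE'.congr fun x hx => hf₁ x ((by decide : ∀ x < 28,
      addShare.writes x = false) x hx) (by omega)
    have a1 : ((d.aDef : ℤ) + j).toNat = d.aDef + j := by omega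
    have a2 : ((d.aBL : ℤ) + j).toNat = d.aBL + j := by omega
    have g1 : s₁.mem (d.aDef + j) = d.deficit m j := by rw [hfr _ (by omega), hdef j hj]
    have g2 : s₁.mem (d.aBL + j) = d.bL j := by rw [hfr _ (by omega), hin.bL j hj]
    refine Runs.seq (Runs.block (Runs.cond ?_))
    simp [h35, hE₁.r20, hE₁.r10, hE₁.r2, a1, a2, g1, g2, h31, lastPos]
    refine ⟨fun i hi => ?_, fun x hx => ?_⟩
    · split_ifs with h
      · rw [h]
      · exact hlt i (by omega)
    · rw [if_neg (by omega), hfr x (by omega)]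
  · rintro K₁ s₁ ⟨hK₁, ⟨h31, hlt, hfr⟩, -⟩ hf₁ -
    have hE₁ : d.Env s₁ := hE'.frame hf₁ (by decide)
    have h31' : s₁.reg 31 = d.sel m := h31
    have a1 : ((d.aDef : ℤ) + d.sel m).toNat = d.aDef + d.sel m := by omega
    have g1 := hlt _ hs
    refine Runs.block ?_
    simp [hE₁.r20, hE₁.r12, h31', a1, g1]
    refine ⟨by omega, fun i hi => ?_, fun x hx => ?_⟩
    · rw [deficit_succ]
      split_ifs with h
      · rw [h]
      · rw [hlt i hi, sub_zero]
    · rw [if_neg (by omega), hfr x (by omega)]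

def carryBody : Program := .ite (.le 12 40) (block [.sub 40 40 12, .add 42 42 1]) .skip

/-- Only the remainder of `m * tgt` modulo `q` is stored. Adding `tgt` and dividing by `q` yields
the move of the centre and the next remainder. The extra `D * q` makes the dividend nonnegative and
is compensated by starting the quotient at `-D`. -/
def shiftBody : Program :=
  block [.add 39 21 38, .load 40 39, .add 41 25 38, .load 41 41, .add 40 40 41, .sub 42 2 13] ⨾
  .for 43 26 carryBody ⨾
  block [.store 39 40, .add 39 22 38, .store 39 42]

/-- Compute how far the centre moves. -/
def shifts : Program := .for 38 4 shiftBody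

/-- Division by repeated subtraction. -/
theorem runs_carry {s : State} (hE : d.Env s) (hq : 0 < d.q) {A : ℤ} (hA : 0 ≤ A)
    (hA' : A < d.q * (2 * d.D + 1)) (h40 : s.reg 40 = A) (h42 : s.reg 42 = -d.D) :
    Runs (.for 43 26 carryBody) s fun K s' => K ≤ 2 * d.D * 6 + 2 ∧ s'.reg 40 = A % d.q ∧
      s'.reg 42 = A / d.q - d.D := by
  have hq' : (0 : ℤ) < d.q := by exact_mod_cast hq
  -- The number of rounds is fixed in advance: either the remainder is already below `q`, or every
  -- round so far has subtracted `q`. As `A < q * (2 * D + 1)`, after `2 * D` rounds the remainder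
  -- is below `q` in any case.
  refine (Runs.for (n := 2 * d.D) (K := 4) (fun j s' => ∃ x : ℤ, s'.reg 42 = x - d.D ∧
    s'.reg 40 = A - d.q * x ∧ 0 ≤ s'.reg 40 ∧ (s'.reg 40 < d.q ∨ x = j)) hE.r1 hE.r26
    (by decide) ?_ ?_).mono ?_
  · exact ⟨0, by simp [h42], by simp [h40], by simp [h40, hA], .inr rfl⟩
  · rintro j hj s₁ hf₁ - h43 ⟨x, h42, h40, h0, hx⟩
    have hE₁ : d.Env s₁ := hE.congr fun x hx => hf₁ x ((by decide : ∀ x < 28,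
      carryBody.writes x = false) x hx) (by omega)
    refine Runs.ite (fun hc => Runs.block ?_) fun hc => Runs.skip ?_
    · have hc' : (d.q : ℤ) ≤ s₁.reg 40 := by simpa [hE₁.r12] using hc
      have hxj := hx.resolve_left (by omega)
      refine ⟨le_rfl, x + 1, ?_, ?_, ?_, .inr ?_⟩
      · simp [h42, hE₁.r1]; ring
      · simp [h40, hE₁.r12]; ring
      · simp [hE₁.r12, hc']
      · rw [hxj]; push_cast; rfl
    · have hc' : ¬ (d.q : ℤ) ≤ s₁.reg 40 := by simpa [hE₁.r12] using hc
      exact ⟨by norm_num, x, by simp [h42], by simp [h40], by simpa using h0,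
        .inl (by simpa using hc')⟩
  · rintro K s' ⟨hK, ⟨x, h42, h40, h0, hx⟩, -⟩
    have hlt : s'.reg 40 < d.q := by
      rcases hx with hx | hx
      · exact hx
      · rw [h40, hx]; push_cast; linarith
    have := (Int.ediv_emod_unique hq' (a := A) (r := s'.reg 40) (q := x)).2
      ⟨by rw [h40]; ring, h0, hlt⟩
    exact ⟨hK, this.2.symm, by rw [h42, this.1]⟩

theorem runs_shifts {s : State} (hE : d.Env s) (h : d.Valid) (hq : 0 < d.q)
    (hacc : ∀ k < d.r, s.mem (d.aAcc + k) = (m * d.tgt k) % d.q)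
    (hbs : ∀ k < d.r, s.mem (d.aBS + k) = d.tgt k + d.D * d.q) :
    Runs shifts s fun K s' => K ≤ d.r * (12 * d.D + 15) + 2 ∧
      (∀ k < d.r, s'.mem (d.aAcc + k) = ((m + 1 : ℕ) * d.tgt k) % d.q) ∧
      (∀ k < d.r, s'.mem (d.aInc + k) = d.inc m k) ∧
      ∀ x, (x < d.aAcc ∨ d.aTmp ≤ x) → s'.mem x = s.mem x := by
  have e4 : d.aAcc + d.r = d.aInc := rfl
  have e5 : d.aInc + d.r = d.aTmp := rfl
  have e6 : d.aTmp + d.r + d.r = d.aBS := rfl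
  have hq' : (0 : ℤ) < d.q := by exact_mod_cast hq
  refine (Runs.for (n := d.r) (K := 12 * d.D + 13) (fun j s' =>
      (∀ k < j, s'.mem (d.aAcc + k) = ((m + 1 : ℕ) * d.tgt k) % d.q) ∧
      (∀ k < j, s'.mem (d.aInc + k) = d.inc m k) ∧
      ∀ x, (x < d.aAcc ∨ (d.aAcc + j ≤ x ∧ x < d.aInc) ∨ d.aInc + j ≤ x) → s'.mem x = s.mem x)
      hE.r1 hE.r4 (by decide) ?_ ?_).mono ?_
  · simp
  · rintro j hj s₁ hf₁ - h38 ⟨hac, hin, hfr⟩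
    have hE₁ : d.Env s₁ := hE.congr fun x hx => hf₁ x ((by decide : ∀ x < 28,
      shiftBody.writes x = false) x hx) (by omega)
    have a1 : ((d.aAcc : ℤ) + j).toNat = d.aAcc + j := by omega
    have a2 : ((d.aBS : ℤ) + j).toNat = d.aBS + j := by omega
    have a3 : ((d.aInc : ℤ) + j).toNat = d.aInc + j := by omega
    have g1 : s₁.mem (d.aAcc + j) = (m * d.tgt j) % d.q := by rw [hfr _ (by omega), hacc j hj]
    have g2 : s₁.mem (d.aBS + j) = d.tgt j + d.D * d.q := by rw [hfr _ (by omega), hbs j hj]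
    set A : ℤ := (m * d.tgt j) % d.q + (d.tgt j + d.D * d.q) with hA
    have ht := abs_le.1 (h.abs_tgt hj)
    have hm0 := Int.emod_nonneg (m * d.tgt j) hq'.ne'
    have hm1 := Int.emod_lt_of_pos (m * d.tgt j) hq'
    have hA1 : (m + 1 : ℕ) * d.tgt j = A + d.q * (d.cen m j - d.D) := by
      have := Int.mul_ediv_add_emod (m * d.tgt j) d.q
      rw [hA, cen]
      push_cast
      linarith
    refine Runs.then (Q' := fun K s₂ => K = 7 ∧ s₂.reg 39 = (d.aAcc + j : ℕ) ∧ s₂.reg 40 = A ∧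
      s₂.reg 42 = -d.D) (Runs.block ?_) ?_
    · simp [h38, hE₁.r21, hE₁.r25, hE₁.r2, hE₁.r13, a1, a2, g1, g2, hA]
    rintro K₂ s₂ ⟨rfl, h39, h40, h42⟩ hf₂ hm₂
    have hm₂ := hm₂ rfl
    have hE₂ : d.Env s₂ := hE₁.frame hf₂ (by decide)
    refine Runs.then (runs_carry hE₂ hq (A := A) (by linarith [ht.1]) (by linarith [ht.2])
      h40 h42) ?_
    rintro K₃ s₃ ⟨hK₃, h40', h42'⟩ hf₃ hm₃
    have hm₃ := hm₃ rfl
    have hE₃ : d.Env s₃ := hE₂.frame hf₃ (by decide)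
    have h39' : s₃.reg 39 = (d.aAcc + j : ℕ) := by rw [hf₃ 39 rfl, h39]
    have h38' : s₃.reg 38 = j := by rw [hf₃ 38 rfl, hf₂ 38 rfl, h38]
    have hmod : A % d.q = ((m + 1 : ℕ) * d.tgt j) % d.q := by
      rw [hA1, Int.add_mul_emod_self_left]
    have hdiv : A / d.q - d.D = d.inc m j := by
      rw [inc, cen, hA1, Int.add_mul_ediv_left _ _ hq'.ne']; ring
    refine Runs.block ⟨?_, ?_, ?_, ?_⟩
    · simp only [List.length_cons, List.length_nil]; omega
    · intro k hk
      simp only [List.foldl_cons, List.foldl_nil, run_store, run_add, State.set_mem,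
        State.put_mem, State.set_reg, State.put_reg]
      simp only [Nat.reduceEqDiff, if_true, if_false, h39', h38', hE₃.r22, a3, h40', hmod,
        Int.toNat_natCast]
      rw [if_neg (by omega)]
      split_ifs with hkj
      · rw [show k = j by omega]
      · rw [hm₃, hm₂, hac k (by omega)]
    · intro k hk
      simp only [List.foldl_cons, List.foldl_nil, run_store, run_add, State.set_mem,
        State.put_mem, State.set_reg, State.put_reg]
      simp only [Nat.reduceEqDiff, if_true, if_false, h39', h38', hE₃.r22, a3, h42', hdiv,
        Int.toNat_natCast]
      split_ifs with hkj hkj'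
      · rw [show k = j by omega]
      · omega
      · rw [hm₃, hm₂, hin k (by omega)]
    · intro x hx
      simp only [List.foldl_cons, List.foldl_nil, run_store, run_add, State.set_mem,
        State.put_mem, State.set_reg, State.put_reg]
      simp only [Nat.reduceEqDiff, if_true, if_false, h39', h38', hE₃.r22, a3, Int.toNat_natCast]
      rw [if_neg (by omega), if_neg (by omega), hm₃, hm₂, hfr x (by omega)]
  · rintro K s' ⟨hK, ⟨hac, hin, hfr⟩, -⟩
    exact ⟨hK, hac, hin, fun x hx => hfr x (by omega)⟩

/-- The step prepares the item loop and fills one layer. -/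
def layer : Program :=
  selectBrick ⨾ mul 32 31 5 72 ⨾ block [.const 33 0, .add 53 30 1] ⨾
  cond (.eq 53 12) (.move 33 15) ⨾ block [.add 53 8 31, .load 53 53, .sub 34 5 53] ⨾
  shifts ⨾ cells ⨾ block [.move 28 29, .add 29 29 19]

/-- The memory between two layers. -/
structure Work (d : FoldData) (mem : ℕ → ℤ) (m : ℕ) : Prop where
  input : d.Input mem
  deficit : ∀ i < d.n, mem (d.aDef + i) = d.deficit m i
  acc : ∀ k < d.r, mem (d.aAcc + k) = (m * d.tgt k) % d.q
  zero : ∀ k < d.r, mem (d.aZero + k) = 0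
  bs : ∀ k < d.r, mem (d.aBS + k) = d.tgt k + d.D * d.q
  table : d.Table mem m
  fresh : ∀ x, d.cell (m + 1) 0 ≤ x → mem x = 0

theorem Table.mark {mem : ℕ → ℤ} (h : d.Table mem m) {i : ℕ} (hi : i < d.N) :
    mem (d.cell m i) = 0 ∨ mem (d.cell m i) = 1 := by
  cases m with
  | zero =>
    rw [h.start.mark i hi]
    split_ifs <;> simp
  | succ m =>
    rcases h.linked m (Nat.lt_succ_self m) i hi with h0 | h0
    · exact .inl h0
    · exact .inr h0.1

theorem Table.succ {mem mem' : ℕ → ℤ} (h : d.Table mem m)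
    (hP : d.Progress mem mem' m fun _ a => d.Allowed m a) : d.Table mem' (m + 1) := by
  have e7 : d.aZero + d.r + d.r = d.base := rfl
  have h' : d.Table mem' m := h.congr fun x h1 h2 => hP.frame x (by omega) (.inl h2)
  refine ⟨h'.start, fun l hl => ?_, fun l hl => ?_⟩
  · rcases Nat.lt_succ_iff_lt_or_eq.1 hl with hl | rfl
    · exact h'.linked l hl
    · exact hP.linked
  · rcases Nat.lt_succ_iff_lt_or_eq.1 hl with hl | rfl
    · exact h'.complete l hl
    · exact hP.complete

/-- The first term, for all items in all cells, dominates; the others account for the schedule, the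
centre and the bookkeeping. -/
def layerBound (d : FoldData) : ℕ :=
  d.N * ((d.t + 1) * (d.r * (3 * d.W + 49) + 63) + 7) + d.r * (12 * d.D + 15) + 11 * d.n +
    3 * d.t + 30

theorem runs_layer {s : State} (hE : d.Env s) (h : d.Valid) (hq : 0 < d.q)
    (hw : d.Work s.mem m) (h28 : s.reg 28 = d.cell m 0) (h29 : s.reg 29 = d.cell (m + 1) 0)
    (h30 : s.reg 30 = m) :
    Runs layer s fun K s' => K ≤ d.layerBound ∧ d.Work s'.mem (m + 1) ∧
      s'.reg 28 = d.cell (m + 1) 0 ∧ s'.reg 29 = d.cell (m + 2) 0 := by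
  have e1 : d.aDef = d.aEnd + 1 := rfl
  have e0 : d.aRL + d.n + d.r + d.n + d.n * d.t = d.aEnd := rfl
  have e3 : d.aDef + d.n = d.aAcc := rfl
  have e4 : d.aAcc + d.r = d.aInc := rfl
  have e5 : d.aInc + d.r = d.aTmp := rfl
  have e6 : d.aTmp + d.r = d.aZero := rfl
  have e6' : d.aZero + d.r = d.aBS := rfl
  have e7 : d.aBS + d.r = d.base := rfl
  have hb := base_le (d := d) (m + 1) 0
  have hb0 := base_le (d := d) m 0
  have hb2 : d.cell (m + 1) 0 ≤ d.cell (m + 2) 0 := cell_layer_mono (by omega)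
  have hs := h.sel_lt hq m
  refine Runs.then (runs_selectBrick hE hw.input hw.deficit hs) ?_
  rintro K₁ s₁ ⟨hK₁, h31, hdef, hfr₁⟩ hf₁ -
  have hE₁ : d.Env s₁ := hE.frame hf₁ (by decide)
  refine Runs.seq (Runs.mul hE₁.r1 hE₁.r5 (by norm_num) fun K₂ hK₂ => ?_)
  refine Runs.seq (Runs.block (Runs.seq (Runs.cond ?_)))
  refine Runs.then (Q' := fun K s₃ => K = 4 ∧ s₃.reg 32 = (d.sel m * d.t : ℕ) ∧
    s₃.reg 33 = d.cl m ∧ s₃.reg 34 = d.itemCount m ∧ s₃.reg 28 = d.cell m 0 ∧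
    s₃.reg 29 = d.cell (m + 1) 0 ∧ s₃.mem = s₁.mem ∧ d.Env s₃) (Runs.block ?_) ?_
  · have a1 : ((d.aRL : ℤ) + d.sel m).toNat = d.aRL + d.sel m := by omega
    have g1 : s₁.mem (d.aRL + d.sel m) = d.relL (d.sel m) := by
      rw [hfr₁ _ (by omega), hw.input.relL _ hs]
    have g30 : s₁.reg 30 = m := by rw [hf₁ 30 rfl, h30]
    refine ⟨rfl, ?_, ?_, ?_, ?_, ?_, ?_, ?_⟩
    · simp [h31]
    · simp [g30, hE₁.r1, hE₁.r12, hE₁.r15, cl]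
      simp only [← Nat.cast_succ, Nat.cast_inj]
    -- The code of a local relation is `0` or `-1`, so `t` minus the code counts the zero column
    -- exactly when it is allowed.
    · simp [h31, hE₁.r8, hE₁.r5, a1, g1, itemCount]
      rcases h.relL _ hs with h0 | h0 <;> rw [h0] <;> norm_num
    · simp [hf₁ 28 rfl, h28]
    · simp [hf₁ 29 rfl, h29]
    · simp
    · refine hE₁.congr fun x hx => ?_
      simp only [List.foldl_cons, List.foldl_nil, run_add, run_load, run_sub, run_const, run_move,
        State.set_reg, State.select_reg]
      have q1 : x ≠ 34 := by omega
      have q2 : x ≠ 53 := by omega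
      have q3 : x ≠ 33 := by omega
      have q4 : x ≠ 72 := by omega
      have q5 : x ≠ 32 := by omega
      simp only [if_neg q1, if_neg q2, if_neg q3, if_neg q4, if_neg q5, ite_self]
  rintro K₃ s₃ ⟨rfl, h32, h33, h34, h28, h29, hm₃, hE₃⟩ - -
  refine Runs.then (runs_shifts hE₃ h hq (m := m) ?_ ?_) ?_
  · intro k hk; rw [hm₃, hfr₁ _ (by omega), hw.acc k hk]
  · intro k hk; rw [hm₃, hfr₁ _ (by omega), hw.bs k hk]
  rintro K₄ s₄ ⟨hK₄, hacc, hinc, hfr₄⟩ hf₄ -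
  rw [hm₃] at hfr₄
  have hE₄ : d.Env s₄ := hE₃.frame hf₄ (by decide)
  have hhi : ∀ x, d.aTmp ≤ x → s₄.mem x = s.mem x := fun x hx => by
    rw [hfr₄ x (by omega), hfr₁ x (by omega)]
  have hlo : ∀ x, x < d.aDef → s₄.mem x = s.mem x := fun x hx => by
    rw [hfr₄ x (by omega), hfr₁ x (by omega)]
  have hT₄ : d.Table s₄.mem m := hw.table.congr fun x h1 h2 => hhi x (by omega)
  have hR₄ : d.Ready s₄.mem m := ⟨hw.input.congr fun x hx => hlo x (by omega), hinc,
    fun k hk => by rw [hhi _ (by omega), hw.zero k hk]⟩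
  refine Runs.then (runs_cells hE₄ hR₄ (fun x hx => by rw [hhi x (by omega), hw.fresh x hx])
    (fun i hi => hT₄.mark hi) hs (by rw [hf₄ 28 rfl, h28]) (by rw [hf₄ 29 rfl, h29])
    (by rw [hf₄ 32 rfl, h32]) (by rw [hf₄ 33 rfl, h33]) (by rw [hf₄ 34 rfl, h34])) ?_
  rintro K₅ s₅ ⟨hK₅, hP⟩ hf₅ -
  refine Runs.block ⟨?_, ?_, ?_, ?_⟩
  · have hi : d.itemCount m ≤ d.t + 1 := by unfold itemCount; split_ifs <;> omega
    have : d.N * (d.itemCount m * (d.r * (3 * d.W + 49) + 63) + 7) ≤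
        d.N * ((d.t + 1) * (d.r * (3 * d.W + 49) + 63) + 7) := by gcongr
    simp only [List.length_cons, List.length_nil]
    unfold layerBound
    omega
  · simp only [List.foldl_cons, List.foldl_nil, run_move, run_add, State.set_mem]
    refine ⟨(hR₄.progress hP).input, fun i hi => ?_, fun k hk => ?_, (hR₄.progress hP).zero,
      fun k hk => ?_, hT₄.succ hP, fun x hx => ?_⟩
    · rw [hP.frame _ (by omega) (by omega), hfr₄ _ (by omega), hdef i hi]
    · rw [hP.frame _ (by omega) (by omega), hacc k hk]
    · rw [hP.frame _ (by omega) (by omega), hhi _ (by omega), hw.bs k hk]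
    · have hx : d.cell (m + 2) 0 ≤ x := hx
      rw [hP.frame x (by omega) (.inr hx), hhi x (by omega), hw.fresh x (by omega)]
  · simp [hf₅ 29 rfl, hf₄ 29 rfl, h29]
  · have h19 : s₅.reg 19 = (d.N * d.S : ℕ) := by rw [hf₅ 19 rfl, hE₄.r19]
    simp [hf₅ 29 rfl, hf₄ 29 rfl, h29, h19, cell_succ (m + 1) 0, cell_eq (m + 1) d.N]

def fill : Program := .for 30 12 layer

theorem runs_fill {s : State} (hE : d.Env s) (h : d.Valid) (hw : d.Work s.mem 0)
    (h28 : s.reg 28 = d.cell 0 0) (h29 : s.reg 29 = d.cell 1 0) :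
    Runs fill s fun K s' => K ≤ d.q * (d.layerBound + 2) + 2 ∧ d.Work s'.mem d.q ∧
      s'.reg 28 = d.cell d.q 0 := by
  refine (Runs.for (n := d.q) (K := d.layerBound) (fun j s' => d.Work s'.mem j ∧
    s'.reg 28 = d.cell j 0 ∧ s'.reg 29 = d.cell (j + 1) 0) hE.r1 hE.r12 (by decide) ?_ ?_).mono ?_
  · exact ⟨hw, by simp [h28], by simp [h29]⟩
  · rintro j hj s₁ hf₁ - h30 ⟨hw, h28, h29⟩
    have hE₁ : d.Env s₁ := hE.congr fun x hx => hf₁ x ((by decide : ∀ x < 28,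
      layer.writes x = false) x hx) (by omega)
    refine (runs_layer hE₁ h (by omega) hw h28 h29 h30).mono ?_
    rintro K s' ⟨hK, hw', h28', h29'⟩
    exact ⟨hK, hw', by simp [h28'], by simp [h29']⟩
  · rintro K s' ⟨hK, ⟨hw, h28, -⟩, -⟩
    exact ⟨hK, hw, h28⟩

end FoldData

/-! ### The program: reading off the answer -/

namespace FoldData

open RAM

variable {d : FoldData}

def traceStep : Program :=
  block [.const 54 3, .add 54 54 53, .load 54 54, .load 55 54, .add 55 55 1, .store 54 55,
    .const 54 2, .add 54 53 54, .load 53 54]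

/-- Count the items on the path that leads to the cell at address `R_53`. -/
def trace : Program :=
  .for 35 6 (.instr (.store 35 2)) ⨾ .for 30 12 traceStep ⨾ .instr (.const 0 1)

def finish : Program :=
  block [.add 53 28 27, .load 54 53] ⨾ .ite (.eq 54 2) (.instr (.const 0 0)) trace

/-- The output overwrites the beginning of memory, which is no longer needed, while the chain of
cells lies at `base` and above. Zero columns on the path are counted at address `n * t`, just
outside the output. -/
theorem runs_trace {s : State} (hE : d.Env s) {a P : ℕ → ℕ} (ha : ∀ l < d.q, a l ≤ d.n * d.t)
    (hP : ∀ u < d.q, s.mem (P (u + 1) + 3) = a u ∧ s.mem (P (u + 1) + 2) = P u ∧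
      d.base ≤ P (u + 1)) (h53 : s.reg 53 = P d.q) :
    Runs trace s fun K s' => K ≤ 3 * (d.n * d.t) + 12 * d.q + 5 ∧ s'.reg 0 = 1 ∧
      ∀ p < d.n * d.t, s'.mem p = d.count a p := by
  have hb : d.n * d.t < d.base := by
    unfold base aBS aZero aTmp aInc aAcc aDef aEnd; omega
  refine Runs.then (Runs.for (n := d.n * d.t) (K := 1) (fun j s' => (∀ p < j, s'.mem p = 0) ∧
    ∀ x, j ≤ x → s'.mem x = s.mem x) hE.r1 hE.r6 (by decide) ?_ ?_) ?_
  · simp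
  · rintro j hj s₁ hf₁ - h35 ⟨h0, hfr⟩
    have h2 : s₁.reg 2 = 0 := by rw [hf₁ 2 rfl (by norm_num), hE.r2]
    refine Runs.instr ?_
    simp [h35, h2]
    refine ⟨fun p hp hne => h0 p (by omega), fun x hx => ?_⟩
    rw [if_neg (by omega), hfr x (by omega)]
  rintro K₁ s₁ ⟨hK₁, ⟨h0, hfr⟩, -⟩ hf₁ -
  have hE₁ : d.Env s₁ := hE.frame hf₁ (by decide)
  -- Predecessor links lead backwards, so round `j` meets item number `q - 1 - j`.
  refine Runs.then (Runs.for (n := d.q) (K := 10) (fun j s' => s'.reg 53 = P (d.q - j) ∧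
    (∀ p < d.n * d.t, s'.mem p =
      ∑ l ∈ Finset.range j, if a (d.q - 1 - l) = p then (1 : ℤ) else 0) ∧
    ∀ x, d.n * d.t < x → s'.mem x = s.mem x) hE₁.r1 hE₁.r12 (by decide) ?_ ?_) ?_
  · refine ⟨by simp [hf₁ 53 rfl, h53], fun p hp => by simpa using h0 p hp, fun x hx => hfr x hx.le⟩
  · rintro j hj s₂ hf₂ - h30 ⟨h53, hcnt, hfr₂⟩
    obtain ⟨u, hu⟩ : ∃ u, d.q - j = u + 1 := ⟨d.q - j - 1, by omega⟩
    obtain ⟨p3, p2, pb⟩ := hP u (by omega)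
    rw [hu] at h53
    have h1 : s₂.reg 1 = 1 := by rw [hf₂ 1 rfl (by norm_num), hE₁.r1]
    have a1 : (3 + (P (u + 1) : ℤ)).toNat = P (u + 1) + 3 := by omega
    have a2 : ((P (u + 1) : ℤ) + 2).toNat = P (u + 1) + 2 := by omega
    have hau := ha u (by omega)
    have g3 : s₂.mem (P (u + 1) + 3) = a u := by rw [hfr₂ _ (by omega), p3]
    have g2 : s₂.mem (P (u + 1) + 2) = P u := by rw [hfr₂ _ (by omega), p2]
    have hne : P (u + 1) + 2 ≠ a u := by omega
    have hu' : d.q - (j + 1) = u := by omega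
    have hu'' : d.q - 1 - j = u := by omega
    refine Runs.block ?_
    simp [h53, h1, a1, a2, g3, g2, hne, hu', -Finset.sum_boole]
    refine ⟨fun p hp => ?_, fun x hx => ?_⟩
    · rw [Finset.sum_range_succ, hu'', ← hcnt p hp]
      by_cases h : p = a u
      · rw [if_pos h, if_pos h.symm, h]
      · rw [if_neg h, if_neg (Ne.symm h), add_zero]
    · rw [if_neg (by omega), hfr₂ x hx]
  · rintro K₂ s₂ ⟨hK₂, ⟨-, hcnt, -⟩, -⟩ - -
    refine Runs.instr ⟨by omega, by simp, fun p hp => ?_⟩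
    rw [run_const, State.set_mem, hcnt p hp, count, Finset.card_filter, Nat.cast_sum,
      Finset.sum_range_reflect fun l => if a l = p then (1 : ℤ) else 0]
    exact Finset.sum_congr rfl fun l _ => by split_ifs <;> rfl

theorem runs_finish {s : State} (hE : d.Env s) (h : d.Valid) (ht : d.Table s.mem d.q)
    (h28 : s.reg 28 = d.cell d.q 0) :
    Runs finish s fun K s' => K ≤ 3 * (d.n * d.t) + 12 * d.q + 9 ∧
      ((s'.reg 0 = 0 ∧ s.mem (d.cell d.q (d.idx d.mid)) = 0) ∨
        (s'.reg 0 = 1 ∧ s.mem (d.cell d.q (d.idx d.mid)) = 1 ∧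
          ∃ a, d.IsPath a d.q ∧ (∀ k < d.r, d.traj a d.q k = d.H) ∧
            d.pathCost a d.q = s.mem (d.cell d.q (d.idx d.mid) + 1) ∧
            ∀ p < d.n * d.t, s'.mem p = d.count a p)) := by
  have hlt := inRange_mid (d := d).idx_lt
  have a0 : ((d.cell d.q 0 : ℤ) + (d.idx d.mid : ℤ) * (d.S : ℤ)) = d.cell d.q (d.idx d.mid) := by
    rw [cell_eq d.q (d.idx d.mid)]; push_cast; ring
  refine Runs.then (Q' := fun K s₁ => K = 3 ∧ s₁.reg 53 = d.cell d.q (d.idx d.mid) ∧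
    s₁.reg 54 = s.mem (d.cell d.q (d.idx d.mid))) (Runs.block (by simp [h28, hE.r27, a0])) ?_
  rintro K₁ s₁ ⟨rfl, h53, h54⟩ hf₁ hm₁
  have hm₁ := hm₁ rfl
  have hE₁ : d.Env s₁ := hE.frame hf₁ (by decide)
  refine Runs.ite (fun hc => Runs.instr ?_) fun hc => ?_
  · refine ⟨by omega, .inl ⟨by simp, ?_⟩⟩
    have : s₁.reg 54 = s₁.reg 2 := hc
    rw [← h54, this, hE₁.r2]
  · have hne : ¬ s₁.reg 54 = s₁.reg 2 := hc
    rw [h54, hE₁.r2] at hne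
    have hmark := (ht.mark hlt).resolve_left hne
    obtain ⟨a, P, hpath, htraj, hidx, hcost, hPq, hch⟩ := ht.exists_path le_rfl hlt hmark
    have hr : d.InRange (dig s.mem (d.cell d.q (d.idx d.mid))) :=
      hpath.inRange.congr fun k hk => htraj k hk
    have hmid := idx_inj hr inRange_mid hidx
    refine (runs_trace hE₁ (a := a) (P := P) (fun l hl => ?_) (by rw [hm₁]; exact hch)
      (by rw [h53, hPq])).mono ?_
    · rcases (hpath l hl).1 with ⟨j, hj, he⟩ | ⟨-, he⟩
      · rw [he]
        exact (index_lt (h.sel_lt (by omega) l) hj).le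
      · exact he.le
    · rintro K s' ⟨hK, h0, hcnt⟩
      exact ⟨by omega, .inr ⟨h0, hmark, a, hpath, fun k hk => (htraj k hk).trans (hmid k hk),
        hcost, hcnt⟩⟩

end FoldData

/-! ### The program: preparations -/

namespace FoldData

open RAM

variable {d : FoldData}

/-- The sizes and the addresses of the arrays are in their registers. -/
structure Layout (d : FoldData) (s : State) : Prop where
  r1 : s.reg 1 = 1
  r2 : s.reg 2 = 0
  r3 : s.reg 3 = d.n
  r4 : s.reg 4 = d.r
  r5 : s.reg 5 = d.t
  r6 : s.reg 6 = (d.n * d.t : ℕ)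
  r7 : s.reg 7 = d.aRG
  r8 : s.reg 8 = d.aRL
  r9 : s.reg 9 = d.aBG
  r10 : s.reg 10 = d.aBL
  r11 : s.reg 11 = d.aC
  r20 : s.reg 20 = d.aDef
  r21 : s.reg 21 = d.aAcc
  r22 : s.reg 22 = d.aInc
  r23 : s.reg 23 = d.aTmp
  r24 : s.reg 24 = d.aZero
  r25 : s.reg 25 = d.aBS
  r28 : s.reg 28 = d.base

theorem Layout.congr {s s' : State} (h : d.Layout s)
    (he : ∀ x < 29, (x < 12 ∨ (20 ≤ x ∧ x < 26) ∨ x = 28) → s'.reg x = s.reg x) :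
    d.Layout s' := by
  constructor <;> rw [he _ (by norm_num) (by norm_num)]
  exacts [h.r1, h.r2, h.r3, h.r4, h.r5, h.r6, h.r7, h.r8, h.r9, h.r10, h.r11, h.r20, h.r21, h.r22,
    h.r23, h.r24, h.r25, h.r28]

theorem Layout.frame {p : Program} {s s' : State} (h : d.Layout s)
    (hf : ∀ x, p.writes x = false → s'.reg x = s.reg x)
    (hp : ∀ x < 29, (x < 12 ∨ (20 ≤ x ∧ x < 26) ∨ x = 28) → p.writes x = false) : d.Layout s' :=
  h.congr fun x hx hx' => hf x (hp x hx hx')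

def readParams : Program :=
  block [.const 1 1, .const 2 0, .load 3 2, .load 4 1, .const 30 2, .load 5 30] ⨾
  mul 6 3 5 31 ⨾ mul 32 6 4 31 ⨾
  block [.const 30 3, .add 7 32 30, .add 8 7 4, .add 9 8 3, .add 10 9 4, .add 11 10 3,
    .add 20 11 6, .add 20 20 1, .add 21 20 3, .add 22 21 4, .add 23 22 4, .add 24 23 4,
    .add 25 24 4, .add 28 25 4]

theorem runs_readParams {s : State} (h0 : s.mem 0 = d.n) (h1 : s.mem 1 = d.r) (h2 : s.mem 2 = d.t) :
    Runs readParams s fun K s' => K ≤ 3 * d.t + 3 * d.r + 28 ∧ d.Layout s' := by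
  refine Runs.seq (Runs.block (Runs.seq (Runs.mul (y := d.t) ?_ ?_ (by norm_num) fun K hK =>
    Runs.seq (Runs.mul (y := d.r) ?_ ?_ (by norm_num) fun K' hK' => Runs.block ⟨?_, ?_⟩))))
  · simp
  · simp [h2]
  · simp
  · simp [h1]
  · simp only [List.length_cons, List.length_nil]; omega
  · constructor <;> simp [h0, h1, h2, base, aBS, aZero, aTmp, aInc, aAcc, aDef, aEnd, aC, aBL, aBG,
      aRL, aRG] <;> ring

/-- `R_12` becomes the sum of the local right-hand sides, `R_40` tells whether one is negative. -/
def sumLocal : Program :=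
  block [.const 12 0, .const 40 0] ⨾
  .for 35 3 (block [.add 36 10 35, .load 37 36, .add 12 12 37] ⨾ cond (.lt 37 2) (.const 40 1))

theorem runs_sumLocal {s : State} (hL : d.Layout s) (hin : d.Input s.mem) :
    Runs sumLocal s fun K s' => K ≤ 8 * d.n + 5 ∧
      s'.reg 12 = ∑ i ∈ Finset.range d.n, d.bL i ∧ (s'.reg 40 = 1 ↔ ¬ ∀ i < d.n, 0 ≤ d.bL i) := by
  refine Runs.then (Q' := fun K s₁ => K = 3 ∧ s₁.reg 12 = 0 ∧ s₁.reg 40 = 0)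
    (Runs.block (by simp)) ?_
  rintro K₁ s₁ ⟨rfl, h12, h40⟩ hf₁ hm₁
  have hm₁ := hm₁ rfl
  have hL₁ : d.Layout s₁ := hL.frame hf₁ (by decide)
  refine (Runs.for (n := d.n) (K := 6) (fun j s' => s'.reg 12 = ∑ i ∈ Finset.range j, d.bL i ∧
    (s'.reg 40 = 1 ↔ ¬ ∀ i < j, 0 ≤ d.bL i)) hL₁.r1 hL₁.r3 (by decide) ?_ ?_).mono ?_
  · simp [h12, h40]
  · rintro j hj s₂ hf₂ hm₂ h35 ⟨i12, i40⟩
    have hm₂ := hm₂ rfl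
    have hL₂ : d.Layout s₂ := hL₁.congr fun x hx hx' => by
      refine hf₂ x ?_ (by omega)
      revert hx' hx
      revert x
      decide
    have a1 : ((d.aBL : ℤ) + j).toNat = d.aBL + j := by omega
    have g1 : s₂.mem (d.aBL + j) = d.bL j := by rw [hm₂, hm₁, hin.bL j hj]
    refine Runs.seq (Runs.block (Runs.cond ⟨le_rfl, ?_, ?_⟩))
    · simp [h35, hL₂.r10, a1, g1, i12, Finset.sum_range_succ]
    · have key : (¬ ∀ i < j + 1, 0 ≤ d.bL i) ↔ (d.bL j < 0 ∨ ¬ ∀ i < j, 0 ≤ d.bL i) := by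
        rw [← not_le, ← not_and_or, not_iff_not]
        constructor
        · exact fun h => ⟨h j (by omega), fun i hi => h i (by omega)⟩
        · rintro ⟨h1, h2⟩ i hi
          rcases Nat.lt_succ_iff_lt_or_eq.1 hi with hi | rfl
          · exact h2 i hi
          · exact h1
      rw [key, ← i40]
      simp [h35, hL₂.r10, hL₂.r2, a1, g1]
      by_cases h : d.bL j < 0
      · simp [h]
      · simp [h, not_lt.1 h]
  · rintro K s' ⟨hK, ⟨i12, i40⟩, -⟩
    exact ⟨by omega, i12, i40⟩

/-- `R_13` becomes the largest absolute value of an entry. -/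
def maxEntry : Program :=
  block [.const 13 1, .const 37 3, .sub 36 7 37] ⨾
  .for 35 36 (block [.add 38 37 35, .load 38 38] ⨾ cond (.lt 13 38) (.move 13 38) ⨾
    .instr (.sub 39 2 38) ⨾ cond (.lt 13 39) (.move 13 39))

/-- The parameters `D` and `q` are the ones computed by the program. -/
structure Exact (d : FoldData) : Prop where
  one_le : 1 ≤ d.D
  abs_T : ∀ a < d.n * d.t, ∀ k < d.r, |d.T a k| ≤ d.D
  attained : d.D = 1 ∨ ∃ a < d.n * d.t, ∃ k < d.r, |d.T a k| = d.D
  sum_bL : ∑ i ∈ Finset.range d.n, d.bL i = d.q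

theorem runs_maxEntry {s : State} (hL : d.Layout s) (hin : d.Input s.mem) (hX : d.Exact) :
    Runs maxEntry s fun K s' => K ≤ 10 * (d.n * d.t * d.r) + 6 ∧ s'.reg 13 = d.D := by
  refine Runs.then (Q' := fun K s₁ => K = 4 ∧ s₁.reg 13 = 1 ∧ s₁.reg 37 = 3 ∧
    s₁.reg 36 = (d.n * d.t * d.r : ℕ)) (Runs.block (by simp [hL.r7, aRG])) ?_
  rintro K₁ s₁ ⟨rfl, h13, h37, h36⟩ hf₁ hm₁
  have hm₁ := hm₁ rfl
  have hL₁ : d.Layout s₁ := hL.frame hf₁ (by decide)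
  refine (Runs.for (n := d.n * d.t * d.r) (K := 8) (fun j s' => 1 ≤ s'.reg 13 ∧
    (∀ x < j, |s.mem (3 + x)| ≤ s'.reg 13) ∧ (s'.reg 13 = 1 ∨ ∃ x < j, |s.mem (3 + x)| = s'.reg 13))
    hL₁.r1 h36 (by decide) ?_ ?_).mono ?_
  · simp [h13]
  · rintro j hj s₂ hf₂ hm₂ h35 ⟨i1, ile, iat⟩
    have hm₂ := hm₂ rfl
    have f37 : s₂.reg 37 = 3 := by rw [hf₂ 37 rfl (by norm_num), h37]
    have f2 : s₂.reg 2 = 0 := by rw [hf₂ 2 rfl (by norm_num), hL₁.r2]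
    have a1 : (3 + (j : ℤ)).toNat = 3 + j := by omega
    have g1 : s₂.mem (3 + j) = s.mem (3 + j) := by rw [hm₂, hm₁]
    refine Runs.seq (Runs.block (Runs.seq (Runs.cond (Runs.seq (Runs.instr (Runs.cond ?_))))))
    set M := s₂.reg 13 with hM
    set v := s.mem (3 + j) with hv
    have e : ∀ s' : State, s'.reg 13 = max M |v| → (1 ≤ s'.reg 13 ∧
        (∀ x < j + 1, |s.mem (3 + x)| ≤ s'.reg 13) ∧
        (s'.reg 13 = 1 ∨ ∃ x < j + 1, |s.mem (3 + x)| = s'.reg 13)) := by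
      intro s' h
      rw [h]
      refine ⟨le_max_of_le_left i1, fun x hx => ?_, ?_⟩
      · rcases Nat.lt_succ_iff_lt_or_eq.1 hx with hx | rfl
        · exact le_max_of_le_left (ile x hx)
        · exact le_max_right _ _
      · rcases le_total |v| M with hle | hle
        · rw [max_eq_left hle]
          exact iat.imp_right fun ⟨x, hx, h⟩ => ⟨x, by omega, h⟩
        · rw [max_eq_right hle]
          exact .inr ⟨j, by omega, rfl⟩
    refine ⟨by simp, e _ ?_⟩
    simp [f37, f2, h35, a1, g1, ← hM]
    rcases abs_cases v with ⟨h, _⟩ | ⟨h, _⟩ <;> rw [h] <;> split_ifs <;> omega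
  · rintro K s' ⟨hK, ⟨i1, ile, iat⟩, -⟩
    refine ⟨by omega, le_antisymm ?_ ?_⟩
    · rcases iat with h | ⟨x, hx, h⟩
      · rw [h]; exact_mod_cast hX.one_le
      · have hr : 0 < d.r := Nat.pos_of_ne_zero fun h0 => by simp [h0] at hx
        -- The entries are scanned as one array; position `x` belongs to column `x / r` and row `x %
        -- r`.
        have h1 : x / d.r < d.n * d.t := (Nat.div_lt_iff_lt_mul hr).2 hx
        have h2 := hX.abs_T _ h1 _ (Nat.mod_lt x hr)
        rw [← hin.T _ h1 _ (Nat.mod_lt x hr), add_assoc, mul_comm, Nat.div_add_mod, h] at h2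
        exact h2
    · rcases hX.attained with h | ⟨a, ha, k, hk, h⟩
      · rw [h]; exact_mod_cast i1
      · rw [← h, ← hin.T a ha k hk, add_assoc]
        exact ile _ (index_lt ha hk)

def widths : Program :=
  mul 14 13 12 31 ⨾ mul 15 3 13 31 ⨾ .instr (.add 30 4 1) ⨾ mul 32 15 30 31 ⨾
  block [.add 15 32 32, .add 16 15 15, .add 16 16 1, .const 30 4, .add 17 4 30, .add 26 13 13]

/-- The counter of each multiplication is the small factor `W`, not the growing power, so the powers
cost only `O(r * W)` steps. -/
def tableSize : Program :=
  .instr (.const 18 1) ⨾ .for 35 4 (mul 36 18 16 37 ⨾ .instr (.move 18 36)) ⨾ mul 19 18 17 31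

def startOffset : Program :=
  .instr (.const 27 0) ⨾ .for 35 4 (mul 36 27 16 37 ⨾ .instr (.add 27 36 15)) ⨾
  mul 36 27 17 37 ⨾ block [.move 27 36, .add 29 28 19]

theorem runs_widths {s : State} (hL : d.Layout s) (h12 : s.reg 12 = d.q) (h13 : s.reg 13 = d.D) :
    Runs widths s fun K s' => K ≤ 3 * d.q + 3 * d.D + 3 * d.r + 20 ∧
      s'.reg 14 = (d.D * d.q : ℕ) ∧ s'.reg 15 = d.H ∧ s'.reg 16 = d.W ∧ s'.reg 17 = d.S ∧
      s'.reg 26 = (2 * d.D : ℕ) := by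
  refine Runs.seq (Runs.mul hL.r1 h12 (by norm_num) fun K hK => Runs.seq (Runs.mul (y := d.D) ?_ ?_
    (by norm_num) fun K' hK' => Runs.seq (Runs.instr (Runs.seq (Runs.mul (y := d.r + 1) ?_ ?_
    (by norm_num) fun K'' hK'' => Runs.block ⟨?_, ?_, ?_, ?_, ?_, ?_⟩)))))
  · simp [hL.r1]
  · simp [h13]
  · simp [hL.r1]
  · simp [hL.r1, hL.r4]
  · simp only [List.length_cons, List.length_nil]; omega
  · simp [h13]
  · simp [hL.r3, H]; ring
  · simp [hL.r3, hL.r1, H, W]; ring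
  · simp [hL.r4, S]
  · simp [h13]; ring

theorem runs_tableSize {s : State} (hL : d.Layout s) (h16 : s.reg 16 = d.W) (h17 : s.reg 17 = d.S) :
    Runs tableSize s fun K s' => K ≤ d.r * (3 * d.W + 6) + 3 * d.S + 6 ∧ s'.reg 18 = d.N ∧
      s'.reg 19 = (d.N * d.S : ℕ) := by
  refine Runs.seq (Runs.instr ?_)
  refine Runs.then (Runs.for (n := d.r) (K := 3 * d.W + 4) (fun j s' => s'.reg 18 = (d.W ^ j : ℕ))
    (by simp [hL.r1]) (by simp [hL.r4]) (by decide) (by simp) ?_) ?_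
  · rintro j hj s₁ hf₁ - h35 h18
    have f1 : s₁.reg 1 = 1 := by rw [hf₁ 1 rfl (by norm_num)]; simp [hL.r1]
    have f16 : s₁.reg 16 = d.W := by rw [hf₁ 16 rfl (by norm_num)]; simp [h16]
    refine Runs.seq (Runs.mul f1 f16 (by norm_num) fun K hK => Runs.instr ⟨by omega, ?_⟩)
    simp [h18, pow_succ]
  · rintro K₁ s₁ ⟨hK₁, h18, -⟩ hf₁ -
    refine Runs.mul (y := d.S) ?_ ?_ (by norm_num) fun K hK => ⟨?_, ?_, ?_⟩
    · rw [hf₁ 1 rfl]; simp [hL.r1]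
    · rw [hf₁ 17 rfl]; simp [h17]
    · rw [show 3 * d.W + 4 + 2 = 3 * d.W + 6 from rfl] at hK₁; omega
    · simp [h18, N]
    · simp [h18, N]

theorem runs_startOffset {s : State} (hL : d.Layout s) (h15 : s.reg 15 = d.H)
    (h16 : s.reg 16 = d.W) (h17 : s.reg 17 = d.S) (h19 : s.reg 19 = (d.N * d.S : ℕ)) :
    Runs startOffset s fun K s' => K ≤ d.r * (3 * d.W + 6) + 3 * d.S + 9 ∧
      s'.reg 27 = (d.idx d.mid * d.S : ℕ) ∧ s'.reg 29 = d.cell 1 0 := by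
  refine Runs.seq (Runs.instr ?_)
  refine Runs.then (Runs.for (n := d.r) (K := 3 * d.W + 4) (fun j s' => s'.reg 27 = d.enc d.mid j)
    (by simp [hL.r1]) (by simp [hL.r4]) (by decide) (by simp [enc]) ?_) ?_
  · rintro j hj s₁ hf₁ - h35 h27
    have f1 : s₁.reg 1 = 1 := by rw [hf₁ 1 rfl (by norm_num)]; simp [hL.r1]
    have f16 : s₁.reg 16 = d.W := by rw [hf₁ 16 rfl (by norm_num)]; simp [h16]
    have f15 : s₁.reg 15 = d.H := by rw [hf₁ 15 rfl (by norm_num)]; simp [h15]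
    refine Runs.seq (Runs.mul f1 f16 (by norm_num) fun K hK => Runs.instr ⟨by omega, ?_⟩)
    simp [h27, f15, enc, mid]
  · rintro K₁ s₁ ⟨hK₁, h27, -⟩ hf₁ -
    refine Runs.seq (Runs.mul (y := d.S) ?_ ?_ (by norm_num) fun K hK => Runs.block ⟨?_, ?_, ?_⟩)
    · rw [hf₁ 1 rfl]; simp [hL.r1]
    · rw [hf₁ 17 rfl]; simp [h17]
    · rw [show 3 * d.W + 4 + 2 = 3 * d.W + 6 from rfl] at hK₁
      simp only [List.length_cons, List.length_nil]; omega
    · simp [h27, ← (inRange_mid (d := d)).cast_idx]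
    · simp [hf₁ 28 rfl, hf₁ 19 rfl, hL.r28, h19, cell]

def params : Program := widths ⨾ tableSize ⨾ startOffset

theorem runs_params {s : State} (hL : d.Layout s) (h12 : s.reg 12 = d.q) (h13 : s.reg 13 = d.D) :
    Runs params s fun K s' => K ≤ 3 * d.q + 3 * d.D + 3 * d.r + 2 * (d.r * (3 * d.W + 6)) +
      6 * d.S + 35 ∧ d.Env s' ∧ s'.reg 28 = d.cell 0 0 ∧ s'.reg 29 = d.cell 1 0 := by
  refine Runs.then (runs_widths hL h12 h13) ?_
  rintro K₁ s₁ ⟨hK₁, h14, h15, h16, h17, h26⟩ hf₁ -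
  have hL₁ : d.Layout s₁ := hL.frame hf₁ (by decide)
  refine Runs.then (runs_tableSize hL₁ h16 h17) ?_
  rintro K₂ s₂ ⟨hK₂, h18, h19⟩ hf₂ -
  have hL₂ : d.Layout s₂ := hL₁.frame hf₂ (by decide)
  refine (runs_startOffset hL₂ (by rw [hf₂ 15 rfl, h15]) (by rw [hf₂ 16 rfl, h16])
    (by rw [hf₂ 17 rfl, h17]) h19).frame.mono ?_
  rintro K₃ s₃ ⟨⟨hK₃, h27, h29⟩, hf₃, -⟩
  have hL₃ : d.Layout s₃ := hL₂.frame hf₃ (by decide)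
  refine ⟨by omega, ⟨hL₃.r1, hL₃.r2, hL₃.r3, hL₃.r4, hL₃.r5, hL₃.r6, hL₃.r7, hL₃.r8, hL₃.r9, hL₃.r10,
    hL₃.r11, ?_, ?_, ?_, ?_, ?_, ?_, ?_, ?_, hL₃.r20, hL₃.r21, hL₃.r22, hL₃.r23, hL₃.r24, hL₃.r25, ?_,
    h27⟩, ?_, h29⟩
  · rw [hf₃ 12 rfl, hf₂ 12 rfl, hf₁ 12 rfl, h12]
  · rw [hf₃ 13 rfl, hf₂ 13 rfl, hf₁ 13 rfl, h13]
  · rw [hf₃ 14 rfl, hf₂ 14 rfl, h14]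
  · rw [hf₃ 15 rfl, hf₂ 15 rfl, h15]
  · rw [hf₃ 16 rfl, hf₂ 16 rfl, h16]
  · rw [hf₃ 17 rfl, hf₂ 17 rfl, h17]
  · rw [hf₃ 18 rfl, h18]
  · rw [hf₃ 19 rfl, h19]
  · rw [hf₃ 26 rfl, hf₂ 26 rfl, h26]
  · rw [hL₃.r28]; simp [cell]

/-- Write the shifted targets, and find out in `R_40` whether a right-hand side is out of reach. -/
def targets : Program :=
  .instr (.const 40 0) ⨾
  .for 38 4 (block [.add 36 9 38, .load 41 36, .add 36 7 38, .load 42 36] ⨾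
    cond (.eq 42 1) (.sub 41 2 41) ⨾ .instr (.add 41 41 14) ⨾ cond (.lt 41 2) (.const 40 1) ⨾
    block [.add 43 14 14, .move 44 41] ⨾ cond (.lt 43 41) (.move 41 43) ⨾
    cond (.ne 42 2) (.move 44 41) ⨾ cond (.ne 44 41) (.const 40 1) ⨾
    block [.add 36 25 38, .store 36 41])

/-- The right-hand side of row `k` can be reached. -/
def Reachable (d : FoldData) (k : ℕ) : Prop :=
  -(d.D * d.q : ℤ) ≤ d.rhs k ∧ (d.relG k = 0 → d.rhs k ≤ d.D * d.q)

theorem runs_targets {s : State} (hE : d.Env s) (hin : d.Input s.mem) :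
    Runs targets s fun K s' => K ≤ 24 * d.r + 3 ∧ (s'.reg 40 = 1 ↔ ¬ ∀ k < d.r, d.Reachable k) ∧
      (∀ k < d.r, s'.mem (d.aBS + k) = min (d.rhs k) (d.D * d.q) + d.D * d.q) ∧
      ∀ x, (x < d.aBS ∨ d.base ≤ x) → s'.mem x = s.mem x := by
  have e0 : d.aRG + d.r + d.n = d.aBG := rfl
  have e1 : d.aBG + d.r + d.n + d.n * d.t + 1 + d.n + d.r + d.r + d.r + d.r = d.aBS := rfl
  have e7 : d.aBS + d.r = d.base := rfl
  refine Runs.seq (Runs.instr ?_)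
  have hE' : d.Env ((Instr.const 40 0).run s) := hE.congr fun x hx => by
    simp only [run_const, State.set_reg]; rw [if_neg (by omega)]
  refine (Runs.for (n := d.r) (K := 22) (fun j s' =>
    (s'.reg 40 = 1 ↔ ¬ ∀ k < j, d.Reachable k) ∧
    (∀ k < j, s'.mem (d.aBS + k) = min (d.rhs k) (d.D * d.q) + d.D * d.q) ∧
    ∀ x, (x < d.aBS ∨ d.aBS + j ≤ x) → s'.mem x = s.mem x) hE'.r1 hE'.r4 (by decide) ?_ ?_).mono ?_
  · simp
  · rintro j hj s₁ hf₁ - h38 ⟨i40, ibs, ifr⟩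
    have hE₁ : d.Env s₁ := hE'.congr fun x hx => hf₁ x (by revert x; decide) (by omega)
    have a1 : ((d.aBG : ℤ) + j).toNat = d.aBG + j := by omega
    have a2 : ((d.aRG : ℤ) + j).toNat = d.aRG + j := by omega
    have a3 : ((d.aBS : ℤ) + j).toNat = d.aBS + j := by omega
    have g1 : s₁.mem (d.aBG + j) = d.bG j := by rw [ifr _ (by omega), hin.bG j hj]
    have g2 : s₁.mem (d.aRG + j) = d.relG j := by rw [ifr _ (by omega), hin.relG j hj]
    refine Runs.seq (Runs.block (Runs.seq (Runs.cond (Runs.seq (Runs.instr ?_)))))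
    refine Runs.then (Q' := fun K s₂ => K = 2 ∧ s₂.reg 41 = d.rhs j + d.D * d.q ∧
      s₂.reg 42 = d.relG j ∧
      (s₂.reg 40 = 1 ↔ (d.rhs j < -(d.D * d.q : ℤ) ∨ ¬ ∀ k < j, d.Reachable k)) ∧
      s₂.mem = s₁.mem ∧ s₂.reg 38 = j ∧ d.Env s₂) (Runs.cond ?_) ?_
    · have hrhs : (if d.relG j = 1 then -d.bG j else d.bG j) = d.rhs j := rfl
      refine ⟨rfl, ?_, ?_, ?_, ?_, ?_, ?_⟩
      · simp [h38, hE₁.r9, hE₁.r7, hE₁.r1, hE₁.r2, hE₁.r14, a1, a2, g1, g2, hrhs]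
      · simp [h38, hE₁.r7, a2, g2]
      · rw [← i40]
        simp [h38, hE₁.r9, hE₁.r7, hE₁.r1, hE₁.r2, hE₁.r14, a1, a2, g1, g2, hrhs]
        by_cases h : d.rhs j + d.D * d.q < 0
        · have : d.rhs j < -(d.D * d.q : ℤ) := by linarith
          simp [h, this]
        · have : ¬ d.rhs j < -(d.D * d.q : ℤ) := by linarith
          simp [this, not_lt.1 h]
      · simp
      · simp [h38]
      · refine hE₁.congr fun x hx => ?_
        simp only [List.foldl_cons, List.foldl_nil, run_add, run_load, run_sub, run_const,
          State.set_reg, State.select_reg]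
        have q1 : x ≠ 36 := by omega
        have q2 : x ≠ 40 := by omega
        have q3 : x ≠ 41 := by omega
        have q4 : x ≠ 42 := by omega
        simp only [if_neg q1, if_neg q2, if_neg q3, if_neg q4, ite_self]
    rintro K₂ s₂ ⟨rfl, h41, h42, h40, hm₂, h38', hE₂⟩ - -
    refine Runs.seq (Runs.block (Runs.seq (Runs.cond (Runs.seq (Runs.cond (Runs.seq (Runs.cond
      (Runs.block ?_))))))))
    have hcut : (if (d.D * d.q : ℤ) + d.D * d.q < d.rhs j + d.D * d.q then
        (d.D * d.q : ℤ) + d.D * d.q else d.rhs j + d.D * d.q) =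
        min (d.rhs j) (d.D * d.q) + d.D * d.q := by
      split_ifs with h
      · rw [min_eq_right (by linarith)]
      · rw [min_eq_left (by linarith)]
    refine ⟨by simp, ?_, fun k hk => ?_, fun x hx => ?_⟩
    · have key : (¬ ∀ k < j + 1, d.Reachable k) ↔
          ((d.relG j = 0 ∧ (d.D * d.q : ℤ) < d.rhs j) ∨
            (d.rhs j < -(d.D * d.q : ℤ) ∨ ¬ ∀ k < j, d.Reachable k)) := by
        have : (∀ k < j + 1, d.Reachable k) ↔ (d.Reachable j ∧ ∀ k < j, d.Reachable k) := by
          constructor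
          · exact fun h => ⟨h j (by omega), fun i hi => h i (by omega)⟩
          · rintro ⟨h1, h2⟩ i hi
            rcases Nat.lt_succ_iff_lt_or_eq.1 hi with hi | rfl
            · exact h2 i hi
            · exact h1
        rw [this, not_and_or, Reachable, not_and_or, Classical.not_imp, not_le, not_le]
        tauto
      rw [key, ← h40]
      simp only [List.foldl_cons, List.foldl_nil, run_store, run_add, run_move, run_const,
        State.put_reg, State.set_reg, State.select_reg, Test.Holds]
      simp only [Nat.reduceEqDiff, if_true, if_false, ite_self, h41, h42, hE₂.r2, hE₂.r14,
        Nat.cast_mul, hcut]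
      by_cases h0 : d.relG j = 0
      · by_cases hlt : (d.D * d.q : ℤ) < d.rhs j
        · have : ¬ (d.rhs j + d.D * d.q = min (d.rhs j) (d.D * d.q) + d.D * d.q) := by
            rw [min_eq_right hlt.le]; intro h; linarith
          simp [h0, hlt, this]
        · rw [min_eq_left (not_lt.1 hlt)]
          simp [hlt]
      · simp [h0]
    · simp only [List.foldl_cons, List.foldl_nil, run_store, run_add, run_move, run_const,
        State.set_reg, State.set_mem, State.put_mem, State.select_reg,
        State.select_mem, Test.Holds]
      simp only [Nat.reduceEqDiff, if_true, if_false, ite_self, h41, hE₂.r25, hE₂.r14,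
        Nat.cast_mul, hcut, h38', a3, hm₂]
      split_ifs with h
      · rw [show k = j by omega]
      · exact ibs k (by omega)
    · simp only [List.foldl_cons, List.foldl_nil, run_store, run_add, run_move, run_const,
        State.set_reg, State.set_mem, State.put_mem, State.select_reg,
        State.select_mem, Test.Holds]
      simp only [Nat.reduceEqDiff, if_true, if_false, ite_self, hE₂.r25, h38', a3, hm₂]
      rw [if_neg (by omega), ifr x (by omega)]
  · rintro K s' ⟨hK, ⟨i40, ibs, ifr⟩, -⟩
    exact ⟨by omega, i40, ibs, fun x hx => ifr x (by omega)⟩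

/-- Mark the centre in layer `0`. -/
def startCell : Program :=
  block [.add 45 28 27, .store 45 1, .const 30 4, .add 46 45 30] ⨾
  .for 49 4 (block [.add 47 46 49, .store 47 15])

theorem runs_startCell {s : State} (hE : d.Env s) (h28 : s.reg 28 = d.cell 0 0)
    (hfresh : ∀ x, d.base ≤ x → s.mem x = 0) :
    Runs startCell s fun K s' => K ≤ 5 * d.r + 7 ∧ d.Start s'.mem ∧
      ∀ x, (x < d.base ∨ d.cell 1 0 ≤ x) → s'.mem x = s.mem x := by
  have hS : d.S = d.r + 4 := rfl
  set p := d.cell 0 (d.idx d.mid) with hp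
  have hb : d.base ≤ p := base_le _ _
  have hp1 : p + d.S ≤ d.cell 1 0 := cell_add_le_succ (inRange_mid (d := d)).idx_lt
  have a0 : ((d.cell 0 0 : ℤ) + (d.idx d.mid : ℤ) * (d.S : ℤ)) = p := by
    rw [hp, cell_eq 0 (d.idx d.mid)]; push_cast; ring
  refine Runs.then (Q' := fun K s₁ => K = 5 ∧ s₁.reg 46 = (p + 4 : ℕ) ∧ s₁.mem p = 1 ∧
    ∀ x, x ≠ p → s₁.mem x = s.mem x) (Runs.block ?_) ?_
  · simp [h28, hE.r27, hE.r1, a0]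
    intro x hx hx'
    exact absurd hx' hx
  rintro K₁ s₁ ⟨rfl, h46, hmark, hfr⟩ hf₁ -
  have hE₁ : d.Env s₁ := hE.frame hf₁ (by decide)
  refine (Runs.for (n := d.r) (K := 3) (fun j s' => (∀ k < j, s'.mem (p + 4 + k) = d.H) ∧
    ∀ x, (x < p + 4 ∨ p + 4 + j ≤ x) → s'.mem x = s₁.mem x) hE₁.r1 hE₁.r4 (by decide) ?_ ?_).mono ?_
  · simp
  · rintro j hj s₂ hf₂ - h49 ⟨hd, hfr₂⟩
    have f46 : s₂.reg 46 = (p + 4 : ℕ) := by rw [hf₂ 46 rfl (by norm_num), h46]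
    have f15 : s₂.reg 15 = d.H := by rw [hf₂ 15 rfl (by norm_num), hE₁.r15]
    have a1 : ((p : ℤ) + 4 + j).toNat = p + 4 + j := by omega
    refine Runs.block ?_
    simp [f46, f15, h49, a1]
    refine ⟨fun k hk => ?_, fun x hx => ?_⟩
    · intro hne
      exact hd k (by omega)
    · rw [if_neg (by omega), hfr₂ x (by omega)]
  · rintro K s' ⟨hK, ⟨hd, hfr₂⟩, -⟩
    refine ⟨by omega, ⟨fun i hi => ?_, ?_, hd⟩, fun x hx => ?_⟩
    · have hbi := base_le (d := d) 0 i
      split_ifs with h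
      · rw [h, ← hp, hfr₂ _ (by omega), hmark]
      · rcases lt_or_gt_of_ne h with hlt | hgt
        · have : d.cell 0 i + d.S ≤ p := cell_add_le hlt
          rw [hfr₂ _ (by omega), hfr _ (by omega), hfresh _ hbi]
        · have : p + d.S ≤ d.cell 0 i := cell_add_le hgt
          rw [hfr₂ _ (by omega), hfr _ (by omega), hfresh _ hbi]
    -- The cost of the start is never written: unused memory already holds zero.
    · rw [hfr₂ _ (by omega), hfr _ (by omega), hfresh _ (by omega)]
    · rw [hfr₂ _ (by omega), hfr _ (by omega)]

end FoldData

/-! ### The whole program -/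

namespace FoldData

open RAM

variable {d : FoldData}

theorem Feasible.bL_nonneg {x : ℕ → ℕ} (hx : d.Feasible x) {i : ℕ} (hi : i < d.n) : 0 ≤ d.bL i :=
  le_trans (Finset.sum_nonneg fun _ _ => Nat.cast_nonneg _) (hx.local_le i hi)

theorem Exact.abs_vec (hX : d.Exact) {a k : ℕ} (hk : k < d.r) : |d.vec a k| ≤ d.D := by
  unfold vec
  split_ifs with h1 h2
  · rw [abs_neg]; exact hX.abs_T a h1 k hk
  · exact hX.abs_T a h1 k hk
  · simp

/-- The entries of a feasible solution sum to at most `q`, so no global row exceeds `D * q` in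
absolute value. This justifies rejecting an instance in `targets`. -/
theorem Feasible.reachable {x : ℕ → ℕ} (hx : d.Feasible x) (hX : d.Exact) {k : ℕ} (hk : k < d.r) :
    d.Reachable k := by
  have h1 : ∑ a ∈ Finset.range (d.n * d.t), (x a : ℤ) ≤ d.q := by
    rw [← hX.sum_bL, sum_range_mul]
    exact Finset.sum_le_sum fun i hi => hx.local_le i (Finset.mem_range.1 hi)
  have h2 : |∑ a ∈ Finset.range (d.n * d.t), d.vec a k * x a| ≤ d.D * d.q := by
    refine (Finset.abs_sum_le_sum_abs _ _).trans
      (le_trans ?_ (mul_le_mul_of_nonneg_left h1 (Nat.cast_nonneg _)))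
    rw [Finset.mul_sum]
    refine Finset.sum_le_sum fun a _ => ?_
    rw [abs_mul, Nat.abs_cast]
    exact mul_le_mul_of_nonneg_right (hX.abs_vec hk) (Nat.cast_nonneg _)
  obtain ⟨h3, h4⟩ := abs_le.1 h2
  exact ⟨h3.trans (hx.le k hk), fun h0 => (hx.eq k hk h0).symm.le.trans h4⟩

/-- The answer found in the final state. -/
def Solved (d : FoldData) (s : State) : Prop :=
  (s.reg 0 = 1 ∧ ∃ x, d.Feasible x ∧ (∀ y, d.Feasible y → d.value x ≤ d.value y) ∧
    ∀ p < d.n * d.t, s.mem p = x p) ∨ (s.reg 0 = 0 ∧ ¬ ∃ x, d.Feasible x)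

/-- Every feasible solution gives a path to the centre, so that cell is marked with at most its
value. The path read off from the cell gives a feasible solution of exactly the recorded cost, which
is therefore optimal. -/
theorem runs_finish_solved {s : State} (hE : d.Env s) (h : d.Valid) (ht : d.Table s.mem d.q)
    (h28 : s.reg 28 = d.cell d.q 0) :
    Runs finish s fun K s' => K ≤ 3 * (d.n * d.t) + 12 * d.q + 9 ∧ d.Solved s' := by
  have key : ∀ y, d.Feasible y → s.mem (d.cell d.q (d.idx d.mid)) = 1 ∧
      s.mem (d.cell d.q (d.idx d.mid) + 1) ≤ d.value y := fun y hy => by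
    obtain ⟨a, ha, hend, hc⟩ := hy.exists_path h
    rw [← hc, ← idx_congr (z := d.traj a d.q) (z' := d.mid) hend]
    exact ht.of_path le_rfl ha
  refine (runs_finish hE h ht h28).mono ?_
  rintro K s' ⟨hK, ⟨h0, hm⟩ | ⟨h0, hm, a, ha, hend, hc, hout⟩⟩
  · refine ⟨hK, .inr ⟨h0, fun ⟨y, hy⟩ => ?_⟩⟩
    have := (key y hy).1
    omega
  · exact ⟨hK, .inl ⟨h0, d.count a, h.feasible_count ha hend, fun y hy =>
      (value_count a).trans_le (hc.trans_le (key y hy).2), hout⟩⟩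

/-- The two early exits reject infeasible instances only, and what passes them satisfies `Valid`:
the first makes the shares nonnegative, the second bounds the targets. -/
def solve : Program :=
  readParams ⨾ sumLocal ⨾ .ite (.eq 40 1) (.instr (.const 0 0))
    (maxEntry ⨾ params ⨾ targets ⨾ .ite (.eq 40 1) (.instr (.const 0 0))
      (startCell ⨾ fill ⨾ finish))

def searchBound (d : FoldData) : ℕ :=
  5 * d.r + 7 + (d.q * (d.layerBound + 2) + 2) + (3 * (d.n * d.t) + 12 * d.q + 9)

def solveBound (d : FoldData) : ℕ :=
  3 * d.t + 3 * d.r + 28 + (8 * d.n + 5) + (10 * (d.n * d.t * d.r) + 6) +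
    (3 * d.q + 3 * d.D + 3 * d.r + 2 * (d.r * (3 * d.W + 6)) + 6 * d.S + 35) + (24 * d.r + 3) + 3 +
    d.searchBound

theorem runs_search {s : State} (hE : d.Env s) (h : d.Valid) (hin : d.Input s.mem)
    (h28 : s.reg 28 = d.cell 0 0) (h29 : s.reg 29 = d.cell 1 0)
    (hbs : ∀ k < d.r, s.mem (d.aBS + k) = d.tgt k + d.D * d.q)
    (hzero : ∀ x, d.aEnd < x → (x < d.aBS ∨ d.base ≤ x) → s.mem x = 0) :
    Runs (startCell ⨾ fill ⨾ finish) s fun K s' => K ≤ d.searchBound ∧ d.Solved s' := by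
  have e1 : d.aDef = d.aEnd + 1 := rfl
  have e2 : d.aAcc = d.aDef + d.n := rfl
  have e3 : d.aZero = d.aAcc + d.r + d.r + d.r := rfl
  have e4 : d.aBS = d.aZero + d.r := rfl
  have e5 : d.base = d.aBS + d.r := rfl
  have e6 : d.base ≤ d.cell 1 0 := base_le _ _
  refine Runs.then (runs_startCell hE h28 fun x hx => hzero x (by omega) (.inr hx)) ?_
  rintro K₁ s₁ ⟨hK₁, hst, hfr⟩ hf₁ -
  have hE₁ : d.Env s₁ := hE.frame hf₁ (by decide)
  have hw : d.Work s₁.mem 0 := by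
    refine ⟨hin.congr fun x hx => hfr x (by omega), fun i hi => ?_, fun k hk => ?_, fun k hk => ?_,
      fun k hk => ?_, ⟨hst, fun l hl => by omega, fun l hl => by omega⟩, fun x hx => ?_⟩
    · rw [hfr _ (by omega), hzero _ (by omega) (by omega)]; rfl
    · rw [hfr _ (by omega), hzero _ (by omega) (by omega)]; simp
    · rw [hfr _ (by omega), hzero _ (by omega) (by omega)]
    · rw [hfr _ (by omega), hbs k hk]
    · rw [zero_add] at hx
      rw [hfr _ (.inr hx), hzero _ (by omega) (by omega)]
  refine Runs.then (runs_fill hE₁ h hw (by rw [hf₁ 28 rfl, h28]) (by rw [hf₁ 29 rfl, h29])) ?_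
  rintro K₂ s₂ ⟨hK₂, hw₂, h28₂⟩ hf₂ -
  refine (runs_finish_solved (hE₁.frame hf₂ (by decide)) h hw₂.table h28₂).mono ?_
  rintro K₃ s₃ ⟨hK₃, hs⟩
  exact ⟨by unfold searchBound; omega, hs⟩

theorem runs_solve {s : State} (h0 : s.mem 0 = d.n) (h1 : s.mem 1 = d.r) (h2 : s.mem 2 = d.t)
    (hin : d.Input s.mem) (hzero : ∀ x, d.aEnd < x → s.mem x = 0)
    (hrel : ∀ i < d.n, d.relL i = 0 ∨ d.relL i = -1)
    (hX : (∀ i < d.n, 0 ≤ d.bL i) → d.Exact) :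
    Runs solve s fun K s' => K ≤ d.solveBound ∧ d.Solved s' := by
  have e1 : d.aBS = d.aEnd + 1 + d.n + d.r + d.r + d.r + d.r := rfl
  have e5 : d.base = d.aBS + d.r := rfl
  refine Runs.then (runs_readParams h0 h1 h2) ?_
  rintro K₁ s₁ ⟨hK₁, hL₁⟩ - hm₁
  have hm₁ := hm₁ rfl
  rw [← hm₁] at hin hzero
  refine Runs.then (runs_sumLocal hL₁ hin) ?_
  rintro K₂ s₂ ⟨hK₂, h12, h40⟩ hf₂ hm₂
  have hm₂ := hm₂ rfl
  have hL₂ : d.Layout s₂ := hL₁.frame hf₂ (by decide)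
  rw [← hm₂] at hin hzero
  refine Runs.ite (fun hc => Runs.instr ?_) fun hc => ?_
  · refine ⟨by unfold solveBound; omega, .inr ⟨rfl, fun ⟨x, hx⟩ => ?_⟩⟩
    rw [Test.Holds, hL₂.r1] at hc
    exact h40.1 hc fun i hi => hx.bL_nonneg hi
  rw [Test.Holds, hL₂.r1, h40, not_not] at hc
  have hX := hX hc
  rw [hX.sum_bL] at h12
  refine Runs.then (runs_maxEntry hL₂ hin hX) ?_
  rintro K₃ s₃ ⟨hK₃, h13⟩ hf₃ hm₃
  have hm₃ := hm₃ rfl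
  have hL₃ : d.Layout s₃ := hL₂.frame hf₃ (by decide)
  rw [← hm₃] at hin hzero
  refine Runs.then (runs_params hL₃ (by rw [hf₃ 12 rfl, h12]) h13) ?_
  rintro K₄ s₄ ⟨hK₄, hE, h28, h29⟩ - hm₄
  have hm₄ := hm₄ rfl
  rw [← hm₄] at hin hzero
  refine Runs.then (runs_targets hE hin) ?_
  rintro K₅ s₅ ⟨hK₅, h40', hbs, hfr⟩ hf₅ -
  have hE₅ : d.Env s₅ := hE.frame hf₅ (by decide)
  refine Runs.ite (fun hc' => Runs.instr ?_) fun hc' => ?_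
  · refine ⟨by unfold solveBound; omega, .inr ⟨rfl, fun ⟨x, hx⟩ => ?_⟩⟩
    rw [Test.Holds, hE₅.r1] at hc'
    exact h40'.1 hc' fun k hk => hx.reachable hX hk
  rw [Test.Holds, hE₅.r1, h40', not_not] at hc'
  have hV : d.Valid := ⟨hc, hX.sum_bL, hX.abs_T, fun k hk => (hc' k hk).1, fun k hk => (hc' k hk).2,
    hrel⟩
  refine (runs_search hE₅ hV (hin.congr fun x hx => hfr x (by omega)) (by rw [hf₅ 28 rfl, h28])
    (by rw [hf₅ 29 rfl, h29]) (fun k hk => ?_) fun x hx hx' => ?_).mono ?_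
  · rw [hbs k hk, tgt]
    split_ifs with h
    · rw [min_eq_left ((hc' k hk).2 h)]
    · rfl
  · rw [hfr x hx', hzero x hx]
  · rintro K s' ⟨hK, hs⟩
    exact ⟨by unfold solveBound; omega, hs⟩

/-- The dominant contribution is `q` layers of `N` cells with at most `t + 1` items, each at cost
`O(r * W)`. All other terms are absorbed because every parameter is at least one and `n` and `D` are
at most `W`. The constant is generous. -/
theorem solveBound_le (hn : 1 ≤ d.n) (hr : 1 ≤ d.r) (ht : 1 ≤ d.t) (hq : 1 ≤ d.q) (hD : 1 ≤ d.D) :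
    d.solveBound ≤ 2000 * (d.q * d.r * d.t * d.W ^ (d.r + 1)) := by
  have hW : d.W = 4 * d.n * (d.r + 1) * d.D + 1 := by unfold W H; ring
  have nW : d.n ≤ d.W := by
    rw [hW]; nlinarith [Nat.le_mul_of_pos_right d.n (Nat.mul_pos (Nat.succ_pos d.r) hD)]
  have DW : d.D ≤ d.W := by
    rw [hW]; nlinarith [Nat.le_mul_of_pos_left d.D (Nat.mul_pos hn (Nat.succ_pos d.r))]
  have W1 : 1 ≤ d.W := W_pos
  have N1 : 1 ≤ d.N := N_pos
  have e : d.q * d.r * d.t * d.W ^ (d.r + 1) = d.q * d.r * d.t * d.N * d.W := by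
    rw [pow_succ, N, mul_assoc (d.q * d.r * d.t)]
  rw [e]
  set P := d.q * d.r * d.t * d.N * d.W with hP
  have h0 : 1 ≤ P := by
    calc 1 = 1 * 1 * 1 * 1 * 1 := rfl
      _ ≤ P := by rw [hP]; gcongr
  have h1 : d.t ≤ P := by
    calc d.t = 1 * 1 * d.t * 1 * 1 := by ring
      _ ≤ P := by rw [hP]; gcongr
  have h2 : d.r * d.W ≤ P := by
    calc d.r * d.W = 1 * d.r * 1 * 1 * d.W := by ring
      _ ≤ P := by rw [hP]; gcongr
  have h2' : d.r ≤ d.r * d.W := Nat.le_mul_of_pos_right _ W1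
  have h3 : d.q ≤ P := by
    calc d.q = d.q * 1 * 1 * 1 * 1 := by ring
      _ ≤ P := by rw [hP]; gcongr
  have h4 : d.q * d.r * d.W ≤ P := by
    calc d.q * d.r * d.W = d.q * d.r * 1 * 1 * d.W := by ring
      _ ≤ P := by rw [hP]; gcongr
  have h5 : d.n * d.t * d.r ≤ P := by
    calc d.n * d.t * d.r = 1 * d.r * d.t * 1 * d.n := by ring
      _ ≤ P := by rw [hP]; gcongr
  have h6 : d.n * d.t ≤ d.n * d.t * d.r := Nat.le_mul_of_pos_right _ hr
  have h7 : d.n ≤ d.n * d.t := Nat.le_mul_of_pos_right _ ht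
  have h8 : d.W ≤ d.r * d.W := Nat.le_mul_of_pos_left _ hr
  have h9 : d.q * (d.N * ((d.t + 1) * (d.r * (3 * d.W + 49) + 63) + 7)) ≤ 237 * P := by
    have a1 : d.r * (3 * d.W + 49) + 63 ≤ 115 * (d.r * d.W) := by nlinarith
    have a2 : (d.t + 1) * (d.r * (3 * d.W + 49) + 63) ≤ 2 * d.t * (115 * (d.r * d.W)) := by
      gcongr; omega
    have a3 : 1 ≤ d.t * (d.r * d.W) := Nat.mul_pos ht (Nat.mul_pos hr W1)
    calc _ ≤ d.q * (d.N * (237 * (d.t * (d.r * d.W)))) := by gcongr; linarith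
      _ = 237 * P := by rw [hP]; ring
  have h10 : d.q * (d.r * (12 * d.D + 15)) ≤ 27 * P := by
    calc _ ≤ d.q * (d.r * (27 * d.W)) := by gcongr; omega
      _ = 27 * (d.q * d.r * d.W) := by ring
      _ ≤ 27 * P := by gcongr
  have h11 : d.q * d.n ≤ P := by
    calc d.q * d.n = d.q * 1 * 1 * 1 * d.n := by ring
      _ ≤ P := by rw [hP]; gcongr
  have h12 : d.q * d.t ≤ P := by
    calc d.q * d.t = d.q * 1 * d.t * 1 * 1 := by ring
      _ ≤ P := by rw [hP]; gcongr
  have h13 : d.q * (d.layerBound + 2) = d.q * (d.N * ((d.t + 1) * (d.r * (3 * d.W + 49) + 63) + 7)) +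
      d.q * (d.r * (12 * d.D + 15)) + 11 * (d.q * d.n) + 3 * (d.q * d.t) + 32 * d.q := by
    unfold layerBound; ring
  have h14 : d.r * (3 * d.W + 6) = 3 * (d.r * d.W) + 6 * d.r := by ring
  have h15 : d.S = d.r + 4 := rfl
  unfold solveBound searchBound
  rw [h13, h14, h15]
  omega

end FoldData

/-! ### Reading the input word -/

theorem List.getD_append_mid {l₁ l₂ l₃ : List ℤ} {m x : ℕ} (hm : l₁.length = m)
    (hx : x < l₂.length) : (l₁ ++ (l₂ ++ l₃)).getD (m + x) 0 = l₂.getD x 0 := by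
  rw [List.getD_append_right _ _ _ _ (by omega), hm, Nat.add_sub_cancel_left,
    List.getD_append _ _ _ _ hx]

theorem List.getD_ofFn {n : ℕ} (f : Fin n → ℤ) (i : Fin n) : (List.ofFn f).getD i 0 = f i := by
  rw [List.getD_eq_getElem _ _ (by simp)]
  simp

theorem List.length_flatten_ofFn {n m : ℕ} {f : Fin n → List ℤ} (hf : ∀ i, (f i).length = m) :
    (List.ofFn f).flatten.length = n * m := by
  induction n with
  | zero => simp
  | succ n ih =>
    rw [List.ofFn_succ, List.flatten_cons, List.length_append, ih fun i => hf _, hf]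
    ring

theorem List.getD_flatten_ofFn {n m : ℕ} {f : Fin n → List ℤ} (hf : ∀ i, (f i).length = m)
    (i : Fin n) {j : ℕ} (hj : j < m) : (List.ofFn f).flatten.getD (i * m + j) 0 = (f i).getD j 0 := by
  induction n with
  | zero => exact i.elim0
  | succ n ih =>
    rw [List.ofFn_succ, List.flatten_cons]
    refine Fin.cases ?_ (fun i => ?_) i
    · rw [List.getD_append _ _ _ _ (by rw [hf]; simpa using hj)]
      simp
    · rw [List.getD_append_right _ _ _ _ (by rw [hf, Fin.val_succ]; nlinarith), hf, Fin.val_succ,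
        ← ih (fun i => hf _)]
      congr 1
      rw [add_mul, one_mul]
      omega

/-! ### Translating the instance. -/

namespace NFold

variable (I : NFold)

/-- The largest absolute value of an entry of a top block. -/
def maxTop : ℕ :=
  Finset.univ.sup fun p : Fin I.r × Fin I.n × Fin I.t => (I.T p.2.1 p.1 p.2.2).natAbs

theorem le_maxTop (i : Fin I.n) (j : Fin I.t) (k : Fin I.r) : (I.T i k j).natAbs ≤ I.maxTop :=
  Finset.le_sup (f := fun p : Fin I.r × Fin I.n × Fin I.t => (I.T p.2.1 p.1 p.2.2).natAbs)
    (Finset.mem_univ (k, i, j))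

theorem exists_eq_maxTop (h : 1 ≤ I.maxTop) : ∃ i k j, (I.T i k j).natAbs = I.maxTop := by
  have hne : (Finset.univ : Finset (Fin I.r × Fin I.n × Fin I.t)).Nonempty := by
    refine Finset.nonempty_iff_ne_empty.2 fun h0 => ?_
    rw [maxTop, h0] at h
    simp at h
  obtain ⟨p, -, hp⟩ := Finset.exists_mem_eq_sup _ hne fun p => (I.T p.2.1 p.1 p.2.2).natAbs
  exact ⟨p.2.1, p.1, p.2.2, hp.symm⟩

/-- The data read off the input word. -/
def data : FoldData where
  n := I.n
  r := I.r
  t := I.t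
  q := I.q.toNat
  D := max 1 I.maxTop
  T a k := I.encode.getD (3 + a * I.r + k) 0
  relG k := I.encode.getD (3 + I.n * I.t * I.r + k) 0
  relL i := I.encode.getD (3 + I.n * I.t * I.r + I.r + i) 0
  bG k := I.encode.getD (3 + I.n * I.t * I.r + I.r + I.n + k) 0
  bL i := I.encode.getD (3 + I.n * I.t * I.r + I.r + I.n + I.r + i) 0
  c a := I.encode.getD (3 + I.n * I.t * I.r + I.r + I.n + I.r + I.n + a) 0

theorem index_lt {n t : ℕ} (i : Fin n) (j : Fin t) : (i * t + j : ℕ) < n * t :=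
  FoldData.index_lt i.2 j.2

theorem length_entries : (List.ofFn fun i => (List.ofFn fun j => List.ofFn fun k =>
    I.T i k j).flatten).flatten.length = I.n * (I.t * I.r) :=
  List.length_flatten_ofFn fun _ => List.length_flatten_ofFn fun _ => by simp

theorem length_encode : I.encode.length = I.data.aEnd := by
  simp only [encode, List.length_append, length_entries, List.length_ofFn, List.length_cons,
    List.length_nil, List.length_flatten_ofFn (m := I.t) (f := fun i => List.ofFn fun j => I.c (i, j))
    fun _ => by simp]
  simp only [FoldData.aEnd, FoldData.aC, FoldData.aBL, FoldData.aBG, FoldData.aRL, FoldData.aRG, data,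
    mul_assoc]

theorem data_T (i : Fin I.n) (j : Fin I.t) (k : Fin I.r) :
    I.data.T (i * I.t + j) k = I.T i k j := by
  have h : 3 + (i * I.t + j) * I.r + k = 3 + (i * (I.t * I.r) + (j * I.r + k)) := by ring
  have hjk : (j * I.r + k : ℕ) < I.t * I.r := index_lt j k
  simp only [data, encode, List.append_assoc, h]
  rw [List.getD_append_mid (by simp) (by rw [length_entries]; exact index_lt i ⟨_, hjk⟩),
    List.getD_flatten_ofFn (fun _ => List.length_flatten_ofFn fun _ => by simp) i hjk,
    List.getD_flatten_ofFn (fun _ => by simp) j k.2, List.getD_ofFn]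

theorem data_relG (k : Fin I.r) : I.data.relG k = (I.rel (Sum.inl k)).code := by
  simp only [data, encode]
  rw [List.append_assoc, List.append_assoc, List.append_assoc, List.append_assoc,
    List.getD_append_mid (by
      simp only [List.length_append, length_entries, List.length_cons, List.length_nil, mul_assoc])
    (by simp), List.getD_ofFn]

theorem data_relL (i : Fin I.n) : I.data.relL i = (I.rel (Sum.inr i)).code := by
  simp only [data, encode]
  rw [List.append_assoc, List.append_assoc, List.append_assoc,
    List.getD_append_mid (by
      simp only [List.length_append, length_entries, List.length_ofFn, List.length_cons,
        List.length_nil, mul_assoc]) (by simp), List.getD_ofFn]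

theorem data_bG (k : Fin I.r) : I.data.bG k = I.b (Sum.inl k) := by
  simp only [data, encode]
  rw [List.append_assoc, List.append_assoc,
    List.getD_append_mid (by
      simp only [List.length_append, length_entries, List.length_ofFn, List.length_cons,
        List.length_nil, mul_assoc]) (by simp), List.getD_ofFn]

theorem data_bL (i : Fin I.n) : I.data.bL i = I.b (Sum.inr i) := by
  simp only [data, encode]
  rw [List.append_assoc,
    List.getD_append_mid (by
      simp only [List.length_append, length_entries, List.length_ofFn, List.length_cons,
        List.length_nil, mul_assoc]) (by simp), List.getD_ofFn]

theorem data_c (i : Fin I.n) (j : Fin I.t) : I.data.c (i * I.t + j) = I.c (i, j) := by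
  simp only [data, encode]
  rw [← List.append_nil (List.ofFn fun i => List.ofFn fun j => I.c (i, j)).flatten,
    List.getD_append_mid (by
      simp only [List.length_append, length_entries, List.length_ofFn, List.length_cons,
        List.length_nil, mul_assoc])
    (by
      rw [List.length_flatten_ofFn (m := I.t) (fun _ => by simp)]
      exact index_lt i j),
    List.getD_flatten_ofFn (fun _ => by simp) i j.2, List.getD_ofFn]

/-- The data are defined by lookup in the input word, so they agree with the initial memory by
definition; past the end of the word the default value `0` is read. -/
theorem input_encode : I.data.Input (RAM.init I.encode).mem := by
  refine ⟨fun _ _ _ _ => rfl, fun _ _ => rfl, fun _ _ => rfl, fun _ _ => rfl, fun _ _ => rfl,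
    fun _ _ => rfl, ?_⟩
  exact List.getD_eq_default _ _ I.length_encode.le

/-! ### Solutions -/

theorem sum_range_index {n t : ℕ} (F : ℕ → ℤ) :
    ∑ a ∈ Finset.range (n * t), F a = ∑ i : Fin n, ∑ j : Fin t, F (i * t + j) := by
  rw [FoldData.sum_range_mul, Finset.sum_range]
  exact Finset.sum_congr rfl fun i _ => Finset.sum_range _

/-- The vector indexed by brick and position. -/
def bricks (y : ℕ → ℕ) (p : Fin I.n × Fin I.t) : ℤ := y (p.1 * I.t + p.2)

theorem mulVec_inl (y : ℕ → ℕ) (k : Fin I.r) :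
    I.A.mulVec (I.bricks y) (Sum.inl k) =
      ∑ a ∈ Finset.range (I.n * I.t), I.data.T a k * y a := by
  rw [sum_range_index]
  simp only [data_T]
  simp [A, Matrix.mulVec, dotProduct, Fintype.sum_prod_type, bricks]

theorem mulVec_inr (y : ℕ → ℕ) (i : Fin I.n) :
    I.A.mulVec (I.bricks y) (Sum.inr i) = ∑ j ∈ Finset.range I.t, (y (i * I.t + j) : ℤ) := by
  rw [Finset.sum_range]
  simp [A, Matrix.mulVec, dotProduct, Fintype.sum_prod_type, bricks]

theorem sum_vec (y : ℕ → ℕ) (k : ℕ) :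
    ∑ a ∈ Finset.range (I.data.n * I.data.t), I.data.vec a k * y a =
      if I.data.relG k = 1 then -∑ a ∈ Finset.range (I.n * I.t), I.data.T a k * y a
      else ∑ a ∈ Finset.range (I.n * I.t), I.data.T a k * y a := by
  have : ∀ a ∈ Finset.range (I.data.n * I.data.t), I.data.vec a k * y a =
      if I.data.relG k = 1 then -(I.data.T a k * y a) else I.data.T a k * y a := fun a ha => by
    rw [FoldData.vec, if_pos (Finset.mem_range.1 ha)]
    split_ifs
    · rw [neg_mul]
    · rfl
  rw [Finset.sum_congr rfl this]
  split_ifs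
  · rw [Finset.sum_neg_distrib]; rfl
  · rfl

theorem feasible_iff (y : ℕ → ℕ) : I.data.Feasible y ↔ I.Feasible (I.bricks y) := by
  have hG : ∀ k : Fin I.r, ((I.data.relG k = 0 →
      ∑ a ∈ Finset.range (I.data.n * I.data.t), I.data.vec a k * y a = I.data.rhs k) ∧
      ∑ a ∈ Finset.range (I.data.n * I.data.t), I.data.vec a k * y a ≤ I.data.rhs k) ↔
      (I.rel (Sum.inl k)).Holds (I.A.mulVec (I.bricks y) (Sum.inl k)) (I.b (Sum.inl k)) := fun k => by
    rw [sum_vec, mulVec_inl, FoldData.rhs, data_relG, data_bG]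
    cases I.rel (Sum.inl k) <;> simp [ConstraintRel.code, ConstraintRel.Holds]
    exact le_of_eq
  have hL : ∀ i : Fin I.n, ((I.data.relL i = 0 →
      ∑ j ∈ Finset.range I.data.t, (y (i * I.data.t + j) : ℤ) = I.data.bL i) ∧
      ∑ j ∈ Finset.range I.data.t, (y (i * I.data.t + j) : ℤ) ≤ I.data.bL i) ↔
      (I.rel (Sum.inr i)).Holds (I.A.mulVec (I.bricks y) (Sum.inr i)) (I.b (Sum.inr i)) := fun i => by
    rw [mulVec_inr, data_relL, data_bL, show I.data.t = I.t from rfl]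
    have := I.rel_local i
    cases h : I.rel (Sum.inr i)
    · simp [ConstraintRel.code, ConstraintRel.Holds]
    · simp [ConstraintRel.code, ConstraintRel.Holds]
      exact le_of_eq
    · exact absurd h this
  constructor
  · refine fun h => ⟨fun p => Nat.cast_nonneg _, fun i => ?_⟩
    rcases i with k | i
    · exact (hG k).1 ⟨h.eq k k.2, h.le k k.2⟩
    · exact (hL i).1 ⟨h.local_eq i i.2, h.local_le i i.2⟩
  · exact fun h => ⟨fun k hk => ((hG ⟨k, hk⟩).2 (h.2 _)).1, fun k hk => ((hG ⟨k, hk⟩).2 (h.2 _)).2,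
      fun i hi => ((hL ⟨i, hi⟩).2 (h.2 _)).1, fun i hi => ((hL ⟨i, hi⟩).2 (h.2 _)).2⟩

theorem value_eq (y : ℕ → ℕ) : I.data.value y = I.c ⬝ᵥ I.bricks y := by
  rw [FoldData.value]
  change ∑ a ∈ Finset.range (I.n * I.t), _ = _
  rw [sum_range_index]
  simp only [data_c]
  simp [dotProduct, Fintype.sum_prod_type, bricks]

variable {I} in
theorem Feasible.exists_bricks {x : Fin I.n × Fin I.t → ℤ} (hx : I.Feasible x) :
    ∃ y, I.bricks y = x := by
  refine ⟨fun a => ((List.ofFn fun i => List.ofFn fun j => x (i, j)).flatten.getD a 0).toNat, ?_⟩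
  ext ⟨i, j⟩
  rw [bricks, List.getD_flatten_ofFn (fun _ => by simp) i j.2, List.getD_ofFn,
    Int.toNat_of_nonneg (hx.1 _)]

theorem answers_of_solved {s : RAM.State} (h : I.data.Solved s) : I.Answers s := by
  rcases h with ⟨h0, x, hx, hmin, hout⟩ | ⟨h0, hno⟩
  · have : I.output s = I.bricks x := by
      ext ⟨i, j⟩
      exact hout _ (index_lt i j)
    refine .inl ⟨h0, this ▸ ⟨(I.feasible_iff x).1 hx, fun y hy => ?_⟩⟩
    obtain ⟨z, rfl⟩ := hy.exists_bricks
    rw [← value_eq, ← value_eq]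
    exact hmin z ((I.feasible_iff z).2 hy)
  · refine .inr ⟨h0, fun ⟨y, hy⟩ => hno ?_⟩
    obtain ⟨z, rfl⟩ := hy.exists_bricks
    exact ⟨z, (I.feasible_iff z).2 hy⟩

/-! ### The parameters of the instance and the running time. -/

theorem sum_bL : ∑ i ∈ Finset.range I.n, I.data.bL i = I.q := by
  rw [Finset.sum_range]
  simp only [data_bL]
  rfl

/-- Nonnegativity matters because `q` is truncated to a natural number in the data; otherwise the
truncation could differ from the sum. -/
theorem exact_data (h : ∀ i < I.n, 0 ≤ I.data.bL i) : I.data.Exact where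
  one_le := le_max_left _ _
  abs_T a ha k hk := by
    have ht : 0 < I.t := Nat.pos_of_ne_zero fun h0 => by simp [data, h0] at ha
    have hi : a / I.t < I.n := (Nat.div_lt_iff_lt_mul ht).2 ha
    have hT := I.data_T ⟨_, hi⟩ ⟨_, Nat.mod_lt a ht⟩ ⟨k, hk⟩
    rw [show a / I.t * I.t + a % I.t = a from Nat.div_add_mod' a I.t] at hT
    rw [hT, Int.abs_eq_natAbs]
    exact_mod_cast le_max_of_le_right (I.le_maxTop _ _ _)
  attained := by
    rcases le_total I.maxTop 1 with h1 | h1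
    · exact .inl (max_eq_left h1)
    · obtain ⟨i, k, j, h⟩ := I.exists_eq_maxTop h1
      refine .inr ⟨_, index_lt i j, k, k.2, ?_⟩
      rw [data_T, Int.abs_eq_natAbs, h, ← max_eq_right h1]
      rfl
  sum_bL := by
    refine I.sum_bL.trans (Int.toNat_of_nonneg ?_).symm
    rw [← sum_bL]
    exact Finset.sum_nonneg fun i hi => h i (Finset.mem_range.1 hi)

/-- The local rows contain entries `1`, so `Δ` is at least one as soon as there is a variable; this
covers the `max 1` in `D`. -/
theorem data_D_le (hn : 1 ≤ I.n) (ht : 1 ≤ I.t) : I.data.D ≤ I.Δ := by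
  refine max_le ?_ (Finset.sup_le fun p _ => ?_)
  · refine le_trans ?_ (Finset.le_sup (f := fun p : (Fin I.r ⊕ Fin I.n) × (Fin I.n × Fin I.t) =>
      (I.A p.1 p.2).natAbs) (Finset.mem_univ (Sum.inr ⟨0, hn⟩, (⟨0, hn⟩, ⟨0, ht⟩))))
    simp [A]
  · refine le_trans ?_ (Finset.le_sup (f := fun p : (Fin I.r ⊕ Fin I.n) × (Fin I.n × Fin I.t) =>
      (I.A p.1 p.2).natAbs) (Finset.mem_univ (Sum.inl p.1, p.2)))
    simp [A]

/-- Once the summand `1` of `W` is absorbed into `D`, the claim becomes `4 * n * r + 4 * n + 1 ≤ (n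
+ 1) * (n + 2 + 4 * r)`; the difference of the two sides is `n ^ 2 - n + 1 + 4 * r`. -/
theorem W_le (hn : 1 ≤ I.n) (ht : 1 ≤ I.t) :
    I.data.W ≤ (I.n + 1) * I.Δ * (I.n + 2 + 4 * I.r) := by
  have hD := I.data_D_le hn ht
  have h1 : 1 ≤ I.data.D := le_max_left _ _
  have hW : I.data.W = 4 * I.n * (I.r + 1) * I.data.D + 1 := by
    unfold FoldData.W FoldData.H
    change 2 * (2 * I.n * (I.r + 1) * I.data.D) + 1 = _
    ring
  calc I.data.W ≤ 4 * I.n * (I.r + 1) * I.data.D + I.data.D := by rw [hW]; gcongr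
    _ = (4 * I.n * I.r + 4 * I.n + 1) * I.data.D := by ring
    _ ≤ ((I.n + 1) * (I.n + 2 + 4 * I.r)) * I.Δ := by
        refine Nat.mul_le_mul ?_ hD
        nlinarith [sq_nonneg ((I.n : ℤ) - 1)]
    _ = (I.n + 1) * I.Δ * (I.n + 2 + 4 * I.r) := by ring

theorem steps_le (hq : 1 ≤ I.q) (hr : 1 ≤ I.r) (ht : 1 ≤ I.t) :
    (I.data.solveBound : ℤ) ≤ 2000 * (I.q * I.r * I.t *
      (((I.n : ℤ) + 1) * I.Δ * (I.n + 2 + 4 * I.r)) ^ (I.r + 1)) := by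
  -- Without bricks the sum `q` would be empty.
  have hn : 1 ≤ I.n := Nat.one_le_iff_ne_zero.2 fun h0 => by
    rw [← sum_bL, h0] at hq
    simp at hq
  have hq' : (I.data.q : ℤ) = I.q := Int.toNat_of_nonneg (by omega)
  have h := FoldData.solveBound_le (d := I.data) hn hr ht (by omega) (le_max_left _ _)
  rw [← hq']
  calc (I.data.solveBound : ℤ)
      ≤ (2000 * (I.data.q * I.r * I.t * I.data.W ^ (I.r + 1)) : ℕ) := by exact_mod_cast h
    _ ≤ (2000 * (I.data.q * I.r * I.t * ((I.n + 1) * I.Δ * (I.n + 2 + 4 * I.r)) ^ (I.r + 1)) : ℕ) := by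
        have := I.W_le hn ht
        exact_mod_cast by gcongr
    _ = _ := by push_cast; ring

end NFold

theorem mainTheorem4 :
    ∃ (P : RAM.Program) (C : ℕ), ∀ I : NFold,
      ∃ (k : ℕ) (s : RAM.State),
        RAM.Exec P (RAM.init I.encode) k s ∧ I.Answers s ∧
          (1 ≤ I.q → 1 ≤ I.r → 1 ≤ I.t →
            (k : ℤ) ≤ C * (I.q * I.r * I.t *
              (((I.n : ℤ) + 1) * I.Δ * (I.n + 2 + 4 * I.r)) ^ (I.r + 1))) := by
  refine ⟨FoldData.solve, 2000, fun I => ?_⟩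
  obtain ⟨k, s, hrun, hk, hs⟩ := FoldData.runs_solve (d := I.data) (s := RAM.init I.encode)
    rfl rfl rfl I.input_encode
    (fun x hx => List.getD_eq_default _ _ (I.length_encode.trans_le hx.le))
    (fun i hi => by
      have h := I.rel_local ⟨i, hi⟩
      have e : I.data.relL i = _ := I.data_relL ⟨i, hi⟩
      rw [e]
      cases h' : I.rel (Sum.inr ⟨i, hi⟩)
      · exact .inr rfl
      · exact .inl rfl
      · exact absurd h' h)
    I.exact_data
  exact ⟨k, s, hrun, I.answers_of_solved hs, fun hq hr ht =>
    (Nat.cast_le.2 hk).trans (I.steps_le hq hr ht)⟩
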